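/- Let $d\ge 1$, let $\Omega\subset\mathbb R^d$ be a nonempty bounded open set (for instance a bounded domain with smooth boundary), and let $$A=\begin{pmatrix}1&0\\0&2\end{pmatrix},\qquad D=\begin{pmatrix}1&2\\2&4\end{pmatrix}.$$ These matrices are symmetric positive semi-definite, $\det D=0$, $\operatorname{rank}(D,AD)=2$ and $\|AD-DA\|=2$ (Euclidean operator norm). For $U=(u,v)^T$ consider the systems in $(0,\infty)\times\Omega$ 1. $U''-\Delta U+AU+DU'=0$, with $U=0$ on $\partial\Omega$ (viscously damped waves); 2. $U''+\Delta^2U+AU+DU'=0$, with $U=\partial_\nu U=0$ on $\partial\Omega$ (viscously damped plates); 3. $U''-\Delta U+AU-D\Delta U'=0$, with $U=0$ on $\partial\Omega$ (Kelvin–Voigt damped waves). They are understood in variational form. Let $H_0=L^2(\Omega)$ and let $H_1=H^1_0(\Omega)$ in cases 1 and 3, $H_1=H^2_0(\Omega)$ in case 2 (complex-valued functions). Let $L:H_1\to H_1^*$ be given by $\langle Lu,\phi\rangle=\int_\Omega\nabla u\cdot\nabla\bar\phi\,dx$ in cases 1 and 3 and $\langle Lu,\phi\rangle=\int_\Omega\Delta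 u\,\Delta\bar\phi\,dx$ in case 2. Let $B=I$ in cases 1 and 2 and $B=L$ in case 3. On $\mathcal H=H_1^2\times H_0^2$ with its Hilbert norm put $$\mathcal A(U,V)=(V,\,-(LU+AU+DBV)),\qquad \mathfrak D(\mathcal A)=\{(U,V)\in H_1^2\times H_1^2:\ LU+AU+DBV\in H_0^2\},$$ with the graph norm $\|X\|_{\mathfrak D(\mathcal A)}=\|X\|_{\mathcal H}+\|\mathcal AX\|_{\mathcal H}$. A classical solution is $X\in C^1([0,\infty);\mathcal H)$ with $X(t)\in\mathfrak D(\mathcal A)$ and $X'(t)=\mathcal AX(t)$ for all $t\ge 0$. In each of the three cases the following holds. (a) For every $X_0\in\mathfrak D(\mathcal A)$ there is exactly one classical solution with $X(0)=X_0$. (b) The eigenvalues of $L$ (that is, of $-\Delta$ with Dirichlet conditions, respectively of $\Delta^2$ with clamped conditions) are exactly the numbers $\nu_n^2$ for some sequence $0<\nu_0<\nu_1<\cdots\to\infty$, and there are eigenvalues $\beta_n\in\mathbb C$ of $\mathcal A$, with eigenvectors $(a_n\phi,b_n\phi,\beta_na_n\phi,\beta_nb_n\phi)$ for every eigenfunction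 $\phi$ of $L$ for $\nu_n^2$ (the vector $(a_n,b_n)\neq 0$ depends only on $n$), such that as $n\to\infty$, in cases 1 and 2, $$\beta_n=i\Big(\nu_n+\frac{3}{5\nu_n}\Big)-\frac{2}{125\,\nu_n^2}+o(\nu_n^{-2}),$$ and in case 3 $$\beta_n=i\Big(\nu_n+\frac{3}{5\nu_n}-\frac{9}{50\,\nu_n^3}\Big)-\frac{2}{125\,\nu_n^4}+o(\nu_n^{-4}),\qquad \operatorname{Re}\beta_n=-\frac{2}{125\,\nu_n^4}+o(\nu_n^{-5}).$$ (c) The decay rate $t^{-\theta}$, with $\theta=\tfrac12$ in cases 1 and 2 and $\theta=\tfrac14$ in case 3, is optimal: there is $M>0$ such that every classical solution satisfies $$\|X(t)\|_{\mathcal H}\le \frac{M}{t^{\theta}}\,\|X(0)\|_{\mathfrak D(\mathcal A)},\qquad t\ge 1,$$ whereas for no function $\rho:\mathbb R\to\mathbb R$ with $\rho(t)=o(t^{-\theta})$ as $t\to\infty$ does the estimate $\|X(t)\|_{\mathcal H}\le\rho(t)\,\|X(0)\|_{\mathfrak D(\mathcal A)}$ hold for all sufficiently large $t$ and all classical solutions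 $X$. -/

import Mathlib

open MeasureTheory Filter Topology Asymptotics
open scoped ContDiff

noncomputable section

namespace CoupledDamping

/-! ### Abstract coupled second-order systems -/

section Abstract

variable {H₁ H₀ K Z : Type*}
  [NormedAddCommGroup H₁] [InnerProductSpace ℂ H₁]
  [NormedAddCommGroup H₀] [InnerProductSpace ℂ H₀]
  [NormedAddCommGroup K] [InnerProductSpace ℂ K]
  [NormedAddCommGroup Z] [InnerProductSpace ℂ Z]

/-- The data of a damped scalar equation `u'' + L u + g⋆ g u' = 0`: the embedding `H₁ → H₀`, an
operator `S = stiff` with `⟨L u, φ⟩ = ⟨S u, S φ⟩`, and the damping operator `g = damp`, so that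
`⟨g⋆ g v, φ⟩ = ⟨g v, g φ⟩`. -/
structure Model (H₁ H₀ K Z : Type*)
    [NormedAddCommGroup H₁] [InnerProductSpace ℂ H₁]
    [NormedAddCommGroup H₀] [InnerProductSpace ℂ H₀]
    [NormedAddCommGroup K] [InnerProductSpace ℂ K]
    [NormedAddCommGroup Z] [InnerProductSpace ℂ Z] where
  emb : H₁ →L[ℂ] H₀
  stiff : H₁ →L[ℂ] K
  damp : H₁ →L[ℂ] Z

/-- The energy space `(H₁)ᴺ × (H₀)ᴺ` with its Hilbert norm. -/
abbrev EnergySpace (N : ℕ) (H₁ H₀ : Type*)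
    [NormedAddCommGroup H₁] [InnerProductSpace ℂ H₁]
    [NormedAddCommGroup H₀] [InnerProductSpace ℂ H₀] : Type _ :=
  WithLp 2 (PiLp 2 (fun _ : Fin N => H₁) × PiLp 2 (fun _ : Fin N => H₀))

/-- `m.OpRel A D X Y` says that `X = (U, V)` lies in the domain of the operator
`𝒜 (U, V) = (V, -(L U + A U + D g⋆ g V))` and that `𝒜 X = Y`: the second component `V` lies in
`(H₁)ᴺ`, it is the first component of `Y`, and `L U + A U + D g⋆ g V`, a priori in the dual of
`(H₁)ᴺ`, is represented in `(H₀)ᴺ` by minus the second component of `Y`. -/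
def Model.OpRel (m : Model H₁ H₀ K Z) {N : ℕ} (A D : Matrix (Fin N) (Fin N) ℝ)
    (X Y : EnergySpace N H₁ H₀) : Prop :=
  (∀ i, m.emb (Y.fst i) = X.snd i) ∧
  ∀ (i : Fin N) (φ : H₁),
    inner ℂ (m.stiff φ) (m.stiff (X.fst i))
      + ∑ j, (A i j : ℂ) * inner ℂ (m.emb φ) (m.emb (X.fst j))
      + ∑ j, (D i j : ℂ) * inner ℂ (m.damp φ) (m.damp (Y.fst j))
    = -inner ℂ (m.emb φ) (Y.snd i)

/-- `X` is a classical solution on `[0, ∞)` of `X' = 𝒜 X`, that is, `X = (U, U')` with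
`U'' + L U + A U + D g⋆ g U' = 0`. -/
def Model.IsSolution (m : Model H₁ H₀ K Z) {N : ℕ} (A D : Matrix (Fin N) (Fin N) ℝ)
    (X : ℝ → EnergySpace N H₁ H₀) : Prop :=
  ∃ X' : ℝ → EnergySpace N H₁ H₀, ContinuousOn X' (Set.Ici 0) ∧
    ∀ t : ℝ, 0 ≤ t → HasDerivWithinAt X (X' t) (Set.Ici 0) t ∧ m.OpRel A D (X t) (X' t)

/-- Every initial state in the domain of `𝒜` is the initial state of exactly one classical
solution. -/
def Model.WellPosed (m : Model H₁ H₀ K Z) {N : ℕ} (A D : Matrix (Fin N) (Fin N) ℝ) : Prop :=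
  ∀ X₀ Y₀ : EnergySpace N H₁ H₀, m.OpRel A D X₀ Y₀ →
    ∃ X : ℝ → EnergySpace N H₁ H₀, m.IsSolution A D X ∧ X 0 = X₀ ∧
      ∀ X₂ : ℝ → EnergySpace N H₁ H₀, m.IsSolution A D X₂ → X₂ 0 = X₀ →
        Set.EqOn X₂ X (Set.Ici 0)

/-- The decay estimate `‖X(t)‖ ≤ ρ(t) ‖X(0)‖_{D(𝒜)}` at time `t`, for all classical solutions,
with the graph norm `‖X(0)‖ + ‖𝒜 X(0)‖` on the right. -/
def Model.DecayBoundAt (m : Model H₁ H₀ K Z) {N : ℕ} (A D : Matrix (Fin N) (Fin N) ℝ)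
    (ρ : ℝ → ℝ) (t : ℝ) : Prop :=
  ∀ X : ℝ → EnergySpace N H₁ H₀, m.IsSolution A D X →
    ∀ Y₀ : EnergySpace N H₁ H₀, m.OpRel A D (X 0) Y₀ →
      ‖X t‖ ≤ ρ t * (‖X 0‖ + ‖Y₀‖)

/-- `t ^ (-θ)` is the optimal decay rate: the decay estimate holds with `M t ^ (-θ)` for `t ≥ 1`,
and it fails for every rate that is `o(t ^ (-θ))` as `t → ∞`. -/
def Model.OptimalRate (m : Model H₁ H₀ K Z) {N : ℕ} (A D : Matrix (Fin N) (Fin N) ℝ)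
    (θ : ℝ) : Prop :=
  (∃ M : ℝ, 0 < M ∧ ∀ t : ℝ, 1 ≤ t → m.DecayBoundAt A D (fun s => M * s ^ (-θ)) t) ∧
  ∀ ρ : ℝ → ℝ, ρ =o[atTop] (fun s : ℝ => s ^ (-θ)) →
    ¬ ∀ᶠ t in atTop, m.DecayBoundAt A D ρ t

/-- `φ ≠ 0` and `L φ = l φ` in the weak sense. -/
def Model.IsEigenfunction (m : Model H₁ H₀ K Z) (l : ℝ) (φ : H₁) : Prop :=
  φ ≠ 0 ∧ ∀ ψ : H₁,
    inner ℂ (m.stiff ψ) (m.stiff φ) = (l : ℂ) * inner ℂ (m.emb ψ) (m.emb φ)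

/-- `ν 0 < ν 1 < ν 2 < ⋯ → ∞` are positive, and the eigenvalues of `L` are exactly the numbers
`(ν n) ^ 2`. -/
def Model.IsFrequencySequence (m : Model H₁ H₀ K Z) (ν : ℕ → ℝ) : Prop :=
  StrictMono ν ∧ (∀ n, 0 < ν n) ∧ Tendsto ν atTop atTop ∧
    ∀ l : ℝ, (∃ φ : H₁, m.IsEigenfunction l φ) ↔ ∃ n, l = ν n ^ 2

/-- `X ≠ 0` is an eigenvector of `𝒜` for the eigenvalue `β`. -/
def Model.IsEigenvector (m : Model H₁ H₀ K Z) {N : ℕ} (A D : Matrix (Fin N) (Fin N) ℝ)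
    (β : ℂ) (X : EnergySpace N H₁ H₀) : Prop :=
  X ≠ 0 ∧ m.OpRel A D X (β • X)

/-- The state `(U, β U)` with `U = (c₁ φ, …, c_N φ)`. -/
def Model.modeState (m : Model H₁ H₀ K Z) {N : ℕ} (c : Fin N → ℂ) (β : ℂ) (φ : H₁) :
    EnergySpace N H₁ H₀ :=
  WithLp.toLp 2 (WithLp.toLp 2 (fun i => c i • φ), WithLp.toLp 2 (fun i => (β * c i) • m.emb φ))

/-- `β n` is, for every `n`, an eigenvalue of `𝒜`, with eigenvectors `(c φ, β n c φ)` where `φ` is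
any eigenfunction of `L` for `(ν n) ^ 2` and the vector `c` depends only on `n`. -/
def Model.IsEigenvalueBranch (m : Model H₁ H₀ K Z) {N : ℕ} (A D : Matrix (Fin N) (Fin N) ℝ)
    (ν : ℕ → ℝ) (β : ℕ → ℂ) : Prop :=
  ∀ n, ∃ c : Fin N → ℂ, ∀ φ : H₁, m.IsEigenfunction (ν n ^ 2) φ →
    m.IsEigenvector A D (β n) (m.modeState c (β n) φ)

end Abstract

/-! ### Sobolev spaces on an open set -/

section Sobolev

variable {d : ℕ}

/-- `L²(Ω)`, complex valued. -/
abbrev L2 (Ω : Set (EuclideanSpace ℝ (Fin d))) : Type :=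
  Lp ℂ 2 (volume.restrict Ω)

/-- The partial derivative `∂ᵢ f`. -/
def pd (i : Fin d) (f : EuclideanSpace ℝ (Fin d) → ℂ) : EuclideanSpace ℝ (Fin d) → ℂ :=
  fun x => fderiv ℝ f x (EuclideanSpace.single i 1)

/-- `f ∈ C_c^∞(Ω)`. -/
def IsTest (Ω : Set (EuclideanSpace ℝ (Fin d))) (f : EuclideanSpace ℝ (Fin d) → ℂ) : Prop :=
  ContDiff ℝ ∞ f ∧ HasCompactSupport f ∧ tsupport f ⊆ Ω

theorem IsTest.zero (Ω : Set (EuclideanSpace ℝ (Fin d))) : IsTest Ω 0 :=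
  ⟨contDiff_const, HasCompactSupport.zero, by simp [tsupport]⟩

theorem IsTest.add {Ω : Set (EuclideanSpace ℝ (Fin d))} {f g : EuclideanSpace ℝ (Fin d) → ℂ}
    (hf : IsTest Ω f) (hg : IsTest Ω g) : IsTest Ω (f + g) :=
  ⟨hf.1.add hg.1, hf.2.1.add hg.2.1,
    (tsupport_add f g).trans (Set.union_subset hf.2.2 hg.2.2)⟩

theorem IsTest.smul {Ω : Set (EuclideanSpace ℝ (Fin d))} {f : EuclideanSpace ℝ (Fin d) → ℂ}
    (c : ℂ) (hf : IsTest Ω f) : IsTest Ω (c • f) :=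
  ⟨hf.1.const_smul c, hf.2.1.smul_left (f := fun _ => c),
    (tsupport_smul_subset_right (fun _ => c) f).trans hf.2.2⟩

theorem IsTest.pd {Ω : Set (EuclideanSpace ℝ (Fin d))} {f : EuclideanSpace ℝ (Fin d) → ℂ}
    (hf : IsTest Ω f) (i : Fin d) : IsTest Ω (pd i f) :=
  ⟨(hf.1.fderiv_right (m := ∞) (by simp)).clm_apply contDiff_const,
    hf.2.1.fderiv_apply ℝ _,
    (tsupport_fderiv_apply_subset ℝ _).trans hf.2.2⟩

theorem IsTest.differentiable {Ω : Set (EuclideanSpace ℝ (Fin d))}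
    {f : EuclideanSpace ℝ (Fin d) → ℂ} (hf : IsTest Ω f) : Differentiable ℝ f :=
  hf.1.differentiable (by simp)

theorem pd_zero (i : Fin d) : pd i (0 : EuclideanSpace ℝ (Fin d) → ℂ) = 0 := by
  funext x; simp [pd]

theorem pd_add (i : Fin d) {f g : EuclideanSpace ℝ (Fin d) → ℂ}
    (hf : Differentiable ℝ f) (hg : Differentiable ℝ g) : pd i (f + g) = pd i f + pd i g := by
  funext x; simp [pd, fderiv_add (hf x) (hg x)]

theorem pd_smul (i : Fin d) (c : ℂ) {f : EuclideanSpace ℝ (Fin d) → ℂ}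
    (hf : Differentiable ℝ f) : pd i (c • f) = c • pd i f := by
  funext x; simp [pd, fderiv_const_smul (hf x)]

/-- `L²(Ω) × L²(Ω)ᵈ`, which contains `H¹(Ω)` through `u ↦ (u, ∇u)`. -/
abbrev Jet1 (Ω : Set (EuclideanSpace ℝ (Fin d))) : Type :=
  WithLp 2 (L2 Ω × PiLp 2 (fun _ : Fin d => L2 Ω))

/-- `L²(Ω) × L²(Ω)ᵈ × L²(Ω)ᵈˣᵈ`, which contains `H²(Ω)` through `u ↦ (u, ∇u, ∇²u)`. -/
abbrev Jet2 (Ω : Set (EuclideanSpace ℝ (Fin d))) : Type :=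
  WithLp 2 (L2 Ω × WithLp 2 (PiLp 2 (fun _ : Fin d => L2 Ω) ×
    PiLp 2 (fun _ : Fin d × Fin d => L2 Ω)))

/-- The pairs `(f, ∇f)` with `f ∈ C_c^∞(Ω)`. -/
def testJet1 (Ω : Set (EuclideanSpace ℝ (Fin d))) : Submodule ℂ (Jet1 Ω) where
  carrier := {w | ∃ f, IsTest Ω f ∧ w.fst =ᵐ[volume.restrict Ω] f ∧
    ∀ i, w.snd i =ᵐ[volume.restrict Ω] pd i f}
  zero_mem' := ⟨0, IsTest.zero Ω, Lp.coeFn_zero _ _ _, fun i => by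
    rw [pd_zero]; exact Lp.coeFn_zero _ _ _⟩
  add_mem' := by
    rintro v w ⟨f, hf, hf0, hf1⟩ ⟨g, hg, hg0, hg1⟩
    refine ⟨f + g, hf.add hg, (Lp.coeFn_add _ _).trans (hf0.add hg0), fun i => ?_⟩
    rw [pd_add i hf.differentiable hg.differentiable]
    exact (Lp.coeFn_add _ _).trans ((hf1 i).add (hg1 i))
  smul_mem' := by
    rintro c w ⟨f, hf, hf0, hf1⟩
    refine ⟨c • f, hf.smul c, (Lp.coeFn_smul _ _).trans (hf0.const_smul c), fun i => ?_⟩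
    rw [pd_smul i c hf.differentiable]
    exact (Lp.coeFn_smul _ _).trans ((hf1 i).const_smul c)

/-- The triples `(f, ∇f, ∇²f)` with `f ∈ C_c^∞(Ω)`. -/
def testJet2 (Ω : Set (EuclideanSpace ℝ (Fin d))) : Submodule ℂ (Jet2 Ω) where
  carrier := {w | ∃ f, IsTest Ω f ∧ w.fst =ᵐ[volume.restrict Ω] f ∧
    (∀ i, w.snd.fst i =ᵐ[volume.restrict Ω] pd i f) ∧
    ∀ ij : Fin d × Fin d, w.snd.snd ij =ᵐ[volume.restrict Ω] pd ij.1 (pd ij.2 f)}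
  zero_mem' := ⟨0, IsTest.zero Ω, Lp.coeFn_zero _ _ _, fun i => by
    rw [pd_zero]; exact Lp.coeFn_zero _ _ _, fun ij => by
    rw [pd_zero, pd_zero]; exact Lp.coeFn_zero _ _ _⟩
  add_mem' := by
    rintro v w ⟨f, hf, hf0, hf1, hf2⟩ ⟨g, hg, hg0, hg1, hg2⟩
    refine ⟨f + g, hf.add hg, (Lp.coeFn_add _ _).trans (hf0.add hg0), fun i => ?_, fun ij => ?_⟩
    · rw [pd_add i hf.differentiable hg.differentiable]
      exact (Lp.coeFn_add _ _).trans ((hf1 i).add (hg1 i))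
    · rw [pd_add _ hf.differentiable hg.differentiable,
        pd_add _ (hf.pd _).differentiable (hg.pd _).differentiable]
      exact (Lp.coeFn_add _ _).trans ((hf2 ij).add (hg2 ij))
  smul_mem' := by
    rintro c w ⟨f, hf, hf0, hf1, hf2⟩
    refine ⟨c • f, hf.smul c, (Lp.coeFn_smul _ _).trans (hf0.const_smul c), fun i => ?_,
      fun ij => ?_⟩
    · rw [pd_smul i c hf.differentiable]
      exact (Lp.coeFn_smul _ _).trans ((hf1 i).const_smul c)
    · rw [pd_smul _ c hf.differentiable, pd_smul _ c (hf.pd _).differentiable]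
      exact (Lp.coeFn_smul _ _).trans ((hf2 ij).const_smul c)

/-- `H¹₀(Ω)`, the closure of `C_c^∞(Ω)` in the `H¹` norm; an element is the pair `(u, ∇u)`. -/
def H10 (Ω : Set (EuclideanSpace ℝ (Fin d))) : Submodule ℂ (Jet1 Ω) :=
  (testJet1 Ω).topologicalClosure

/-- `H²₀(Ω)`, the closure of `C_c^∞(Ω)` in the `H²` norm; an element is the triple
`(u, ∇u, ∇²u)`. -/
def H20 (Ω : Set (EuclideanSpace ℝ (Fin d))) : Submodule ℂ (Jet2 Ω) :=
  (testJet2 Ω).topologicalClosure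

variable (Ω : Set (EuclideanSpace ℝ (Fin d)))

/-- The embedding `H¹₀(Ω) → L²(Ω)`. -/
def emb1 : H10 Ω →L[ℂ] L2 Ω :=
  (WithLp.fstL 2 ℂ _ _).comp (H10 Ω).subtypeL

/-- The gradient `∇ : H¹₀(Ω) → L²(Ω)ᵈ`. -/
def grad : H10 Ω →L[ℂ] PiLp 2 (fun _ : Fin d => L2 Ω) :=
  (WithLp.sndL 2 ℂ _ _).comp (H10 Ω).subtypeL

/-- The embedding `H²₀(Ω) → L²(Ω)`. -/
def emb2 : H20 Ω →L[ℂ] L2 Ω :=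
  (WithLp.fstL 2 ℂ _ _).comp (H20 Ω).subtypeL

/-- The Laplacian `Δ : H²₀(Ω) → L²(Ω)`, the trace of the Hessian. -/
def lap : H20 Ω →L[ℂ] L2 Ω :=
  ∑ i : Fin d, (PiLp.proj 2 (fun _ : Fin d × Fin d => L2 Ω) (i, i)).comp
    ((WithLp.sndL 2 ℂ _ _).comp ((WithLp.sndL 2 ℂ _ _).comp (H20 Ω).subtypeL))

/-- `u'' - Δu + u' = 0` in `Ω`, `u = 0` on the boundary: `⟨L u, φ⟩ = ∫ ∇u · ∇φ`, `g = I`. -/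
def waveViscous : Model (H10 Ω) (L2 Ω) (PiLp 2 (fun _ : Fin d => L2 Ω)) (L2 Ω) where
  emb := emb1 Ω
  stiff := grad Ω
  damp := emb1 Ω

/-- `u'' + Δ²u + u' = 0` in `Ω`, `u = ∂u/∂n = 0` on the boundary: `⟨L u, φ⟩ = ∫ Δu Δφ`,
`g = I`. -/
def plateViscous : Model (H20 Ω) (L2 Ω) (L2 Ω) (L2 Ω) where
  emb := emb2 Ω
  stiff := lap Ω
  damp := emb2 Ω

/-- `u'' - Δu - Δu' = 0` in `Ω`, `u = 0` on the boundary: `⟨L u, φ⟩ = ⟨g⋆ g u, φ⟩ = ∫ ∇u · ∇φ`. -/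
def waveKelvinVoigt : Model (H10 Ω) (L2 Ω) (PiLp 2 (fun _ : Fin d => L2 Ω))
    (PiLp 2 (fun _ : Fin d => L2 Ω)) where
  emb := emb1 Ω
  stiff := grad Ω
  damp := grad Ω

end Sobolev

/-- The coupling matrix. -/
def matA : Matrix (Fin 2) (Fin 2) ℝ := !![1, 0; 0, 2]

/-- The control matrix. -/
def matD : Matrix (Fin 2) (Fin 2) ℝ := !![1, 2; 2, 4]

end CoupledDamping

end

/-!
The scalar operator `L` has compact inverse, so its eigenfunctions form a Hilbert basis of `H₀`,
and in this basis the coupled system splits into ordinary differential equations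
`u'' + ν² u + A u + γ D u' = 0` for `u ∈ ℂ²`, with `γ = 1` for viscous and `γ = ν²` for
Kelvin–Voigt damping. Everything follows from estimates on these modes that are uniform in `ν`.

* *Reduction.* The singular value decomposition of the embedding of `H₁`, with its form norm, into
  `H₀` gives `Model.IsElliptic.exists_modalBasis`; by `Model.ModalBasis.opRel_iff` the operator
  `𝒜` is then similar to a block-diagonal operator on `ℓ²` whose
  blocks are the operators `modeOp`. Uniformly bounded flows of the blocks yield well-posedness
  (`Model.ModalBasis.wellPosed`), and uniform decay of the blocks yields decay
  (`Model.ModalBasis.decayBound`).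

* *Upper bound for the decay.* `D` has rank one, so in the coordinates `p = u₁ + 2 u₂`,
  `q = 2 u₁ - u₂` only `p` is damped, while `A`, which does not commute with `D`, couples `p` and
  `q`. The multiplier `p'' q' - p' q''` exploits this coupling: its derivative contains `q'²`, at
  the price of one more time derivative. Hence the energy `E` satisfies
  `t E(t) ≤ C (E(u) + E(u'))(0)` (`IsMode.viscous_decay`), which is the rate `t ^ (-1/2)`. For
  Kelvin–Voigt damping two time derivatives are lost (`IsMode.kelvinVoigt_decay`), and the
  interpolation `norm_flow_interpolation` turns this into `t ^ (-1/4)` with a loss of one.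

* *Eigenvalues.* With `P = β² + ν²`, the number `β` is an eigenvalue of the mode if
  `(P + 1) (P + 2) + γ β (5 P + 6) = 0`. Some root lies at distance `O(1/ν)` from `i ν`
  (`exists_root_near`). For this root `δ = P + 6/5` solves `5 γ β δ = -(P + 1) (P + 2)`, whose
  right-hand side is `4/25 + O(δ)`; iterating the equation gives the expansions
  (`viscous_expansion`, `kelvinVoigt_expansion`). The eigenfunction of the `n`-th
  eigenvalue decays like `exp (t Re β n)`, so it is not yet small at `t = (ν n) ^ q`, where
  `q = 2` or `q = 4`, while its graph norm is about `ν n` times its norm. This rules out rates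
  `o(t ^ (-1/q))` (`Model.not_decayBoundAt_of_eigenvalues`).

* *Sobolev spaces.* All that is needed about `H¹₀(Ω)` and `H²₀(Ω)` comes from the estimate
  `‖f(· + z) - f‖ ≤ |z| ‖∇f‖` for test functions (`lintegral_translate_le`). Translating `Ω` off
  itself gives the Poincaré inequality, and averaging over the vectors `z` that join two points of
  a small cube shows that `f` is close to its means over small cubes, that is, to the image of `f`
  under an operator of finite rank; this is Rellich's theorem. For the plate,
  `∑ ‖∂ᵢ∂ⱼf‖² = ‖Δf‖²` (`sum_norm_hessian_sq`).
-/

noncomputable section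

namespace CoupledDamping

/-! ### Singular values of compact operators -/

section Spectral

open Module.End

universe u

variable {H₀ : Type*} [NormedAddCommGroup H₀] [InnerProductSpace ℂ H₀]

/-- A compact self-adjoint operator has a Hilbert basis of eigenvectors. -/
theorem exists_hilbertBasis_eigenvectors {W : Type u} [NormedAddCommGroup W]
    [InnerProductSpace ℂ W] [CompleteSpace W] (T : W →L[ℂ] W) (hT : IsCompactOperator T)
    (hs : T.IsSymmetric) :
    ∃ (ι : Type u) (f : HilbertBasis ι ℂ W) (μ : ι → ℂ), ∀ k, T (f k) = μ k • f k := by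
  have hb : ∀ μ : ℂ, ∃ (w : Set (eigenspace (T : W →ₗ[ℂ] W) μ))
      (b : HilbertBasis w ℂ (eigenspace (T : W →ₗ[ℂ] W) μ)), ⇑b = ((↑) : w → _) := fun μ => by
    have hcl : IsClosed (eigenspace (T : W →ₗ[ℂ] W) μ : Set W) := by
      have : (eigenspace (T : W →ₗ[ℂ] W) μ : Set W) = {x | T x = μ • x} := by
        ext x; simp
      rw [this]
      exact isClosed_eq T.continuous (continuous_const_smul μ)
    have : CompleteSpace (eigenspace (T : W →ₗ[ℂ] W) μ) := hcl.completeSpace_coe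
    exact exists_hilbertBasis ℂ _
  choose w b _ using hb
  have hO := (show (T : W →ₗ[ℂ] W).IsSymmetric from hs).orthogonalFamily_eigenspaces
  have hv := hO.orthonormal_sigma_orthonormal (v_family := fun μ => ⇑(b μ))
    (fun μ => (b μ).orthonormal)
  refine ⟨Σ μ : ℂ, w μ, HilbertBasis.mkOfOrthogonalEqBot hv ?_, fun k => k.1, ?_⟩
  · rw [← ContinuousLinearMap.orthogonalComplement_iSup_eigenspaces_eq_bot hT hs]
    apply le_antisymm
    · intro x hx
      rw [← Submodule.iInf_orthogonal, Submodule.mem_iInf]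
      intro μ
      rw [Submodule.mem_orthogonal]
      intro u hu
      -- the functional `⟪x, ·⟫` vanishes on a Hilbert basis of the eigenspace
      have hd := (b μ).dense_span
      let g : eigenspace (T : W →ₗ[ℂ] W) μ →L[ℂ] ℂ :=
        (innerSL ℂ x).comp (eigenspace (T : W →ₗ[ℂ] W) μ).subtypeL
      have hle : Submodule.span ℂ (Set.range (b μ)) ≤ LinearMap.ker (g : _ →ₗ[ℂ] ℂ) := by
        rw [Submodule.span_le]
        rintro _ ⟨k, rfl⟩
        have := (Submodule.mem_orthogonal' _ _).1 hx _ (Submodule.subset_span ⟨⟨μ, k⟩, rfl⟩)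
        simpa [g] using this
      have h2 : (⟨u, hu⟩ : eigenspace (T : W →ₗ[ℂ] W) μ) ∈
          (Submodule.span ℂ (Set.range (b μ))).topologicalClosure := by
        rw [hd]; trivial
      have h3 := Submodule.topologicalClosure_minimal _ hle g.isClosed_ker h2
      have h4 : inner ℂ x u = 0 := by simpa [g] using h3
      rw [← inner_conj_symm, h4, map_zero]
    · apply Submodule.orthogonal_le
      rw [Submodule.span_le]
      rintro _ ⟨⟨μ, k⟩, rfl⟩
      exact (le_iSup (fun μ => eigenspace (T : W →ₗ[ℂ] W) μ) μ) (b μ k).2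
  · rintro ⟨μ, k⟩
    simp only [HilbertBasis.coe_mkOfOrthogonalEqBot]
    exact mem_eigenspace_iff.1 (b μ k).2

/-- Singular value decomposition of an injective compact operator with dense range. -/
theorem exists_singularValueDecomposition {W : Type u} [NormedAddCommGroup W]
    [InnerProductSpace ℂ W] [CompleteSpace W] [CompleteSpace H₀] (J : W →L[ℂ] H₀)
    (hJ : IsCompactOperator J) (hinj : Function.Injective J) (hd : DenseRange J) :
    ∃ (ι : Type u) (f : HilbertBasis ι ℂ W) (e : HilbertBasis ι ℂ H₀) (σ : ι → ℝ),
      (∀ k, 0 < σ k) ∧ ∀ k, J (f k) = (σ k : ℂ) • e k := by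
  obtain ⟨ι, f, μ, hμ⟩ := exists_hilbertBasis_eigenvectors (J.adjoint.comp J)
    (hJ.clm_comp J.adjoint) (fun x y => by
      simp [ContinuousLinearMap.adjoint_inner_left, ContinuousLinearMap.adjoint_inner_right])
  have hin : ∀ j k, inner ℂ (J (f j)) (J (f k)) = μ k * inner ℂ (f j) (f k) := fun j k => by
    rw [← ContinuousLinearMap.adjoint_inner_right, ← inner_smul_right, ← hμ k]; rfl
  have hf : ∀ k, inner ℂ (f k) (f k) = 1 := fun k => by
    simp [inner_self_eq_norm_sq_to_K, f.orthonormal.1 k]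
  have hne : ∀ k, J (f k) ≠ 0 := fun k h => by
    have : f k = 0 := hinj (by simpa using h)
    simpa [this] using hf k
  have hμ' : ∀ k, μ k = (‖J (f k)‖ : ℂ) ^ 2 := fun k => by
    have := hin k k
    rw [hf, mul_one, inner_self_eq_norm_sq_to_K] at this
    exact this.symm
  have hpos : ∀ k, 0 < ‖J (f k)‖ := fun k => norm_pos_iff.2 (hne k)
  have hposC : ∀ k, (‖J (f k)‖ : ℂ) ≠ 0 := fun k => by exact_mod_cast (hpos k).ne'
  let e : ι → H₀ := fun k => ((‖J (f k)‖ : ℂ)⁻¹) • J (f k)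
  have he : Orthonormal ℂ e := by
    classical
    rw [orthonormal_iff_ite]
    intro j k
    have := (orthonormal_iff_ite.1 f.orthonormal) j k
    simp only [e, inner_smul_left, inner_smul_right, hin, this]
    split_ifs with h
    · subst h
      rw [hμ']
      simp only [map_inv₀, Complex.conj_ofReal]
      field_simp [hposC j]
    · simp
  -- `e` is complete: a vector orthogonal to the dense range of `J` vanishes
  refine ⟨ι, f, HilbertBasis.mkOfOrthogonalEqBot he ?_, fun k => ‖J (f k)‖, hpos, fun k => ?_⟩
  · rw [Submodule.eq_bot_iff]
    intro x hx
    have h1 : ∀ k, inner ℂ (J (f k)) x = 0 := fun k => by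
      have := (Submodule.mem_orthogonal _ _).1 hx (e k) (Submodule.subset_span ⟨k, rfl⟩)
      simp only [e, inner_smul_left, mul_eq_zero] at this
      exact this.resolve_left (by simp [hne k])
    have h2 : J.adjoint x = 0 := by
      apply f.repr.injective
      ext k
      rw [f.repr_apply_apply, ContinuousLinearMap.adjoint_inner_right, h1, map_zero]; rfl
    have h3 : ∀ y, inner ℂ y x = 0 := by
      have : (fun y : H₀ => inner ℂ y x) = fun _ => (0 : ℂ) :=
        hd.equalizer (by fun_prop) continuous_const (by
          funext w
          simp only [Function.comp_apply]
          rw [← ContinuousLinearMap.adjoint_inner_right, h2, inner_zero_right])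
      exact fun y => congrFun this y
    exact inner_self_eq_zero.1 (h3 x)
  · simp only [HilbertBasis.coe_mkOfOrthogonalEqBot, e, smul_smul]
    rw [mul_inv_cancel₀ (hposC k), one_smul]

/-- An orthonormal family inside a compact set is finite; this makes the frequencies tend to
infinity. -/
theorem Orthonormal.finite_of_mem_compact {ι : Type*} {e : ι → H₀} (he : Orthonormal ℂ e)
    {s : Set H₀} (hs : IsCompact s) {t : Set ι} (h : ∀ k ∈ t, e k ∈ s) : t.Finite := by
  by_contra hinf
  let x : ℕ → ι := fun n => (Set.Infinite.natEmbedding t hinf n : t)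
  have hx : Function.Injective x := fun a b hab =>
    (Set.Infinite.natEmbedding t hinf).injective (Subtype.ext hab)
  obtain ⟨a, _, φ, hφ, ha⟩ := hs.tendsto_subseq (x := fun n => e (x n))
    (fun n => h _ (Set.Infinite.natEmbedding t hinf n).2)
  have hc := ha.cauchySeq
  rw [Metric.cauchySeq_iff'] at hc
  obtain ⟨N, hN⟩ := hc 1 one_pos
  have h1 := hN (N + 1) (Nat.le_succ N)
  have hne : x (φ (N + 1)) ≠ x (φ N) := fun hh =>
    absurd (hφ.injective (hx hh)) (Nat.succ_ne_self N)
  simp only [Function.comp_apply, dist_eq_norm] at h1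
  have h2 := norm_sub_mul_self (𝕜 := ℂ) (e (x (φ (N + 1)))) (e (x (φ N)))
  rw [he.2 hne, he.1, he.1] at h2
  simp at h2
  nlinarith [norm_nonneg (e (x (φ (N + 1))) - e (x (φ N)))]

end Spectral

/-! ### Expansion of a model in eigenfunctions -/

section Modal

universe u

variable {H₁ H₀ Z : Type*} {K : Type u}
  [NormedAddCommGroup H₁] [InnerProductSpace ℂ H₁]
  [NormedAddCommGroup H₀] [InnerProductSpace ℂ H₀]
  [NormedAddCommGroup K] [InnerProductSpace ℂ K]
  [NormedAddCommGroup Z] [InnerProductSpace ℂ Z]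

/-- The hypotheses of the spectral theorem for `L`: the form `⟨S u, S φ⟩` is coercive on `H₁`, and
`H₁` is compactly and densely embedded in the infinite-dimensional space `H₀`. -/
structure Model.IsElliptic (m : Model H₁ H₀ K Z) : Prop where
  compact : IsCompactOperator m.emb
  injective : Function.Injective m.emb
  dense : DenseRange m.emb
  coercive : ∃ C : ℝ, ∀ u, ‖u‖ ≤ C * ‖m.stiff u‖
  infinite : ¬ FiniteDimensional ℂ H₀

/-- Eigenfunctions `φ k` of `L` with eigenvalues `(ν k) ^ 2`, such that `emb (φ k) = e k` is a
Hilbert basis of `H₀`. The coordinates of `u` in the form norm are `ν k * ⟨e k, u⟩`, and the map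
`w` to these coordinates identifies `H₁` with `ℓ²`. -/
structure Model.ModalBasis (m : Model H₁ H₀ K Z) (ι : Type*) where
  e : HilbertBasis ι ℂ H₀
  w : H₁ ≃L[ℂ] lp (fun _ : ι => ℂ) 2
  φ : ι → H₁
  ν : ι → ℝ
  emb_φ : ∀ k, m.emb (φ k) = e k
  stiff_φ : ∀ k u, inner ℂ (m.stiff (φ k)) (m.stiff u) = (ν k : ℂ) ^ 2 * inner ℂ (e k) (m.emb u)
  w_apply : ∀ u k, w u k = (ν k : ℂ) * inner ℂ (e k) (m.emb u)
  dense_φ : Dense (Submodule.span ℂ (Set.range φ) : Set H₁)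
  injective : Function.Injective m.emb
  ν_pos : ∀ k, 0 < ν k
  finite_le : ∀ R : ℝ, {k | ν k ≤ R}.Finite
  infinite : Infinite ι

/-- The embedding of `H₁`, with the norm `‖S u‖`, into `H₀` is compact; its singular values are the
numbers `1 / ν k` and its left singular vectors are the eigenfunctions of `L`. -/
theorem Model.IsElliptic.exists_modalBasis [CompleteSpace H₁] [CompleteSpace H₀]
    [CompleteSpace K]
    {m : Model H₁ H₀ K Z} (hm : m.IsElliptic) : ∃ ι : Type u, Nonempty (m.ModalBasis ι) := by
  obtain ⟨C, hC⟩ := hm.coercive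
  have hanti : AntilipschitzWith (Real.toNNReal C) m.stiff :=
    AddMonoidHomClass.antilipschitz_of_bound _ (fun x => (hC x).trans (by
      gcongr; exact Real.le_coe_toNNReal C))
  have hclo : IsClosed (Set.range m.stiff) :=
    hanti.isClosed_range m.stiff.uniformContinuous
  let R := m.stiff.equivRange hanti.injective hclo
  have hR : ∀ u, ((R u : m.stiff.range) : K) = m.stiff u := fun u => rfl
  have : CompleteSpace m.stiff.range := by
    have h : IsClosed (m.stiff.range : Set K) := by
      rw [LinearMap.coe_range]; exact hclo
    exact h.completeSpace_coe
  let J : m.stiff.range →L[ℂ] H₀ := m.emb.comp (R.symm : m.stiff.range →L[ℂ] H₁)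
  have hJR : ∀ u, J (R u) = m.emb u := fun u => by simp [J]
  have hJc : IsCompactOperator J := hm.compact.comp_clm _
  obtain ⟨ι, f, e, σ, hσ, hf⟩ := exists_singularValueDecomposition J
    hJc (hm.injective.comp R.symm.injective)
    (hm.dense.comp R.symm.surjective.denseRange m.emb.continuous)
  have hσC : ∀ k, (σ k : ℂ) ≠ 0 := fun k => by exact_mod_cast (hσ k).ne'
  -- `J† e k = σ k f k`
  have hcoord : ∀ k x, inner ℂ (e k) (J x) = (σ k : ℂ) * inner ℂ (f k) x := fun k x => by
    have h : (J.adjoint (e k)) = (σ k : ℂ) • f k := by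
      classical
      apply f.repr.injective
      ext j
      rw [f.repr_apply_apply, f.repr_apply_apply, ContinuousLinearMap.adjoint_inner_right, hf,
        inner_smul_left, inner_smul_right, orthonormal_iff_ite.1 e.orthonormal,
        orthonormal_iff_ite.1 f.orthonormal]
      split_ifs with hjk
      · subst hjk; simp
      · simp
    rw [← ContinuousLinearMap.adjoint_inner_left, h, inner_smul_left, Complex.conj_ofReal]
  have hinf : Infinite ι := by
    by_contra hι
    have : Finite ι := not_infinite_iff_finite.1 hι
    have := Fintype.ofFinite ι
    exact hm.infinite (Module.Basis.finiteDimensional_of_finite e.toOrthonormalBasis.toBasis)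
  let φ : ι → H₁ := fun k => R.symm (((σ k : ℂ)⁻¹) • f k)
  have hRφ : ∀ k, R (φ k) = ((σ k : ℂ)⁻¹) • f k := fun k => by simp [φ]
  refine ⟨ι, ⟨{
    e := e
    w := R.trans f.repr.toContinuousLinearEquiv
    φ := φ
    ν := fun k => (σ k)⁻¹
    emb_φ := fun k => ?_
    stiff_φ := fun k u => ?_
    w_apply := fun u k => ?_
    dense_φ := ?_
    injective := hm.injective
    ν_pos := fun k => inv_pos.2 (hσ k)
    finite_le := fun r => ?_
    infinite := hinf }⟩⟩
  · rw [← hJR, hRφ, map_smul, hf, smul_smul, inv_mul_cancel₀ (hσC k), one_smul]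
  · rw [← hR, ← hR, ← Submodule.coe_inner, hRφ, inner_smul_left, ← hJR u, hcoord]
    simp only [map_inv₀, Complex.conj_ofReal, Complex.ofReal_inv]
    field_simp [hσC k]
  · rw [← hJR u, hcoord]
    simp only [ContinuousLinearEquiv.trans_apply, Complex.ofReal_inv]
    rw [← mul_assoc, inv_mul_cancel₀ (hσC k), one_mul, ← f.repr_apply_apply]
    rfl
  · have h1 : Submodule.span ℂ (Set.range φ) =
        (Submodule.span ℂ (Set.range f)).map (R.symm : m.stiff.range →ₗ[ℂ] H₁) := by
      rw [Submodule.map_span, ← Set.range_comp]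
      apply le_antisymm
      · rw [Submodule.span_le]
        rintro _ ⟨k, rfl⟩
        simp only [φ, map_smul]
        exact Submodule.smul_mem _ _ (Submodule.subset_span ⟨k, rfl⟩)
      · rw [Submodule.span_le]
        rintro _ ⟨k, rfl⟩
        have : (R.symm (f k)) = (σ k : ℂ) • φ k := by
          simp [φ, smul_smul, hσC k]
        change R.symm (f k) ∈ _
        rw [this]
        exact Submodule.smul_mem _ _ (Submodule.subset_span ⟨k, rfl⟩)
    rw [h1, Submodule.map_coe]
    refine R.symm.surjective.denseRange.dense_image R.symm.continuous ?_
    have := f.dense_span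
    rwa [Submodule.dense_iff_topologicalClosure_eq_top]
  · apply Orthonormal.finite_of_mem_compact e.orthonormal
      (hJc.isCompact_closure_image_closedBall (f := (J : m.stiff.range →ₗ[ℂ] H₀)) |r|)
    intro k hk
    apply subset_closure
    refine ⟨((σ k : ℂ)⁻¹) • f k, ?_, ?_⟩
    · rw [mem_closedBall_zero_iff, norm_smul, f.orthonormal.1 k]
      simp only [norm_inv, Complex.norm_real, mul_one, Real.norm_eq_abs, abs_of_pos (hσ k)]
      exact le_trans hk (le_abs_self r)
    · change J _ = _
      rw [map_smul, hf, smul_smul, inv_mul_cancel₀ (hσC k), one_smul]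

end Modal

/-! ### The eigenvalues of the scalar operator -/

section Frequencies

/-- An infinite set of reals with finitely many elements below every bound is the range of a
strictly increasing sequence. -/
theorem exists_strictMono_range_eq {S : Set ℝ} (hS : S.Infinite)
    (hfin : ∀ R : ℝ, (S ∩ Set.Iic R).Finite) :
    ∃ ν : ℕ → ℝ, StrictMono ν ∧ Set.range ν = S ∧ Tendsto ν atTop atTop := by
  classical
  have hIic : ∀ a : S, (Set.Iic a).Finite := fun a => by
    refine Set.Finite.of_finite_image ((hfin a).subset ?_) Subtype.val_injective.injOn
    rintro _ ⟨x, hx, rfl⟩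
    exact ⟨x.2, hx⟩
  let _ : LocallyFiniteOrder S := LocallyFiniteOrder.ofFiniteIcc fun a b =>
    (hIic b).subset Set.Icc_subset_Iic_self
  let _ := LinearLocallyFiniteOrder.succOrder S
  let _ := LinearLocallyFiniteOrder.predOrder S
  obtain ⟨s₀, hs₀⟩ := hS.nonempty
  obtain ⟨b, hb, hbmin⟩ := Set.exists_min_image _ id (hIic ⟨s₀, hs₀⟩) ⟨_, Set.self_mem_Iic⟩
  let _ : OrderBot S :=
    { bot := b
      bot_le := fun a => by
        rcases le_total a ⟨s₀, hs₀⟩ with h | h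
        · exact hbmin a h
        · exact le_trans hb h }
  have : NoMaxOrder S := ⟨fun a => by
    by_contra! hmax
    exact hS ((hfin a).subset fun x hx => ⟨hx, hmax ⟨x, hx⟩⟩)⟩
  let o : ℕ ≃o S := (orderIsoNatOfLinearSuccPredArch (ι := S)).symm
  have hmono : StrictMono fun n => (o n : ℝ) := fun a b h => o.strictMono h
  refine ⟨fun n => (o n : ℝ), hmono, ?_, ?_⟩
  · ext x
    constructor
    · rintro ⟨n, rfl⟩; exact (o n).2
    · intro hx
      exact ⟨o.symm ⟨x, hx⟩, by simp⟩
  · rw [tendsto_atTop_atTop]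
    intro R
    by_contra! h
    refine Set.infinite_range_of_injective hmono.injective ((hfin R).subset ?_)
    rintro _ ⟨n, rfl⟩
    obtain ⟨a, ha, hlt⟩ := h n
    exact ⟨(o n).2, (hmono.monotone ha).trans hlt.le⟩

variable {H₁ H₀ K Z ι : Type*}
  [NormedAddCommGroup H₁] [InnerProductSpace ℂ H₁]
  [NormedAddCommGroup H₀] [InnerProductSpace ℂ H₀]
  [NormedAddCommGroup K] [InnerProductSpace ℂ K]
  [NormedAddCommGroup Z] [InnerProductSpace ℂ Z]
  {m : Model H₁ H₀ K Z}

theorem Model.ModalBasis.isEigenfunction (B : m.ModalBasis ι) (k : ι) :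
    m.IsEigenfunction (B.ν k ^ 2) (B.φ k) := by
  refine ⟨fun h => ?_, fun ψ => ?_⟩
  · have h1 := B.e.orthonormal.1 k
    rw [← B.emb_φ, h, map_zero, norm_zero] at h1
    exact zero_ne_one h1
  · rw [← inner_conj_symm, B.stiff_φ, map_mul, inner_conj_symm, B.emb_φ]
    simp

theorem Model.ModalBasis.eigenvalue_iff (B : m.ModalBasis ι) (l : ℝ) :
    (∃ φ : H₁, m.IsEigenfunction l φ) ↔ ∃ k, l = B.ν k ^ 2 := by
  constructor
  · rintro ⟨φ, hφ, h⟩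
    have : ∃ k, inner ℂ (B.e k) (m.emb φ) ≠ 0 := by
      by_contra! h0
      refine hφ (B.injective ?_)
      rw [map_zero]
      apply B.e.repr.injective
      ext k
      rw [B.e.repr_apply_apply, h0, map_zero]; rfl
    obtain ⟨k, hk⟩ := this
    refine ⟨k, ?_⟩
    have h1 := h (B.φ k)
    rw [B.stiff_φ, B.emb_φ] at h1
    have h2 := mul_right_cancel₀ hk h1
    exact_mod_cast h2.symm
  · rintro ⟨k, rfl⟩
    exact ⟨_, B.isEigenfunction k⟩

theorem Model.ModalBasis.exists_isFrequencySequence (B : m.ModalBasis ι) :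
    ∃ ν : ℕ → ℝ, m.IsFrequencySequence ν := by
  have := B.infinite
  have hinf : (Set.range B.ν).Infinite := by
    intro hfin
    obtain ⟨R, hR⟩ := hfin.bddAbove
    refine Set.infinite_univ (α := ι) ((B.finite_le R).subset fun k _ => hR ⟨k, rfl⟩)
  obtain ⟨ν, hmono, hrange, htend⟩ := exists_strictMono_range_eq hinf fun R => by
    refine ((B.finite_le R).image B.ν).subset ?_
    rintro _ ⟨⟨k, rfl⟩, hk⟩
    exact ⟨k, hk, rfl⟩
  have hex : ∀ n, ∃ k, B.ν k = ν n := fun n => by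
    have : ν n ∈ Set.range B.ν := hrange ▸ ⟨n, rfl⟩
    exact this
  refine ⟨ν, hmono, fun n => ?_, htend, fun l => ?_⟩
  · obtain ⟨k, hk⟩ := hex n
    exact hk ▸ B.ν_pos k
  · rw [B.eigenvalue_iff]
    constructor
    · rintro ⟨k, rfl⟩
      have : B.ν k ∈ Set.range ν := hrange ▸ ⟨k, rfl⟩
      obtain ⟨n, hn⟩ := this
      exact ⟨n, by rw [hn]⟩
    · rintro ⟨n, rfl⟩
      obtain ⟨k, hk⟩ := hex n
      exact ⟨k, by rw [hk]⟩

/-- The frequencies of a modal basis are bounded away from zero. -/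
theorem Model.ModalBasis.exists_le_ν (B : m.ModalBasis ι) : ∃ c : ℝ, 0 < c ∧ ∀ k, c ≤ B.ν k := by
  by_cases h : ({k | B.ν k ≤ 1}).Nonempty
  · obtain ⟨k₀, hk₀, hmin⟩ := Set.exists_min_image _ B.ν (B.finite_le 1) h
    refine ⟨B.ν k₀, B.ν_pos k₀, fun k => ?_⟩
    by_cases hk : B.ν k ≤ 1
    · exact hmin k hk
    · exact hk₀.trans (not_le.1 hk).le
  · refine ⟨1, one_pos, fun k => ?_⟩
    by_contra hk
    exact h ⟨k, (not_le.1 hk).le⟩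

end Frequencies

/-! ### Diagonal evolution equations in `ℓ²` -/

section Flow

variable {E : Type*} [NormedAddCommGroup E] [NormedSpace ℂ E]

/-- The solution `exp (t M) x` of `x' = M x`. -/
noncomputable def flow (M : E →L[ℂ] E) (t : ℝ) : E →L[ℂ] E := NormedSpace.exp (t • M)

@[simp] theorem flow_zero (M : E →L[ℂ] E) : flow M 0 = 1 := by
  simp [flow, NormedSpace.exp_zero]

theorem flow_apply_comm (M : E →L[ℂ] E) (x : E) (t : ℝ) : flow M t (M x) = M (flow M t x) := by
  have h : Commute (t • M) M := (Commute.refl M).smul_left t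
  have := (h.exp_left).eq
  exact congrArg (fun T : E →L[ℂ] E => T x) this

variable [CompleteSpace E]

theorem hasDerivAt_flow (M : E →L[ℂ] E) (x : E) (t : ℝ) :
    HasDerivAt (fun s => flow M s x) (M (flow M t x)) t := by
  have h := hasDerivAt_exp_smul_const' (𝕂 := ℝ) M t
  have h2 := ((ContinuousLinearMap.apply ℂ E x).restrictScalars ℝ).hasFDerivAt.comp_hasDerivAt t h
  exact h2

theorem flow_unique (M : E →L[ℂ] E) {x : ℝ → E}
    (hx : ∀ t, 0 ≤ t → HasDerivWithinAt x (M (x t)) (Set.Ici 0) t) {t : ℝ} (ht : 0 ≤ t) :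
    x t = flow M t (x 0) := by
  have h := ODE_solution_unique (v := fun _ => M) (K := ‖M‖₊) (f := x)
    (g := fun t => flow M t (x 0)) (a := 0) (b := t) (fun _ => M.lipschitz)
    (fun s hs => ((hx s hs.1).continuousWithinAt).mono fun r hr => hr.1)
    (fun s hs => (hx s hs.1).mono (Set.Ici_subset_Ici.2 hs.1))
    (fun s _ => (hasDerivAt_flow M _ s).continuousAt.continuousWithinAt)
    (fun s _ => (hasDerivAt_flow M _ s).hasDerivWithinAt) (by simp)
  exact h ⟨ht, le_rfl⟩

theorem norm_flow_sub_le {M : E →L[ℂ] E} {C : ℝ}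
    (hC : ∀ t, 0 ≤ t → ∀ z, ‖flow M t z‖ ≤ C * ‖z‖) (x : E) {s t : ℝ} (hs : 0 ≤ s) (ht : 0 ≤ t) :
    ‖flow M s x - flow M t x‖ ≤ C * ‖M x‖ * ‖s - t‖ :=
  (convex_Ici (0 : ℝ)).norm_image_sub_le_of_norm_hasDerivWithin_le
    (fun r _ => (hasDerivAt_flow M x r).hasDerivWithinAt)
    (fun r hr => by rw [← flow_apply_comm]; exact hC r hr _) ht hs

end Flow

section Diagonal

variable {ι E : Type*} [NormedAddCommGroup E]

theorem memℓp_of_norm_le_mul {x : lp (fun _ : ι => E) 2} {y : ι → E} {C : ℝ}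
    (h : ∀ k, ‖y k‖ ≤ C * ‖x k‖) : Memℓp y 2 := by
  exact ((lp.memℓp x).norm.const_mul C).mono h

/-- Dominated convergence in `ℓ²`. -/
theorem lp_tendsto_zero {α : Type*} {l : Filter α} {F : α → lp (fun _ : ι => E) 2}
    {b : lp (fun _ : ι => E) 2} {C : ℝ} (hb : ∀ᶠ s in l, ∀ k, ‖F s k‖ ≤ C * ‖b k‖)
    (hF : ∀ k, Tendsto (fun s => F s k) l (𝓝 0)) : Tendsto F l (𝓝 0) := by
  have hp : (0 : ℝ) < (2 : ENNReal).toReal := by norm_num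
  have hn : ∀ f : lp (fun _ : ι => E) 2, ‖f‖ ^ 2 = ∑' k, ‖f k‖ ^ 2 := fun f => by
    have := lp.norm_rpow_eq_tsum hp f
    simpa using this
  rw [tendsto_zero_iff_norm_tendsto_zero]
  have h1 : Tendsto (fun s => ‖F s‖ ^ 2) l (𝓝 0) := by
    simp_rw [hn]
    have h2 : Summable fun k => (C * ‖b k‖) ^ 2 := by
      simp_rw [mul_pow]
      refine Summable.mul_left _ ?_
      simpa using (lp.memℓp b).summable hp
    have h3 := tendsto_tsum_of_dominated_convergence (𝓕 := l) (f := fun s k => ‖F s k‖ ^ 2)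
      (g := fun _ => (0 : ℝ)) h2 (fun k => by simpa using ((hF k).norm.pow 2)) (by
        filter_upwards [hb] with s hs k
        rw [Real.norm_of_nonneg (by positivity)]
        exact pow_le_pow_left₀ (norm_nonneg _) (hs k) 2)
    simpa using h3
  have h4 := h1.sqrt
  simpa [Real.sqrt_sq (norm_nonneg _)] using h4

variable [NormedSpace ℂ E] [CompleteSpace E]

/-- A bounded family of flows acts on `ℓ²`, and its orbits through the domain of the diagonal
operator are differentiable. -/
theorem exists_diagonal_solution {M : ι → E →L[ℂ] E} {C : ℝ}
    (hC : ∀ k t, 0 ≤ t → ∀ z, ‖flow (M k) t z‖ ≤ C * ‖z‖)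
    {x y : lp (fun _ : ι => E) 2} (hxy : ∀ k, y k = M k (x k)) :
    ∃ X Y : ℝ → lp (fun _ : ι => E) 2, X 0 = x ∧ ContinuousOn Y (Set.Ici 0) ∧
      ∀ t, 0 ≤ t → HasDerivWithinAt X (Y t) (Set.Ici 0) t ∧ ∀ k, Y t k = M k (X t k) := by
  have hmem : ∀ (z : lp (fun _ : ι => E) 2) (t : ℝ),
      Memℓp (fun k => flow (M k) (max t 0) (z k)) 2 := fun z t =>
    memℓp_of_norm_le_mul fun k => hC k _ (le_max_right _ _) (z k)
  let T : ℝ → lp (fun _ : ι => E) 2 → lp (fun _ : ι => E) 2 := fun t z => ⟨_, hmem z t⟩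
  have hT : ∀ t z k, 0 ≤ t → T t z k = flow (M k) t (z k) := fun t z k ht => by
    change flow (M k) (max t 0) (z k) = _
    rw [max_eq_left ht]
  refine ⟨fun t => T t x, fun t => T t y, ?_, fun t ht => ?_, fun t ht => ⟨?_, fun k => ?_⟩⟩
  · ext k
    rw [hT _ _ _ le_rfl]; simp
  · have ht : 0 ≤ t := ht
    change Tendsto _ _ _
    rw [tendsto_iff_norm_sub_tendsto_zero, ← tendsto_zero_iff_norm_tendsto_zero]
    refine lp_tendsto_zero (b := y) (C := C + C) ?_ fun k => ?_
    · filter_upwards [self_mem_nhdsWithin] with s hs k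
      rw [lp.coeFn_sub, Pi.sub_apply, hT _ _ _ hs, hT _ _ _ ht, add_mul]
      exact (norm_sub_le _ _).trans (add_le_add (hC k s hs _) (hC k t ht _))
    · have h := (hasDerivAt_flow (M k) (y k) t).continuousAt.continuousWithinAt (s := Set.Ici 0)
      have h2 := (h.tendsto.sub_const (flow (M k) t (y k)))
      rw [sub_self] at h2
      refine h2.congr' ?_
      filter_upwards [self_mem_nhdsWithin] with s hs
      rw [lp.coeFn_sub, Pi.sub_apply, hT _ _ _ hs, hT _ _ _ ht]
  · rw [hasDerivWithinAt_iff_tendsto]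
    have hsm : ∀ (s : ℝ) (z : lp (fun _ : ι => E) 2) (k : ι), (s • z) k = s • z k :=
      fun s z k => rfl
    have hval : ∀ s, 0 ≤ s → ∀ k, (‖s - t‖⁻¹ • (T s x - T t x - (s - t) • T t y)) k =
        ‖s - t‖⁻¹ • (flow (M k) s (x k) - flow (M k) t (x k) -
          (s - t) • M k (flow (M k) t (x k))) := fun s hs k => by
      rw [hsm, lp.coeFn_sub, Pi.sub_apply, lp.coeFn_sub, Pi.sub_apply, hsm,
        hT _ _ _ hs, hT _ _ _ ht, hT _ _ _ ht, hxy, flow_apply_comm]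
    have h := lp_tendsto_zero (l := 𝓝[Set.Ici 0] t) (b := y) (C := C + C)
      (F := fun s => ‖s - t‖⁻¹ • (T s x - T t x - (s - t) • T t y)) ?_ fun k => ?_
    · refine (tendsto_zero_iff_norm_tendsto_zero.1 h).congr fun s => ?_
      rw [norm_smul, norm_inv, norm_norm]
    · filter_upwards [self_mem_nhdsWithin] with s hs k
      rw [hval s hs, norm_smul, norm_inv, norm_norm]
      have h1 := norm_flow_sub_le (hC k) (x k) hs ht
      have h2 := hC k t ht (M k (x k))
      rw [flow_apply_comm] at h2
      rw [← hxy] at h1 h2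
      have h3 : ‖flow (M k) s (x k) - flow (M k) t (x k) -
          (s - t) • M k (flow (M k) t (x k))‖ ≤ ‖s - t‖ * ((C + C) * ‖y k‖) := by
        refine (norm_sub_le _ _).trans ?_
        rw [norm_smul]
        nlinarith [norm_nonneg (s - t)]
      rcases eq_or_lt_of_le (norm_nonneg (s - t)) with h0 | h0
      · rw [← h0, inv_zero, zero_mul]
        have := (norm_nonneg _).trans h2
        linarith
      · rw [inv_mul_le_iff₀ h0]
        exact h3
    · have h1 := hasDerivWithinAt_iff_tendsto.1
        ((hasDerivAt_flow (M k) (x k) t).hasDerivWithinAt (s := Set.Ici 0))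
      rw [tendsto_zero_iff_norm_tendsto_zero]
      refine h1.congr' ?_
      filter_upwards [self_mem_nhdsWithin] with s hs
      rw [hval s hs, norm_smul, norm_inv, norm_norm]
  · rw [hT _ _ _ ht, hT _ _ _ ht, hxy, flow_apply_comm]

theorem diagonal_solution_apply {M : ι → E →L[ℂ] E} {X Y : ℝ → lp (fun _ : ι => E) 2}
    (h : ∀ t, 0 ≤ t → HasDerivWithinAt X (Y t) (Set.Ici 0) t ∧ ∀ k, Y t k = M k (X t k))
    {t : ℝ} (ht : 0 ≤ t) (k : ι) : X t k = flow (M k) t (X 0 k) := by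
  refine flow_unique (M k) (x := fun t => X t k) (fun s hs => ?_) ht
  have h1 := ((lp.evalCLM ℂ (fun _ : ι => E) 2 k).restrictScalars ℝ).hasFDerivAt.comp_hasDerivWithinAt
    s (h s hs).1
  have h2 : (lp.evalCLM ℂ (fun _ : ι => E) 2 k).restrictScalars ℝ (Y s) = M k (X s k) :=
    (h s hs).2 k
  rw [h2] at h1
  exact h1

end Diagonal

/-! ### Reduction of the coupled system to its modes -/

section ModeOperator

theorem EnergySpace.ext {N : ℕ} {H₁ H₀ : Type*}
    [NormedAddCommGroup H₁] [InnerProductSpace ℂ H₁]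
    [NormedAddCommGroup H₀] [InnerProductSpace ℂ H₀] {x y : EnergySpace N H₁ H₀}
    (h₁ : ∀ i, x.fst i = y.fst i) (h₂ : ∀ i, x.snd i = y.snd i) : x = y :=
  (WithLp.ofLp_injective 2) (Prod.ext (PiLp.ext h₁) (PiLp.ext h₂))

/-- The state with components `a` and `b`. -/
def state {N : ℕ} {H₁ H₀ : Type*}
    [NormedAddCommGroup H₁] [InnerProductSpace ℂ H₁]
    [NormedAddCommGroup H₀] [InnerProductSpace ℂ H₀] (a : Fin N → H₁) (b : Fin N → H₀) :
    EnergySpace N H₁ H₀ :=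
  WithLp.toLp 2 (WithLp.toLp 2 a, WithLp.toLp 2 b)

theorem state_fst {N : ℕ} {H₁ H₀ : Type*}
    [NormedAddCommGroup H₁] [InnerProductSpace ℂ H₁]
    [NormedAddCommGroup H₀] [InnerProductSpace ℂ H₀] (a : Fin N → H₁) (b : Fin N → H₀)
    (i : Fin N) : (state a b).fst i = a i := rfl

theorem state_snd {N : ℕ} {H₁ H₀ : Type*}
    [NormedAddCommGroup H₁] [InnerProductSpace ℂ H₁]
    [NormedAddCommGroup H₀] [InnerProductSpace ℂ H₀] (a : Fin N → H₁) (b : Fin N → H₀)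
    (i : Fin N) : (state a b).snd i = b i := rfl

variable {N : ℕ}

/-- `modeOp` as a linear map. -/
def modeOpₗ (A D : Matrix (Fin N) (Fin N) ℝ) (ν γ : ℝ) :
    EnergySpace N ℂ ℂ →ₗ[ℂ] EnergySpace N ℂ ℂ where
  toFun z := state (fun i => (ν : ℂ) * z.snd i) fun i => -((ν : ℂ) * z.fst i
      + (∑ j, (A i j : ℂ) * z.fst j) / ν + γ * ∑ j, (D i j : ℂ) * z.snd j)
  map_add' x y := by
    refine EnergySpace.ext (fun i => ?_) fun i => ?_
    · simp only [WithLp.add_fst, WithLp.add_snd, PiLp.add_apply, state_fst, mul_add]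
    · simp only [WithLp.add_fst, WithLp.add_snd, PiLp.add_apply, state_snd, mul_add,
        Finset.sum_add_distrib]
      ring
  map_smul' c x := by
    refine EnergySpace.ext (fun i => ?_) fun i => ?_
    · simp only [WithLp.smul_fst, WithLp.smul_snd, PiLp.smul_apply, smul_eq_mul, state_fst,
        RingHom.id_apply]
      ring
    · simp only [WithLp.smul_fst, WithLp.smul_snd, PiLp.smul_apply, smul_eq_mul, state_snd,
        RingHom.id_apply, mul_left_comm _ c, ← Finset.mul_sum]
      ring

/-- The matrix of `𝒜` on the mode of frequency `ν`, in the coordinates `(ν u, u')` and for the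
scalar damping coefficient `γ`: `(a, b) ↦ (ν b, -(ν a + A a / ν + γ D b))`. -/
def modeOp (A D : Matrix (Fin N) (Fin N) ℝ) (ν γ : ℝ) :
    EnergySpace N ℂ ℂ →L[ℂ] EnergySpace N ℂ ℂ :=
  ⟨modeOpₗ A D ν γ, by
    have h1 : ∀ i, Continuous fun z : EnergySpace N ℂ ℂ => z.fst i := fun i =>
      (PiLp.continuous_apply 2 _ i).comp (WithLp.continuous_fst 2 _ _)
    have h2 : ∀ i, Continuous fun z : EnergySpace N ℂ ℂ => z.snd i := fun i =>
      (PiLp.continuous_apply 2 _ i).comp (WithLp.continuous_snd 2 _ _)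
    refine (WithLp.prod_continuous_toLp 2 _ _).comp
      (((PiLp.continuous_toLp 2 _).comp (continuous_pi fun i => ?_)).prodMk
        ((PiLp.continuous_toLp 2 _).comp (continuous_pi fun i => ?_)))
    · exact continuous_const.mul (h2 i)
    · exact (((continuous_const.mul (h1 i)).add ((continuous_finsetSum _ fun j _ =>
        continuous_const.mul (h1 j)).div_const _)).add (continuous_const.mul
          (continuous_finsetSum _ fun j _ => continuous_const.mul (h2 j)))).neg⟩

theorem modeOp_fst (A D : Matrix (Fin N) (Fin N) ℝ) (ν γ : ℝ) (z : EnergySpace N ℂ ℂ)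
    (i : Fin N) : (modeOp A D ν γ z).fst i = (ν : ℂ) * z.snd i := rfl

theorem modeOp_snd (A D : Matrix (Fin N) (Fin N) ℝ) (ν γ : ℝ) (z : EnergySpace N ℂ ℂ)
    (i : Fin N) : (modeOp A D ν γ z).snd i = -((ν : ℂ) * z.fst i
      + (∑ j, (A i j : ℂ) * z.fst j) / ν + γ * ∑ j, (D i j : ℂ) * z.snd j) := rfl

end ModeOperator

section Reduction

variable {H₁ H₀ K Z ι : Type*} {N : ℕ}
  [NormedAddCommGroup H₁] [InnerProductSpace ℂ H₁]
  [NormedAddCommGroup H₀] [InnerProductSpace ℂ H₀]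
  [NormedAddCommGroup K] [InnerProductSpace ℂ K]
  [NormedAddCommGroup Z] [InnerProductSpace ℂ Z]
  {m : Model H₁ H₀ K Z}

theorem norm_fst_apply_le (z : EnergySpace N H₁ H₀) (i : Fin N) : ‖z.fst i‖ ≤ ‖z‖ :=
  (PiLp.norm_apply_le z.fst i).trans (WithLp.norm_fst_le _ z)

theorem norm_snd_apply_le (z : EnergySpace N H₁ H₀) (i : Fin N) : ‖z.snd i‖ ≤ ‖z‖ :=
  (PiLp.norm_apply_le z.snd i).trans (WithLp.norm_snd_le _ z)

theorem norm_le_sum_norm (z : EnergySpace N H₁ H₀) :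
    ‖z‖ ≤ ∑ i, ‖z.fst i‖ + ∑ i, ‖z.snd i‖ := by
  have h1 : 0 ≤ ∑ i, ‖z.fst i‖ := Finset.sum_nonneg fun i _ => norm_nonneg _
  have h2 : 0 ≤ ∑ i, ‖z.snd i‖ := Finset.sum_nonneg fun i _ => norm_nonneg _
  apply abs_le_of_sq_le_sq' _ (by positivity) |>.2
  rw [WithLp.prod_norm_sq_eq_of_L2, PiLp.norm_sq_eq_of_L2, PiLp.norm_sq_eq_of_L2]
  have h3 := Finset.sum_sq_le_sq_sum_of_nonneg (s := Finset.univ) (f := fun i => ‖z.fst i‖)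
    (fun i _ => norm_nonneg _)
  have h4 := Finset.sum_sq_le_sq_sum_of_nonneg (s := Finset.univ) (f := fun i => ‖z.snd i‖)
    (fun i _ => norm_nonneg _)
  nlinarith

/-- The state whose modes are a given square-summable sequence. -/
def Model.ModalBasis.synthesis (B : m.ModalBasis ι) (N : ℕ) :
    lp (fun _ : ι => EnergySpace N ℂ ℂ) 2 →ₗ[ℂ] EnergySpace N H₁ H₀ where
  toFun z := state
    (fun i => B.w.symm ⟨fun k => (z k).fst i,
      (lp.memℓp z).mono' fun k => norm_fst_apply_le (z k) i⟩)
    fun i => B.e.repr.symm ⟨fun k => (z k).snd i,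
      (lp.memℓp z).mono' fun k => norm_snd_apply_le (z k) i⟩
  map_add' x y := by
    refine EnergySpace.ext (fun i => ?_) fun i => ?_
    · simp only [WithLp.add_fst, PiLp.add_apply, state_fst]
      rw [← map_add]; rfl
    · simp only [WithLp.add_snd, PiLp.add_apply, state_snd]
      rw [← map_add]; rfl
  map_smul' c x := by
    refine EnergySpace.ext (fun i => ?_) fun i => ?_
    · simp only [WithLp.smul_fst, PiLp.smul_apply, RingHom.id_apply, state_fst]
      rw [← map_smul]; rfl
    · simp only [WithLp.smul_snd, PiLp.smul_apply, RingHom.id_apply, state_snd]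
      rw [← map_smul]; rfl

theorem Model.ModalBasis.synthesis_fst (B : m.ModalBasis ι)
    (z : lp (fun _ : ι => EnergySpace N ℂ ℂ) 2) (i : Fin N) (k : ι) :
    B.w ((B.synthesis N z).fst i) k = (z k).fst i := by
  change B.w (B.w.symm _) k = _
  rw [B.w.apply_symm_apply]

theorem Model.ModalBasis.synthesis_snd (B : m.ModalBasis ι)
    (z : lp (fun _ : ι => EnergySpace N ℂ ℂ) 2) (i : Fin N) (k : ι) :
    B.e.repr ((B.synthesis N z).snd i) k = (z k).snd i := by
  change B.e.repr (B.e.repr.symm _) k = _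
  rw [B.e.repr.apply_symm_apply]

theorem Model.ModalBasis.continuous_synthesis (B : m.ModalBasis ι) :
    Continuous (B.synthesis N) := by
  have hp : (2 : ENNReal) ≠ 0 := by norm_num
  refine AddMonoidHomClass.continuous_of_bound (B.synthesis N)
    (∑ _i : Fin N, ‖(B.w.symm : lp (fun _ : ι => ℂ) 2 →L[ℂ] H₁)‖ + ∑ _i : Fin N, 1) fun z => ?_
  refine (norm_le_sum_norm _).trans ?_
  rw [add_mul, Finset.sum_mul, Finset.sum_mul]
  gcongr with i _ i _
  · refine ((B.w.symm : lp (fun _ : ι => ℂ) 2 →L[ℂ] H₁).le_opNorm _).trans ?_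
    gcongr
    exact lp.norm_mono hp fun k => norm_fst_apply_le (z k) i
  · rw [one_mul]
    change ‖B.e.repr.symm _‖ ≤ _
    rw [LinearIsometryEquiv.norm_map]
    exact lp.norm_mono hp fun k => norm_snd_apply_le (z k) i

theorem Model.ModalBasis.synthesis_bijective (B : m.ModalBasis ι) :
    Function.Bijective (B.synthesis N) := by
  constructor
  · intro x y h
    ext k
    have h3 : x k = y k := by
      refine EnergySpace.ext (fun i => ?_) fun i => ?_
      · rw [← B.synthesis_fst, h, B.synthesis_fst]
      · rw [← B.synthesis_snd, h, B.synthesis_snd]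
    rw [h3]
  · intro X
    let z : ι → EnergySpace N ℂ ℂ := fun k =>
      state (fun i => B.w (X.fst i) k) fun i => B.e.repr (X.snd i) k
    have hz : Memℓp z 2 := by
      have h1 : Memℓp (fun k => ∑ i, ‖B.w (X.fst i) k‖ + ∑ i, ‖B.e.repr (X.snd i) k‖) 2 :=
        (Memℓp.finsetSum _ fun i _ => (lp.memℓp (B.w (X.fst i))).norm).add
          (Memℓp.finsetSum _ fun i _ => (lp.memℓp (B.e.repr (X.snd i))).norm)
      exact h1.mono fun k => norm_le_sum_norm (z k)
    refine ⟨⟨z, hz⟩, ?_⟩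
    refine EnergySpace.ext (fun i => ?_) fun i => ?_
    · apply B.w.injective
      ext k
      rw [B.synthesis_fst]; rfl
    · apply B.e.repr.injective
      ext k
      rw [B.synthesis_snd]; rfl

variable [CompleteSpace H₁] [CompleteSpace H₀]

/-- The isomorphism between the energy space and the square-summable sequences of modes; the mode
`k` of `(U, V)` is `(ν k ⟨e k, U⟩, ⟨e k, V⟩)`. -/
def Model.ModalBasis.modes (B : m.ModalBasis ι) (N : ℕ) :
    EnergySpace N H₁ H₀ ≃L[ℂ] lp (fun _ : ι => EnergySpace N ℂ ℂ) 2 :=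
  ((LinearEquiv.ofBijective (B.synthesis N)
    B.synthesis_bijective).toContinuousLinearEquivOfContinuous B.continuous_synthesis).symm

theorem Model.ModalBasis.synthesis_modes (B : m.ModalBasis ι) (X : EnergySpace N H₁ H₀) :
    B.synthesis N (B.modes N X) = X :=
  (B.modes N).symm_apply_apply X

theorem Model.ModalBasis.modes_fst (B : m.ModalBasis ι) (X : EnergySpace N H₁ H₀) (k : ι)
    (i : Fin N) : (B.modes N X k).fst i = (B.ν k : ℂ) * inner ℂ (B.e k) (m.emb (X.fst i)) := by
  rw [← B.synthesis_fst, B.synthesis_modes, B.w_apply]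

theorem Model.ModalBasis.modes_snd (B : m.ModalBasis ι) (X : EnergySpace N H₁ H₀) (k : ι)
    (i : Fin N) : (B.modes N X k).snd i = inner ℂ (B.e k) (X.snd i) := by
  rw [← B.synthesis_snd, B.synthesis_modes, B.e.repr_apply_apply]

/-- The operator `𝒜` is diagonal in the modes. -/
theorem Model.ModalBasis.opRel_iff (B : m.ModalBasis ι) {γ : ι → ℝ}
    (hγ : ∀ k u, inner ℂ (m.damp (B.φ k)) (m.damp u) = (γ k : ℂ) * inner ℂ (B.e k) (m.emb u))
    (A D : Matrix (Fin N) (Fin N) ℝ) (X Y : EnergySpace N H₁ H₀) :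
    m.OpRel A D X Y ↔
      ∀ k, B.modes N Y k = modeOp A D (B.ν k) (γ k) (B.modes N X k) := by
  have hν : ∀ k, (B.ν k : ℂ) ≠ 0 := fun k => by exact_mod_cast (B.ν_pos k).ne'
  have hfst : (∀ i, m.emb (Y.fst i) = X.snd i) ↔
      ∀ k i, (B.modes N Y k).fst i = (modeOp A D (B.ν k) (γ k) (B.modes N X k)).fst i := by
    simp only [modeOp_fst, B.modes_fst, B.modes_snd]
    constructor
    · intro h k i
      rw [h]
    · intro h i
      apply B.e.repr.injective
      ext k
      rw [B.e.repr_apply_apply, B.e.repr_apply_apply]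
      exact mul_left_cancel₀ (hν k) (h k i)
  have hsnd : (∀ i, m.emb (Y.fst i) = X.snd i) → ((∀ (i : Fin N) (φ : H₁),
      inner ℂ (m.stiff φ) (m.stiff (X.fst i))
        + ∑ j, (A i j : ℂ) * inner ℂ (m.emb φ) (m.emb (X.fst j))
        + ∑ j, (D i j : ℂ) * inner ℂ (m.damp φ) (m.damp (Y.fst j))
      = -inner ℂ (m.emb φ) (Y.snd i)) ↔
      ∀ k i, (B.modes N Y k).snd i = (modeOp A D (B.ν k) (γ k) (B.modes N X k)).snd i) := by
    intro h1
    have hk : ∀ k i, (inner ℂ (m.stiff (B.φ k)) (m.stiff (X.fst i))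
        + ∑ j, (A i j : ℂ) * inner ℂ (m.emb (B.φ k)) (m.emb (X.fst j))
        + ∑ j, (D i j : ℂ) * inner ℂ (m.damp (B.φ k)) (m.damp (Y.fst j))
      = -inner ℂ (m.emb (B.φ k)) (Y.snd i)) ↔
        (B.modes N Y k).snd i = (modeOp A D (B.ν k) (γ k) (B.modes N X k)).snd i := by
      intro k i
      simp only [modeOp_snd, B.modes_fst, B.modes_snd, B.stiff_φ, hγ, B.emb_φ, h1]
      have e1 : (∑ j, (A i j : ℂ) * ((B.ν k : ℂ) * inner ℂ (B.e k) (m.emb (X.fst j)))) / B.ν k =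
          ∑ j, (A i j : ℂ) * inner ℂ (B.e k) (m.emb (X.fst j)) := by
        rw [Finset.sum_div]
        refine Finset.sum_congr rfl fun j _ => ?_
        field_simp [hν k]
      have e2 : ∑ j, (D i j : ℂ) * ((γ k : ℂ) * inner ℂ (B.e k) (X.snd j)) =
          γ k * ∑ j, (D i j : ℂ) * inner ℂ (B.e k) (X.snd j) := by
        rw [Finset.mul_sum]
        exact Finset.sum_congr rfl fun j _ => by ring
      rw [e1, e2, ← mul_assoc, ← pow_two, eq_neg_iff_add_eq_zero, eq_neg_iff_add_eq_zero, add_comm]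
    simp only [← hk]
    constructor
    · exact fun h k i => h i (B.φ k)
    · intro h i
      -- both sides are continuous and conjugate-linear in the test function
      have hclosed : IsClosed {φ : H₁ | inner ℂ (m.stiff φ) (m.stiff (X.fst i))
          + ∑ j, (A i j : ℂ) * inner ℂ (m.emb φ) (m.emb (X.fst j))
          + ∑ j, (D i j : ℂ) * inner ℂ (m.damp φ) (m.damp (Y.fst j))
          = -inner ℂ (m.emb φ) (Y.snd i)} :=
        isClosed_eq (by fun_prop) (by fun_prop)
      refine fun φ => B.dense_φ.induction (P := fun φ => _ = _) (fun φ hφ => ?_) hclosed φ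
      induction hφ using Submodule.span_induction with
      | mem φ hφ => obtain ⟨k, rfl⟩ := hφ; exact h k i
      | zero => simp
      | add x y _ _ hx hy =>
        simp only [map_add, inner_add_left, mul_add, Finset.sum_add_distrib, neg_add]
        rw [← hx, ← hy]; ring
      | smul c x _ hx =>
        simp only [map_smul, inner_smul_left, ← mul_neg, ← hx, mul_add, Finset.mul_sum,
          mul_left_comm]
  constructor
  · rintro ⟨h1, h2⟩ k
    refine EnergySpace.ext (fun i => ?_) fun i => ?_
    · exact hfst.1 h1 k i
    · exact (hsnd h1).1 h2 k i
  · intro h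
    have h1 := hfst.2 fun k i => by rw [h k]
    exact ⟨h1, (hsnd h1).2 fun k i => by rw [h k]⟩

end Reduction

/-! ### Well-posedness and decay from uniform estimates on the modes -/

section Consequences

variable {H₁ H₀ K Z ι : Type*} {N : ℕ}
  [NormedAddCommGroup H₁] [InnerProductSpace ℂ H₁]
  [NormedAddCommGroup H₀] [InnerProductSpace ℂ H₀]
  [NormedAddCommGroup K] [InnerProductSpace ℂ K]
  [NormedAddCommGroup Z] [InnerProductSpace ℂ Z]
  {m : Model H₁ H₀ K Z} [CompleteSpace H₁] [CompleteSpace H₀]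

/-- The modes of a solution evolve independently; in particular solutions are unique. -/
theorem Model.ModalBasis.modes_solution (B : m.ModalBasis ι) {γ : ι → ℝ}
    (hγ : ∀ k u, inner ℂ (m.damp (B.φ k)) (m.damp u) = (γ k : ℂ) * inner ℂ (B.e k) (m.emb u))
    {A D : Matrix (Fin N) (Fin N) ℝ} {X : ℝ → EnergySpace N H₁ H₀} (hX : m.IsSolution A D X)
    {t : ℝ} (ht : 0 ≤ t) (k : ι) :
    B.modes N (X t) k = flow (modeOp A D (B.ν k) (γ k)) t (B.modes N (X 0) k) := by
  obtain ⟨X', _, h⟩ := hX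
  let P : EnergySpace N H₁ H₀ →L[ℂ] lp (fun _ : ι => EnergySpace N ℂ ℂ) 2 := B.modes N
  have h1 : ∀ s, 0 ≤ s → HasDerivWithinAt (fun t => P (X t)) (P (X' s)) (Set.Ici 0) s ∧
      ∀ k, P (X' s) k = modeOp A D (B.ν k) (γ k) (P (X s) k) := fun s hs =>
    ⟨(P.restrictScalars ℝ).hasFDerivAt.comp_hasDerivWithinAt s (h s hs).1,
      (B.opRel_iff hγ A D _ _).1 (h s hs).2⟩
  exact diagonal_solution_apply (M := fun k => modeOp A D (B.ν k) (γ k)) h1 ht k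

theorem Model.ModalBasis.wellPosed (B : m.ModalBasis ι) {γ : ι → ℝ}
    (hγ : ∀ k u, inner ℂ (m.damp (B.φ k)) (m.damp u) = (γ k : ℂ) * inner ℂ (B.e k) (m.emb u))
    {A D : Matrix (Fin N) (Fin N) ℝ} {C : ℝ}
    (hC : ∀ k t, 0 ≤ t → ∀ z, ‖flow (modeOp A D (B.ν k) (γ k)) t z‖ ≤ C * ‖z‖) :
    m.WellPosed A D := by
  intro X₀ Y₀ h₀
  obtain ⟨X, Y, hX0, hY, hXY⟩ := exists_diagonal_solution hC ((B.opRel_iff hγ A D _ _).1 h₀)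
  have hsol : m.IsSolution A D fun t => (B.modes N).symm (X t) := by
    refine ⟨fun t => (B.modes N).symm (Y t), (B.modes N).symm.continuous.comp_continuousOn hY,
      fun t ht => ⟨?_, ?_⟩⟩
    · exact ((((B.modes N).symm : lp (fun _ : ι => EnergySpace N ℂ ℂ) 2 →L[ℂ] EnergySpace N H₁ H₀
        ).restrictScalars ℝ).hasFDerivAt).comp_hasDerivWithinAt t (hXY t ht).1
    · rw [B.opRel_iff hγ]
      intro k
      rw [(B.modes N).apply_symm_apply, (B.modes N).apply_symm_apply]
      exact (hXY t ht).2 k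
  refine ⟨_, hsol, ?_, fun X₂ hX₂ h2 t ht => ?_⟩
  · simp only [hX0, (B.modes N).symm_apply_apply]
  · apply (B.modes N).injective
    ext k
    rw [B.modes_solution hγ hX₂ ht k, B.modes_solution hγ hsol ht k, h2, hX0,
      (B.modes N).symm_apply_apply]

theorem lp_norm_le_of_forall_le {E : Type*} [NormedAddCommGroup E]
    {x y z : lp (fun _ : ι => E) 2} {c : ℝ} (hc : 0 ≤ c)
    (h : ∀ k, ‖x k‖ ≤ c * (‖y k‖ + ‖z k‖)) : ‖x‖ ≤ c * (‖y‖ + ‖z‖) := by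
  have hp : (2 : ENNReal) ≠ 0 := by norm_num
  let n : lp (fun _ : ι => E) 2 → lp (fun _ : ι => ℝ) 2 := fun w =>
    ⟨fun k => ‖w k‖, (lp.memℓp w).norm⟩
  have hn : ∀ w, ‖n w‖ ≤ ‖w‖ := fun w => lp.norm_mono hp fun k => by simp [n]
  calc ‖x‖ ≤ ‖c • (n y + n z)‖ := lp.norm_mono hp fun k => by
        have : (c • (n y + n z)) k = c * (‖y k‖ + ‖z k‖) := rfl
        rw [this]
        exact (h k).trans (le_abs_self _)
    _ ≤ c * (‖y‖ + ‖z‖) := by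
        rw [norm_smul, Real.norm_of_nonneg hc]
        gcongr
        exact (norm_add_le _ _).trans (add_le_add (hn y) (hn z))

theorem Model.ModalBasis.decayBound (B : m.ModalBasis ι) {γ : ι → ℝ}
    (hγ : ∀ k u, inner ℂ (m.damp (B.φ k)) (m.damp u) = (γ k : ℂ) * inner ℂ (B.e k) (m.emb u))
    {A D : Matrix (Fin N) (Fin N) ℝ} {C θ : ℝ} (hC0 : 0 ≤ C)
    (hC : ∀ k t, 1 ≤ t → ∀ z, ‖flow (modeOp A D (B.ν k) (γ k)) t z‖
      ≤ C * t ^ (-θ) * (‖z‖ + ‖modeOp A D (B.ν k) (γ k) z‖)) :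
    ∃ M : ℝ, 0 < M ∧ ∀ t : ℝ, 1 ≤ t → m.DecayBoundAt A D (fun s => M * s ^ (-θ)) t := by
  let P : EnergySpace N H₁ H₀ →L[ℂ] lp (fun _ : ι => EnergySpace N ℂ ℂ) 2 := B.modes N
  let Q : lp (fun _ : ι => EnergySpace N ℂ ℂ) 2 →L[ℂ] EnergySpace N H₁ H₀ := (B.modes N).symm
  refine ⟨‖Q‖ * C * ‖P‖ + 1, by positivity, fun t ht X hX Y₀ hY₀ => ?_⟩
  have ht0 : 0 ≤ t ^ (-θ) := Real.rpow_nonneg (by linarith) _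
  have h1 : ‖P (X t)‖ ≤ C * t ^ (-θ) * (‖P (X 0)‖ + ‖P Y₀‖) := by
    refine lp_norm_le_of_forall_le (by positivity) fun k => ?_
    have h2 := hC k t ht (P (X 0) k)
    have h3 : P Y₀ k = _ := (B.opRel_iff hγ A D _ _).1 hY₀ k
    rw [h3]
    have h4 : P (X t) k = _ := B.modes_solution hγ hX (by linarith) k
    rw [h4]
    exact h2
  have h5 : ‖X t‖ ≤ ‖Q‖ * ‖P (X t)‖ := by
    have : X t = Q (P (X t)) := ((B.modes N).symm_apply_apply _).symm
    nth_rw 1 [this]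
    exact Q.le_opNorm _
  calc ‖X t‖ ≤ ‖Q‖ * (C * t ^ (-θ) * (‖P‖ * ‖X 0‖ + ‖P‖ * ‖Y₀‖)) := by
        refine h5.trans ?_
        gcongr
        refine h1.trans ?_
        gcongr <;> exact P.le_opNorm _
    _ = ‖Q‖ * C * ‖P‖ * t ^ (-θ) * (‖X 0‖ + ‖Y₀‖) := by ring
    _ ≤ (‖Q‖ * C * ‖P‖ + 1) * t ^ (-θ) * (‖X 0‖ + ‖Y₀‖) := by
        gcongr
        linarith

end Consequences

/-! ### Eigenvalues close to the imaginary axis limit the decay rate -/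

section LowerBound

variable {H₁ H₀ K Z : Type*} {N : ℕ}
  [NormedAddCommGroup H₁] [InnerProductSpace ℂ H₁]
  [NormedAddCommGroup H₀] [InnerProductSpace ℂ H₀]
  [NormedAddCommGroup K] [InnerProductSpace ℂ K]
  [NormedAddCommGroup Z] [InnerProductSpace ℂ Z]
  {m : Model H₁ H₀ K Z} {A D : Matrix (Fin N) (Fin N) ℝ}

theorem Model.OpRel.smul {X Y : EnergySpace N H₁ H₀} (h : m.OpRel A D X Y) (c : ℂ) :
    m.OpRel A D (c • X) (c • Y) := by
  refine ⟨fun i => ?_, fun i φ => ?_⟩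
  · simp only [WithLp.smul_fst, WithLp.smul_snd, PiLp.smul_apply, map_smul, h.1 i]
  · simp only [WithLp.smul_fst, WithLp.smul_snd, PiLp.smul_apply, map_smul, inner_smul_right,
      mul_left_comm _ c, ← Finset.mul_sum, ← mul_add, h.2 i φ, mul_neg]

theorem Model.IsEigenvector.isSolution {β : ℂ} {X₀ : EnergySpace N H₁ H₀}
    (h : m.IsEigenvector A D β X₀) :
    m.IsSolution A D fun t : ℝ => Complex.exp (β * t) • X₀ := by
  have hd : ∀ t : ℝ, HasDerivAt (fun t : ℝ => Complex.exp (β * t)) (Complex.exp (β * t) * β) t :=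
    fun t => by
      have h1 : HasDerivAt (fun s : ℝ => β * (s : ℂ)) β t := by
        simpa using (Complex.ofRealCLM.hasDerivAt (x := t)).const_mul β
      exact h1.cexp
  refine ⟨fun t => Complex.exp (β * t) • β • X₀, ?_, fun t _ => ⟨?_, h.2.smul _⟩⟩
  · exact Continuous.continuousOn (by fun_prop)
  · have := ((hd t).smul_const X₀).hasDerivWithinAt (s := Set.Ici 0)
    rwa [mul_smul] at this

theorem Model.IsEigenvector.le_of_decayBoundAt {β : ℂ} {X₀ : EnergySpace N H₁ H₀}
    (h : m.IsEigenvector A D β X₀) {ρ : ℝ → ℝ} {t : ℝ} (hρ : m.DecayBoundAt A D ρ t) :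
    Real.exp (β.re * t) ≤ ρ t * (1 + ‖β‖) := by
  have h1 := hρ _ h.isSolution (β • X₀) (by simpa using h.2)
  simp only [Complex.ofReal_zero, mul_zero, Complex.exp_zero, one_smul, norm_smul,
    Complex.norm_exp, Complex.mul_re, Complex.ofReal_re, Complex.ofReal_im, sub_zero] at h1
  have h2 : 0 < ‖X₀‖ := norm_pos_iff.2 h.1
  refine le_of_mul_le_mul_right ?_ h2
  linarith

/-- If `𝒜` has eigenvalues `β n` of size at most `ν n → ∞` with `Re β n ≥ -c / (ν n) ^ q`, then
solutions do not decay faster than `t ^ (-1 / q)`. -/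
theorem Model.not_decayBoundAt_of_eigenvalues {β : ℕ → ℂ} {ν : ℕ → ℝ}
    {X₀ : ℕ → EnergySpace N H₁ H₀}
    (hX : ∀ n, m.IsEigenvector A D (β n) (X₀ n)) (hν : Tendsto ν atTop atTop)
    {c C : ℝ} {q : ℕ} (hq : q ≠ 0) (hre : ∀ᶠ n in atTop, -c ≤ (β n).re * ν n ^ q)
    (hn : ∀ᶠ n in atTop, 1 + ‖β n‖ ≤ C * ν n) {ρ : ℝ → ℝ}
    (hρ : ρ =o[atTop] fun s : ℝ => s ^ (-(1 / q : ℝ))) :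
    ¬ ∀ᶠ t in atTop, m.DecayBoundAt A D ρ t := by
  intro hdec
  have hνq : Tendsto (fun n => ν n ^ q) atTop atTop := (tendsto_pow_atTop hq).comp hν
  have hC : 0 < |C| + 1 := by positivity
  -- at `t = ν n ^ q` the solution is still of size `exp (-c)`, relative to its initial norm
  have hε : 0 < Real.exp (-c) / (2 * (|C| + 1)) := by positivity
  have h1 := hνq.eventually (hρ.def hε)
  obtain ⟨n, h1, h2, h3, h4, h5⟩ := (h1.and ((hνq.eventually hdec).and (hre.and (hn.and
    (hν.eventually_gt_atTop 0))))).exists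
  have h6 := (hX n).le_of_decayBoundAt h2
  have h7 : (ν n ^ q) ^ (-(1 / q : ℝ)) = (ν n)⁻¹ := by
    rw [← Real.rpow_natCast, ← Real.rpow_mul h5.le, ← Real.rpow_neg_one]
    congr 1
    field_simp
  rw [h7, Real.norm_eq_abs, Real.norm_of_nonneg (inv_pos.2 h5).le] at h1
  have h8 : Real.exp (-c) ≤ Real.exp (-c) / (2 * (|C| + 1)) * (ν n)⁻¹ * (C * ν n) :=
    calc Real.exp (-c) ≤ Real.exp ((β n).re * ν n ^ q) := Real.exp_le_exp.2 h3
      _ ≤ ρ (ν n ^ q) * (1 + ‖β n‖) := h6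
      _ ≤ |ρ (ν n ^ q)| * (1 + ‖β n‖) := by gcongr; exact le_abs_self _
      _ ≤ Real.exp (-c) / (2 * (|C| + 1)) * (ν n)⁻¹ * (C * ν n) := by gcongr
  have h9 : Real.exp (-c) / (2 * (|C| + 1)) * (ν n)⁻¹ * (C * ν n) =
      Real.exp (-c) * (C / (2 * (|C| + 1))) := by field_simp
  have h10 : C / (2 * (|C| + 1)) < 1 := by
    rw [div_lt_one (by positivity)]
    linarith [le_abs_self C, abs_nonneg C]
  rw [h9] at h8
  nlinarith [Real.exp_pos (-c)]

end LowerBound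

/-! ### Lyapunov functionals for a single mode -/

section Lyapunov

/-- The energy of the mode equation in the coordinates `p = u₁ + 2 u₂`, `q = 2 u₁ - u₂`
(eigenvectors of the control matrix), where `r = p'`, `s = q'` and `l` is the eigenvalue. -/
def modeEnergy (l p q r s : ℝ) : ℝ :=
  r ^ 2 + s ^ 2 + (l + 9 / 5) * p ^ 2 - 4 / 5 * (p * q) + (l + 6 / 5) * q ^ 2

/-- The mode equation `u'' + l u + A u + γ D u' = 0` as a first-order system in the coordinates
`p = u₁ + 2 u₂`, `q = 2 u₁ - u₂`, in which only `p` is damped. -/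
structure IsMode (l γ : ℝ) (p q r s : ℝ → ℝ) : Prop where
  hp : ∀ t, HasDerivAt p (r t) t
  hq : ∀ t, HasDerivAt q (s t) t
  hr : ∀ t, HasDerivAt r (-(l + 9 / 5) * p t + 2 / 5 * q t - 5 * γ * r t) t
  hs : ∀ t, HasDerivAt s (-(l + 6 / 5) * q t + 2 / 5 * p t) t

variable {l γ : ℝ} {p q r s : ℝ → ℝ}

theorem IsMode.deriv (h : IsMode l γ p q r s) :
    IsMode l γ r s (fun t => -(l + 9 / 5) * p t + 2 / 5 * q t - 5 * γ * r t)
      (fun t => -(l + 6 / 5) * q t + 2 / 5 * p t) where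
  hp := h.hr
  hq := h.hs
  hr t := (((h.hp t).const_mul _).add ((h.hq t).const_mul _)).sub ((h.hr t).const_mul _)
  hs t := ((h.hq t).const_mul _).add ((h.hp t).const_mul _)

theorem modeEnergy_ge (l p q r s : ℝ) :
    r ^ 2 + s ^ 2 + (l + 1) * (p ^ 2 + q ^ 2) ≤ modeEnergy l p q r s := by
  unfold modeEnergy
  nlinarith [sq_nonneg (2 * p - q)]

theorem modeEnergy_le (l p q r s : ℝ) :
    modeEnergy l p q r s ≤ r ^ 2 + s ^ 2 + (l + 2) * (p ^ 2 + q ^ 2) := by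
  unfold modeEnergy
  nlinarith [sq_nonneg (p + 2 * q)]

theorem IsMode.hasDerivAt_energy (h : IsMode l γ p q r s) (t : ℝ) :
    HasDerivAt (fun t => modeEnergy l (p t) (q t) (r t) (s t)) (-10 * γ * r t ^ 2) t := by
  have h1 := (((((h.hr t).pow 2).add ((h.hs t).pow 2)).add (((h.hp t).pow 2).const_mul
    (l + 9 / 5))).sub (((h.hp t).mul (h.hq t)).const_mul (4 / 5))).add
    (((h.hq t).pow 2).const_mul (l + 6 / 5))
  refine h1.congr_deriv ?_
  push_cast
  ring

theorem le_apply_zero_of_hasDerivAt_nonpos {g g' : ℝ → ℝ} (hg : ∀ t, HasDerivAt g (g' t) t)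
    (h : ∀ t, 0 ≤ t → g' t ≤ 0) {t : ℝ} (ht : 0 ≤ t) : g t ≤ g 0 := by
  have h1 : AntitoneOn g (Set.Ici 0) := by
    refine antitoneOn_of_deriv_nonpos (convex_Ici 0)
      (fun t _ => (hg t).continuousAt.continuousWithinAt)
      (fun t _ => (hg t).differentiableAt.differentiableWithinAt) fun t ht => ?_
    rw [(hg t).deriv]
    rw [interior_Ici] at ht
    exact h t (le_of_lt ht)
  exact h1 Set.self_mem_Ici ht ht

theorem IsMode.energy_le (h : IsMode l γ p q r s) (hγ : 0 ≤ γ) {t : ℝ} (ht : 0 ≤ t) :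
    modeEnergy l (p t) (q t) (r t) (s t) ≤ modeEnergy l (p 0) (q 0) (r 0) (s 0) :=
  le_apply_zero_of_hasDerivAt_nonpos (g := fun t => modeEnergy l (p t) (q t) (r t) (s t))
    h.hasDerivAt_energy (fun t _ => by nlinarith [mul_nonneg hγ (sq_nonneg (r t))]) ht

/-- A functional `F ≥ 0` with `F' ≤ -c E` bounds `t E(t)`, because `E` is nonincreasing. -/
theorem IsMode.mul_energy_le (h : IsMode l γ p q r s) (hγ : 0 ≤ γ) {F F' : ℝ → ℝ} {c : ℝ}
    (hc : 0 ≤ c) (hF : ∀ t, HasDerivAt F (F' t) t) (hpos : ∀ t, 0 ≤ F t)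
    (hF' : ∀ t, F' t ≤ -c * modeEnergy l (p t) (q t) (r t) (s t)) {t : ℝ} (ht : 0 ≤ t) :
    c * (t * modeEnergy l (p t) (q t) (r t) (s t)) ≤ F 0 := by
  have h1 := le_apply_zero_of_hasDerivAt_nonpos (fun t => (hF t).add
    (((hasDerivAt_id t).mul (h.hasDerivAt_energy t)).const_mul c)) (fun t ht => ?_) ht
  · simp only [Pi.add_apply, Pi.mul_apply, id, zero_mul, mul_zero, add_zero] at h1
    linarith [hpos t]
  · have h2 : 0 ≤ c * (t * (γ * r t ^ 2)) := by positivity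
    have h3 := hF' t
    simp only [id]
    linarith

/-- Coupling through the zero-order terms transfers the dissipation of `u` and `u'` to the
undamped component, hence `t E(t)` is bounded by the energies of `u` and `u'`. -/
theorem IsMode.viscous_decay (h : IsMode l 1 p q r s) (hl : 0 < l) {t : ℝ} (ht : 0 ≤ t) :
    t * modeEnergy l (p t) (q t) (r t) (s t) ≤ 110 * (modeEnergy l (p 0) (q 0) (r 0) (s 0) +
      modeEnergy l (r 0) (s 0) (-(l + 9 / 5) * p 0 + 2 / 5 * q 0 - 5 * 1 * r 0)
        (-(l + 6 / 5) * q 0 + 2 / 5 * p 0)) := by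
  have h1 := h.deriv
  set R := fun t => -(l + 9 / 5) * p t + 2 / 5 * q t - 5 * 1 * r t with hR
  set S := fun t => -(l + 6 / 5) * q t + 2 / 5 * p t with hS
  -- the derivative of `R s - r S` contains `2/5 s²`, which is not controlled by the damping, and
  -- `(p r + q s + 5/2 p²)' = 2 (r² + s²) - E`; the energies make the functional nonnegative
  have hF : ∀ t, HasDerivAt (fun t => 100 * (modeEnergy l (p t) (q t) (r t) (s t) +
      modeEnergy l (r t) (s t) (R t) (S t)) - 10 * (R t * s t - r t * S t) +
      (p t * r t + q t * s t + 5 / 2 * p t ^ 2)) _ t := fun t =>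
    (((h.hasDerivAt_energy t).add (h1.hasDerivAt_energy t)).const_mul 100).sub
      ((((h1.hr t).mul (h.hs t)).sub ((h.hr t).mul (h1.hs t))).const_mul 10) |>.add
      ((((h.hp t).mul (h.hr t)).add ((h.hq t).mul (h.hs t))).add
        (((h.hp t).pow 2).const_mul (5 / 2)))
  have hb : ∀ t, |10 * (R t * s t - r t * S t)| + |p t * r t + q t * s t| ≤
      6 * (modeEnergy l (p t) (q t) (r t) (s t) + modeEnergy l (r t) (s t) (R t) (S t)) := by
    intro t
    have e0 := modeEnergy_ge l (p t) (q t) (r t) (s t)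
    have e1 := modeEnergy_ge l (r t) (s t) (R t) (S t)
    have a1 : |10 * (R t * s t - r t * S t)| ≤ 5 * (R t ^ 2 + s t ^ 2 + r t ^ 2 + S t ^ 2) := by
      rw [abs_le]
      constructor <;>
      nlinarith [sq_nonneg (R t - s t), sq_nonneg (R t + s t), sq_nonneg (r t - S t),
        sq_nonneg (r t + S t)]
    have a2 : |p t * r t + q t * s t| ≤ p t ^ 2 + q t ^ 2 + r t ^ 2 + s t ^ 2 := by
      rw [abs_le]
      constructor <;>
      nlinarith [sq_nonneg (p t - r t), sq_nonneg (p t + r t), sq_nonneg (q t - s t),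
        sq_nonneg (q t + s t)]
    nlinarith [mul_nonneg hl.le (add_nonneg (sq_nonneg (p t)) (sq_nonneg (q t))),
      mul_nonneg hl.le (add_nonneg (sq_nonneg (r t)) (sq_nonneg (s t))), sq_nonneg (p t),
      sq_nonneg (q t), sq_nonneg (r t), sq_nonneg (s t), sq_nonneg (R t), sq_nonneg (S t)]
  have hE : ∀ t, 5 / 2 * p t ^ 2 ≤ 3 * modeEnergy l (p t) (q t) (r t) (s t) := fun t => by
    nlinarith [modeEnergy_ge l (p t) (q t) (r t) (s t), sq_nonneg (r t), sq_nonneg (s t),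
      mul_nonneg hl.le (add_nonneg (sq_nonneg (p t)) (sq_nonneg (q t))), sq_nonneg (q t),
      sq_nonneg (p t)]
  have hE1 : ∀ t, 0 ≤ modeEnergy l (r t) (s t) (R t) (S t) := fun t =>
    le_trans (by positivity) (modeEnergy_ge l (r t) (s t) (R t) (S t))
  have hE0 : ∀ t, 0 ≤ modeEnergy l (p t) (q t) (r t) (s t) := fun t =>
    le_trans (by positivity) (modeEnergy_ge l (p t) (q t) (r t) (s t))
  have key := h.mul_energy_le zero_le_one zero_le_one hF (fun t => ?_) (fun t => ?_) ht
  · change _ ≤ 110 * (_ + modeEnergy l (r 0) (s 0) (R 0) (S 0))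
    have h2 := abs_le.1 (abs_add_le (-(10 * (R 0 * s 0 - r 0 * S 0))) (p 0 * r 0 + q 0 * s 0))
    rw [abs_neg] at h2
    linarith [hb 0, hE 0, hE1 0, hE0 0, h2.2]
  · have h2 := abs_le.1 (abs_add_le (-(10 * (R t * s t - r t * S t))) (p t * r t + q t * s t))
    rw [abs_neg] at h2
    linarith [hb t, hE t, hE1 t, hE0 t, h2.1, sq_nonneg (p t)]
  · simp only [modeEnergy, hR, hS]
    push_cast
    nlinarith [sq_nonneg (s t - 3 * r t),
      sq_nonneg (s t - 25 * (-(l + 9 / 5) * p t + 2 / 5 * q t - 5 * 1 * r t)), sq_nonneg (r t),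
      sq_nonneg (s t), sq_nonneg (-(l + 9 / 5) * p t + 2 / 5 * q t - 5 * 1 * r t)]

/-- For Kelvin–Voigt damping the derivative of `p'' q' - p' q''` contains the term `-5 l p'' q'`,
whose coefficient is unbounded. The multiplier `p'' q''` cancels it, at the price of the term
`p''' q''`, and `p'''` is controlled only by the dissipation of `u''`. -/
theorem IsMode.kelvinVoigt_decay (h : IsMode l l p q r s) {l₀ : ℝ} (hl₀ : 0 < l₀) (hl : l₀ ≤ l)
    {R S T U : ℝ → ℝ} (hR : R = fun t => -(l + 9 / 5) * p t + 2 / 5 * q t - 5 * l * r t)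
    (hS : S = fun t => -(l + 6 / 5) * q t + 2 / 5 * p t)
    (hT : T = fun t => -(l + 9 / 5) * r t + 2 / 5 * s t - 5 * l * R t)
    (hU : U = fun t => -(l + 6 / 5) * s t + 2 / 5 * r t) {t : ℝ} (ht : 0 ≤ t) :
    t * modeEnergy l (p t) (q t) (r t) (s t) ≤
      1100 * (1 + 1 / l₀) * (modeEnergy l (p 0) (q 0) (r 0) (s 0) +
        modeEnergy l (r 0) (s 0) (R 0) (S 0) + modeEnergy l (R 0) (S 0) (T 0) (U 0)) := by
  have h1 : IsMode l l r s R S := by rw [hR, hS]; exact h.deriv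
  have h2 : IsMode l l R S T U := by rw [hT, hU]; exact h1.deriv
  have hl0 : 0 < l := hl₀.trans_le hl
  set μ := 1 + 1 / l₀ with hμ
  have hμ1 : 1 ≤ μ := by rw [hμ]; linarith [one_div_pos.2 hl₀]
  have hlμ : 1 + l ≤ l * μ := by
    have : 1 ≤ l * (1 / l₀) := by rw [mul_one_div, one_le_div hl₀]; exact hl
    rw [hμ]; linarith
  have hF : ∀ t, HasDerivAt (fun t => 500 * μ * (modeEnergy l (p t) (q t) (r t) (s t) +
      modeEnergy l (r t) (s t) (R t) (S t) + modeEnergy l (R t) (S t) (T t) (U t))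
      - 10 * (R t * s t - r t * S t) + 50 * (R t * S t) +
      (p t * r t + q t * s t + 5 / 2 * l * p t ^ 2))
      (500 * μ * (-10 * l * r t ^ 2 + -10 * l * R t ^ 2 + -10 * l * T t ^ 2)
        - 10 * (T t * s t - r t * U t) + 50 * (T t * S t + R t * U t) +
        (r t ^ 2 + p t * R t + s t ^ 2 + q t * S t + 5 * l * p t * r t)) t := fun t => by
    refine (((((((h.hasDerivAt_energy t).add (h1.hasDerivAt_energy t)).add
      (h2.hasDerivAt_energy t)).const_mul (500 * μ)).sub
      ((((h2.hp t).mul (h.hs t)).sub ((h.hr t).mul (h2.hq t))).const_mul 10)).add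
      (((h2.hp t).mul (h2.hq t)).const_mul 50)).add
      ((((h.hp t).mul (h.hr t)).add ((h.hq t).mul (h.hs t))).add
        (((h.hp t).pow 2).const_mul (5 / 2 * l)))).congr_deriv ?_
    simp only [hR, hS]
    push_cast
    ring
  have hb : ∀ t, |10 * (R t * s t - r t * S t)| + |50 * (R t * S t)| + |p t * r t + q t * s t| ≤
      40 * (modeEnergy l (p t) (q t) (r t) (s t) + modeEnergy l (r t) (s t) (R t) (S t)) := by
    intro t
    have e0 := modeEnergy_ge l (p t) (q t) (r t) (s t)
    have e1 := modeEnergy_ge l (r t) (s t) (R t) (S t)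
    have a1 : |10 * (R t * s t - r t * S t)| ≤ 5 * (R t ^ 2 + s t ^ 2 + r t ^ 2 + S t ^ 2) := by
      rw [abs_le]
      constructor <;>
      nlinarith [sq_nonneg (R t - s t), sq_nonneg (R t + s t), sq_nonneg (r t - S t),
        sq_nonneg (r t + S t)]
    have a2 : |p t * r t + q t * s t| ≤ p t ^ 2 + q t ^ 2 + r t ^ 2 + s t ^ 2 := by
      rw [abs_le]
      constructor <;>
      nlinarith [sq_nonneg (p t - r t), sq_nonneg (p t + r t), sq_nonneg (q t - s t),
        sq_nonneg (q t + s t)]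
    have a3 : |50 * (R t * S t)| ≤ 25 * (R t ^ 2 + S t ^ 2) := by
      rw [abs_le]
      constructor <;> nlinarith [sq_nonneg (R t - S t), sq_nonneg (R t + S t)]
    nlinarith [mul_nonneg hl0.le (add_nonneg (sq_nonneg (p t)) (sq_nonneg (q t))),
      mul_nonneg hl0.le (add_nonneg (sq_nonneg (r t)) (sq_nonneg (s t))), sq_nonneg (p t),
      sq_nonneg (q t), sq_nonneg (r t), sq_nonneg (s t), sq_nonneg (R t), sq_nonneg (S t)]
  have hE : ∀ t, 5 / 2 * l * p t ^ 2 ≤ 3 * modeEnergy l (p t) (q t) (r t) (s t) := fun t => by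
    nlinarith [modeEnergy_ge l (p t) (q t) (r t) (s t), sq_nonneg (r t), sq_nonneg (s t),
      mul_nonneg hl0.le (sq_nonneg (p t)), mul_nonneg hl0.le (sq_nonneg (q t)), sq_nonneg (q t),
      sq_nonneg (p t)]
  have hE0 : ∀ p q r s : ℝ, 0 ≤ modeEnergy l p q r s := fun p q r s =>
    le_trans (by positivity) (modeEnergy_ge l p q r s)
  have hμE : ∀ t, modeEnergy l (p t) (q t) (r t) (s t) + modeEnergy l (r t) (s t) (R t) (S t) +
      modeEnergy l (R t) (S t) (T t) (U t) ≤ μ * (modeEnergy l (p t) (q t) (r t) (s t) +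
      modeEnergy l (r t) (s t) (R t) (S t) + modeEnergy l (R t) (S t) (T t) (U t)) := fun t =>
    le_mul_of_one_le_left (add_nonneg (add_nonneg (hE0 _ _ _ _) (hE0 _ _ _ _)) (hE0 _ _ _ _)) hμ1
  have habs : ∀ t, |-(10 * (R t * s t - r t * S t)) + 50 * (R t * S t) +
      (p t * r t + q t * s t)| ≤ |10 * (R t * s t - r t * S t)| + |50 * (R t * S t)| +
      |p t * r t + q t * s t| := fun t => by
    refine (abs_add_le _ _).trans (add_le_add_left ((abs_add_le _ _).trans ?_) _)
    rw [abs_neg]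
  have key := h.mul_energy_le (c := 1 / 2) hl0.le (by norm_num) hF (fun t => ?_) (fun t => ?_) ht
  · linarith [hb 0, hE 0, hμE 0, hE0 (p 0) (q 0) (r 0) (s 0), hE0 (r 0) (s 0) (R 0) (S 0),
      hE0 (R 0) (S 0) (T 0) (U 0), (abs_le.1 (habs 0)).2]
  · linarith [hb t, hE t, hμE t, hE0 (p t) (q t) (r t) (s t), hE0 (r t) (s t) (R t) (S t),
      hE0 (R t) (S t) (T t) (U t), (abs_le.1 (habs t)).1,
      mul_nonneg hl0.le (sq_nonneg (p t))]
  · -- the cross terms, after inserting the equations for `T` and `U`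
    have c1 : -10 * (T t * s t - r t * U t) + 50 * (T t * S t + R t * U t) +
        (r t ^ 2 + p t * R t + s t ^ 2 + q t * S t + 5 * l * p t * r t) =
        2 * (r t ^ 2 + s t ^ 2) - modeEnergy l (p t) (q t) (r t) (s t) - 4 * s t ^ 2 + 4 * r t ^ 2
          + 6 * (r t * s t) - 60 * (R t * s t) + 20 * (R t * r t) + 50 * (T t * S t) := by
      have e1 : p t * R t + q t * S t + 5 * l * p t * r t + r t ^ 2 + s t ^ 2 =
          2 * (r t ^ 2 + s t ^ 2) - modeEnergy l (p t) (q t) (r t) (s t) := by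
        simp only [hR, hS, modeEnergy]; ring
      have e2 : -10 * (T t * s t - r t * U t) + 50 * (R t * U t) = - 4 * s t ^ 2 + 4 * r t ^ 2
          + 6 * (r t * s t) - 60 * (R t * s t) + 20 * (R t * r t) := by
        simp only [hT, hU]; ring
      linarith
    -- `S ^ 2 / l` is controlled by the potential energy
    have c2 : S t ^ 2 ≤ 4 * (l * μ) *
        (modeEnergy l (p t) (q t) (r t) (s t) - (r t ^ 2 + s t ^ 2)) := by
      have e0 := modeEnergy_ge l (p t) (q t) (r t) (s t)
      have e3 : S t ^ 2 ≤ (l + 2) ^ 2 * (p t ^ 2 + q t ^ 2) := by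
        simp only [hS]
        nlinarith [sq_nonneg ((l + 6 / 5) * p t + 2 / 5 * q t), mul_nonneg hl0.le
          (sq_nonneg (p t)), mul_nonneg hl0.le (sq_nonneg (q t)), sq_nonneg (p t),
          sq_nonneg (q t)]
      have e4 : (l + 2) ^ 2 * (p t ^ 2 + q t ^ 2) ≤
          4 * (l * μ) * ((l + 1) * (p t ^ 2 + q t ^ 2)) := by
        rw [← mul_assoc]
        gcongr
        nlinarith
      have e5 : 4 * (l * μ) * ((l + 1) * (p t ^ 2 + q t ^ 2)) ≤ 4 * (l * μ) *
          (modeEnergy l (p t) (q t) (r t) (s t) - (r t ^ 2 + s t ^ 2)) := by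
        gcongr
        linarith
      linarith
    have c3 : 50 * (T t * S t) ≤ 5000 * (l * μ) * T t ^ 2 +
        1 / 2 * (modeEnergy l (p t) (q t) (r t) (s t) - (r t ^ 2 + s t ^ 2)) := by
      have hk : 0 < l * μ := by positivity
      have e6 : 0 ≤ (200 * (l * μ) * T t - S t) ^ 2 := sq_nonneg _
      have e7 : 8 * (l * μ) * (50 * (T t * S t)) ≤ 8 * (l * μ) * (5000 * (l * μ) * T t ^ 2 +
        1 / 2 * (modeEnergy l (p t) (q t) (r t) (s t) - (r t ^ 2 + s t ^ 2))) := by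
        linarith
      exact le_of_mul_le_mul_left e7 (by positivity)
    have c4 : ∀ x : ℝ, 5000 * x ^ 2 ≤ 5000 * (l * μ) * x ^ 2 := fun x => by
      have : (1 : ℝ) ≤ l * μ := by linarith
      nlinarith [sq_nonneg x]
    nlinarith [c4 (r t), c4 (R t), sq_nonneg (s t - 3 * r t), sq_nonneg (s t + 30 * R t),
      sq_nonneg (10 * R t - r t), sq_nonneg (r t), sq_nonneg (R t), sq_nonneg (s t)]

end Lyapunov

/-! ### Uniform decay of the modes -/

section ModeDecay

theorem modeOp_matA_matD_snd (ν γ : ℝ) (z : EnergySpace 2 ℂ ℂ) :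
    (modeOp matA matD ν γ z).snd 0 =
        -((ν : ℂ) * z.fst 0 + z.fst 0 / ν + γ * (z.snd 0 + 2 * z.snd 1)) ∧
      (modeOp matA matD ν γ z).snd 1 =
        -((ν : ℂ) * z.fst 1 + 2 * z.fst 1 / ν + γ * (2 * z.snd 0 + 4 * z.snd 1)) := by
  simp [modeOp_snd, Fin.sum_univ_two, matA, matD]

theorem norm_sq_eq_two (z : EnergySpace 2 ℂ ℂ) :
    ‖z‖ ^ 2 = ‖z.fst 0‖ ^ 2 + ‖z.fst 1‖ ^ 2 + (‖z.snd 0‖ ^ 2 + ‖z.snd 1‖ ^ 2) := by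
  rw [WithLp.prod_norm_sq_eq_of_L2, PiLp.norm_sq_eq_of_L2, PiLp.norm_sq_eq_of_L2,
    Fin.sum_univ_two, Fin.sum_univ_two]

/-- The energy of the real-valued mode that is obtained from the complex mode `z` by applying
`f = Re` or `f = Im`. -/
def partEnergy (f : ℂ → ℝ) (ν : ℝ) (z : EnergySpace 2 ℂ ℂ) : ℝ :=
  modeEnergy (ν ^ 2) (f (z.fst 0 + 2 * z.fst 1) / ν) (f (2 * z.fst 0 - z.fst 1) / ν)
    (f (z.snd 0 + 2 * z.snd 1)) (f (2 * z.snd 0 - z.snd 1))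

/-- The factor `5` is the squared norm of the vectors `(1, 2)` and `(2, -1)` that define `p` and
`q`. -/
theorem norm_sq_le_partEnergy {ν : ℝ} (hν : 0 < ν) (z : EnergySpace 2 ℂ ℂ) :
    5 * ‖z‖ ^ 2 ≤ partEnergy Complex.re ν z + partEnergy Complex.im ν z := by
  have h1 := modeEnergy_ge (ν ^ 2) ((z.fst 0 + 2 * z.fst 1).re / ν)
    ((2 * z.fst 0 - z.fst 1).re / ν) (z.snd 0 + 2 * z.snd 1).re (2 * z.snd 0 - z.snd 1).re
  have h2 := modeEnergy_ge (ν ^ 2) ((z.fst 0 + 2 * z.fst 1).im / ν)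
    ((2 * z.fst 0 - z.fst 1).im / ν) (z.snd 0 + 2 * z.snd 1).im (2 * z.snd 0 - z.snd 1).im
  have h3 : ∀ x y : ℝ, ν ^ 2 * ((x / ν) ^ 2 + (y / ν) ^ 2) = x ^ 2 + y ^ 2 := fun x y => by
    field_simp
  rw [add_mul, h3] at h1 h2
  rw [norm_sq_eq_two]
  simp only [Complex.sq_norm, Complex.normSq_apply]
  unfold partEnergy
  have h4 : ∀ x y : ℝ, 0 ≤ 1 * ((x / ν) ^ 2 + (y / ν) ^ 2) := fun x y => by positivity
  refine le_trans ?_ (add_le_add h1 h2)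
  have h5 := h4 (z.fst 0 + 2 * z.fst 1).re (2 * z.fst 0 - z.fst 1).re
  have h6 := h4 (z.fst 0 + 2 * z.fst 1).im (2 * z.fst 0 - z.fst 1).im
  refine le_trans (le_of_eq ?_) (add_le_add (add_le_add_right (le_add_of_nonneg_right h5) _)
    (add_le_add_right (le_add_of_nonneg_right h6) _))
  simp
  ring

theorem partEnergy_le {ν c : ℝ} (hc : 0 < c) (hν : c ≤ ν) (z : EnergySpace 2 ℂ ℂ) :
    partEnergy Complex.re ν z + partEnergy Complex.im ν z ≤ 5 * (1 + 2 / c ^ 2) * ‖z‖ ^ 2 := by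
  have hν0 : 0 < ν := hc.trans_le hν
  have h1 := modeEnergy_le (ν ^ 2) ((z.fst 0 + 2 * z.fst 1).re / ν)
    ((2 * z.fst 0 - z.fst 1).re / ν) (z.snd 0 + 2 * z.snd 1).re (2 * z.snd 0 - z.snd 1).re
  have h2 := modeEnergy_le (ν ^ 2) ((z.fst 0 + 2 * z.fst 1).im / ν)
    ((2 * z.fst 0 - z.fst 1).im / ν) (z.snd 0 + 2 * z.snd 1).im (2 * z.snd 0 - z.snd 1).im
  have h3 : ∀ x y : ℝ, (ν ^ 2 + 2) * ((x / ν) ^ 2 + (y / ν) ^ 2) ≤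
      (1 + 2 / c ^ 2) * (x ^ 2 + y ^ 2) := fun x y => by
    have : (ν ^ 2 + 2) * ((x / ν) ^ 2 + (y / ν) ^ 2) = (1 + 2 / ν ^ 2) * (x ^ 2 + y ^ 2) := by
      field_simp
    rw [this]
    gcongr
  have h4 : 0 ≤ 2 / c ^ 2 * ‖z‖ ^ 2 := by positivity
  have h5 := add_le_add h1 h2
  refine h5.trans ((add_le_add (add_le_add_right (h3 _ _) _) (add_le_add_right (h3 _ _) _)).trans
    ?_)
  rw [norm_sq_eq_two]
  simp only [Complex.sq_norm, Complex.normSq_apply]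
  have h6 : 0 ≤ 2 / c ^ 2 := by positivity
  simp
  nlinarith [mul_nonneg h6 (add_nonneg (add_nonneg (sq_nonneg (z.snd 0).re)
    (sq_nonneg (z.snd 0).im)) (add_nonneg (sq_nonneg (z.snd 1).re) (sq_nonneg (z.snd 1).im)))]

theorem hasDerivAt_flow_fst (M : EnergySpace 2 ℂ ℂ →L[ℂ] EnergySpace 2 ℂ ℂ)
    (z : EnergySpace 2 ℂ ℂ) (i : Fin 2) (t : ℝ) :
    HasDerivAt (fun s => (flow M s z).fst i) ((M (flow M t z)).fst i) t := by
  let L : EnergySpace 2 ℂ ℂ →L[ℂ] ℂ := (PiLp.proj 2 (fun _ : Fin 2 => ℂ) i).comp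
    (WithLp.fstL 2 ℂ _ _)
  exact (L.restrictScalars ℝ).hasFDerivAt.comp_hasDerivAt t (hasDerivAt_flow M z t)

theorem hasDerivAt_flow_snd (M : EnergySpace 2 ℂ ℂ →L[ℂ] EnergySpace 2 ℂ ℂ)
    (z : EnergySpace 2 ℂ ℂ) (i : Fin 2) (t : ℝ) :
    HasDerivAt (fun s => (flow M s z).snd i) ((M (flow M t z)).snd i) t := by
  let L : EnergySpace 2 ℂ ℂ →L[ℂ] ℂ := (PiLp.proj 2 (fun _ : Fin 2 => ℂ) i).comp
    (WithLp.sndL 2 ℂ _ _)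
  exact (L.restrictScalars ℝ).hasFDerivAt.comp_hasDerivAt t (hasDerivAt_flow M z t)

/-- The coordinates of `modeEnergy` turn `modeOp` into the system of `IsMode`; `f` is the real or
the imaginary part. -/
theorem modeOp_coord {ν : ℝ} (hν : ν ≠ 0) (γ : ℝ) (z : EnergySpace 2 ℂ ℂ) (f : ℂ →L[ℝ] ℝ) :
    f ((modeOp matA matD ν γ z).fst 0 + 2 * (modeOp matA matD ν γ z).fst 1) / ν =
        f (z.snd 0 + 2 * z.snd 1) ∧
      f (2 * (modeOp matA matD ν γ z).fst 0 - (modeOp matA matD ν γ z).fst 1) / ν =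
        f (2 * z.snd 0 - z.snd 1) ∧
      f ((modeOp matA matD ν γ z).snd 0 + 2 * (modeOp matA matD ν γ z).snd 1) =
        -(ν ^ 2 + 9 / 5) * (f (z.fst 0 + 2 * z.fst 1) / ν) +
          2 / 5 * (f (2 * z.fst 0 - z.fst 1) / ν) - 5 * γ * f (z.snd 0 + 2 * z.snd 1) ∧
      f (2 * (modeOp matA matD ν γ z).snd 0 - (modeOp matA matD ν γ z).snd 1) =
        -(ν ^ 2 + 6 / 5) * (f (2 * z.fst 0 - z.fst 1) / ν) +
          2 / 5 * (f (z.fst 0 + 2 * z.fst 1) / ν) := by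
  have hνC : (ν : ℂ) ≠ 0 := by exact_mod_cast hν
  have hf : ∀ (x : ℝ) (w : ℂ), x * f w = f (x * w) := fun x w => by
    rw [← smul_eq_mul, ← map_smul, Complex.real_smul]
  have hd : ∀ w : ℂ, f w / ν = f ((ν : ℂ)⁻¹ * w) := fun w => by
    rw [div_eq_inv_mul, hf]; push_cast; rfl
  obtain ⟨h0, h1⟩ := modeOp_matA_matD_snd ν γ z
  simp only [modeOp_fst, h0, h1, hd, hf, ← map_add, ← map_sub]
  refine ⟨congrArg f ?_, congrArg f ?_, congrArg f ?_, congrArg f ?_⟩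
  · field_simp
  · field_simp
  · push_cast
    field_simp
    ring
  · push_cast
    field_simp
    ring

theorem isMode_flow {ν : ℝ} (hν : ν ≠ 0) (γ : ℝ) (z : EnergySpace 2 ℂ ℂ) (f : ℂ →L[ℝ] ℝ) :
    IsMode (ν ^ 2) γ
      (fun t => f ((flow (modeOp matA matD ν γ) t z).fst 0 +
        2 * (flow (modeOp matA matD ν γ) t z).fst 1) / ν)
      (fun t => f (2 * (flow (modeOp matA matD ν γ) t z).fst 0 -
        (flow (modeOp matA matD ν γ) t z).fst 1) / ν)
      (fun t => f ((flow (modeOp matA matD ν γ) t z).snd 0 +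
        2 * (flow (modeOp matA matD ν γ) t z).snd 1))
      (fun t => f (2 * (flow (modeOp matA matD ν γ) t z).snd 0 -
        (flow (modeOp matA matD ν γ) t z).snd 1)) := by
  have hco := fun t => modeOp_coord hν γ (flow (modeOp matA matD ν γ) t z) f
  have d1 := hasDerivAt_flow_fst (modeOp matA matD ν γ) z
  have d2 := hasDerivAt_flow_snd (modeOp matA matD ν γ) z
  refine ⟨fun t => ?_, fun t => ?_, fun t => ?_, fun t => ?_⟩
  · rw [← (hco t).1]
    exact (f.hasFDerivAt.comp_hasDerivAt t ((d1 0 t).add ((d1 1 t).const_mul 2))).div_const ν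
  · rw [← (hco t).2.1]
    exact (f.hasFDerivAt.comp_hasDerivAt t (((d1 0 t).const_mul 2).sub (d1 1 t))).div_const ν
  · rw [← (hco t).2.2.1]
    exact f.hasFDerivAt.comp_hasDerivAt t ((d2 0 t).add ((d2 1 t).const_mul 2))
  · rw [← (hco t).2.2.2]
    exact f.hasFDerivAt.comp_hasDerivAt t (((d2 0 t).const_mul 2).sub (d2 1 t))

theorem partEnergy_modeOp {ν : ℝ} (hν : ν ≠ 0) (γ : ℝ) (z : EnergySpace 2 ℂ ℂ) (f : ℂ →L[ℝ] ℝ) :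
    partEnergy f ν (modeOp matA matD ν γ z) =
      modeEnergy (ν ^ 2) (f (z.snd 0 + 2 * z.snd 1)) (f (2 * z.snd 0 - z.snd 1))
        (-(ν ^ 2 + 9 / 5) * (f (z.fst 0 + 2 * z.fst 1) / ν) +
          2 / 5 * (f (2 * z.fst 0 - z.fst 1) / ν) - 5 * γ * f (z.snd 0 + 2 * z.snd 1))
        (-(ν ^ 2 + 6 / 5) * (f (2 * z.fst 0 - z.fst 1) / ν) +
          2 / 5 * (f (z.fst 0 + 2 * z.fst 1) / ν)) := by
  obtain ⟨h1, h2, h3, h4⟩ := modeOp_coord hν γ z f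
  rw [partEnergy, h1, h2, h3, h4]

theorem partEnergy_flow_le {ν γ : ℝ} (hν : ν ≠ 0) (hγ : 0 ≤ γ) (z : EnergySpace 2 ℂ ℂ)
    (f : ℂ →L[ℝ] ℝ) {t : ℝ} (ht : 0 ≤ t) :
    partEnergy f ν (flow (modeOp matA matD ν γ) t z) ≤ partEnergy f ν z := by
  have h := (isMode_flow hν γ z f).energy_le hγ ht
  simpa only [flow_zero, one_apply_eq_self] using! h

theorem partEnergy_viscous_decay {ν : ℝ} (hν : 0 < ν) (z : EnergySpace 2 ℂ ℂ)
    (f : ℂ →L[ℝ] ℝ) {t : ℝ} (ht : 0 ≤ t) :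
    t * partEnergy f ν (flow (modeOp matA matD ν 1) t z) ≤
      110 * (partEnergy f ν z + partEnergy f ν (modeOp matA matD ν 1 z)) := by
  have h := (isMode_flow hν.ne' 1 z f).viscous_decay (by positivity) ht
  rw [partEnergy_modeOp hν.ne']
  simpa only [flow_zero, one_apply_eq_self] using! h

theorem partEnergy_kelvinVoigt_decay {ν c : ℝ} (hc : 0 < c) (hν : c ≤ ν) (z : EnergySpace 2 ℂ ℂ)
    (f : ℂ →L[ℝ] ℝ) {t : ℝ} (ht : 0 ≤ t) :
    t * partEnergy f ν (flow (modeOp matA matD ν (ν ^ 2)) t z) ≤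
      1100 * (1 + 1 / c ^ 2) * (partEnergy f ν z + partEnergy f ν (modeOp matA matD ν (ν ^ 2) z) +
        partEnergy f ν (modeOp matA matD ν (ν ^ 2) (modeOp matA matD ν (ν ^ 2) z))) := by
  have hν0 : 0 < ν := hc.trans_le hν
  have h := (isMode_flow hν0.ne' (ν ^ 2) z f).kelvinVoigt_decay (l₀ := c ^ 2) (by positivity)
    (by gcongr) rfl rfl rfl rfl ht
  obtain ⟨-, -, h3, h4⟩ := modeOp_coord hν0.ne' (ν ^ 2) z f
  rw [partEnergy_modeOp hν0.ne', partEnergy_modeOp hν0.ne', h3, h4]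
  obtain ⟨h1, h2, -, -⟩ := modeOp_coord hν0.ne' (ν ^ 2) z f
  rw [h1, h2]
  simpa only [flow_zero, one_apply_eq_self] using! h

end ModeDecay

section ModeDecay

theorem norm_flow_modeOp_le {ν c γ : ℝ} (hc : 0 < c) (hν : c ≤ ν) (hγ : 0 ≤ γ) {t : ℝ}
    (ht : 0 ≤ t) (z : EnergySpace 2 ℂ ℂ) :
    ‖flow (modeOp matA matD ν γ) t z‖ ≤ √(1 + 2 / c ^ 2) * ‖z‖ := by
  have hν0 : 0 < ν := hc.trans_le hν
  apply le_of_sq_le_sq _ (by positivity)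
  rw [mul_pow, Real.sq_sqrt (by positivity)]
  have h1 := norm_sq_le_partEnergy hν0 (flow (modeOp matA matD ν γ) t z)
  have h2 := partEnergy_le hc hν z
  have h3 := partEnergy_flow_le hν0.ne' hγ z Complex.reCLM ht
  have h4 := partEnergy_flow_le hν0.ne' hγ z Complex.imCLM ht
  change partEnergy Complex.re ν _ ≤ partEnergy Complex.re ν _ at h3
  change partEnergy Complex.im ν _ ≤ partEnergy Complex.im ν _ at h4
  linarith

theorem norm_flow_viscous_le {ν c : ℝ} (hc : 0 < c) (hν : c ≤ ν) {t : ℝ}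
    (ht : 0 < t) (z : EnergySpace 2 ℂ ℂ) :
    ‖flow (modeOp matA matD ν 1) t z‖ ≤
      √(110 * (1 + 2 / c ^ 2)) * t ^ (-(1 / 2) : ℝ) * (‖z‖ + ‖modeOp matA matD ν 1 z‖) := by
  have hν0 : 0 < ν := hc.trans_le hν
  apply le_of_sq_le_sq _ (by positivity)
  have ht2 : (t ^ (-(1 / 2) : ℝ)) ^ 2 = t⁻¹ := by
    rw [← Real.rpow_natCast, ← Real.rpow_mul ht.le, ← Real.rpow_neg_one]
    norm_num
  rw [mul_pow, mul_pow, Real.sq_sqrt (by positivity), ht2, mul_assoc, mul_assoc,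
    mul_left_comm _ t⁻¹, mul_left_comm _ t⁻¹, le_inv_mul_iff₀ ht]
  have h1 := norm_sq_le_partEnergy hν0 (flow (modeOp matA matD ν 1) t z)
  have h2 := partEnergy_le hc hν z
  have h3 := partEnergy_le hc hν (modeOp matA matD ν 1 z)
  have h4 := partEnergy_viscous_decay hν0 z Complex.reCLM ht.le
  have h5 := partEnergy_viscous_decay hν0 z Complex.imCLM ht.le
  change t * partEnergy Complex.re ν _ ≤
    110 * (partEnergy Complex.re ν _ + partEnergy Complex.re ν _) at h4
  change t * partEnergy Complex.im ν _ ≤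
    110 * (partEnergy Complex.im ν _ + partEnergy Complex.im ν _) at h5
  have h6 : ‖z‖ ^ 2 + ‖modeOp matA matD ν 1 z‖ ^ 2 ≤ (‖z‖ + ‖modeOp matA matD ν 1 z‖) ^ 2 := by
    nlinarith [norm_nonneg z, norm_nonneg (modeOp matA matD ν 1 z)]
  have h7 := mul_le_mul_of_nonneg_left h6 (show 0 ≤ 5 * (1 + 2 / c ^ 2) by positivity)
  have h8 := mul_le_mul_of_nonneg_left h1 ht.le
  nlinarith

/-- The rate `t ^ (-1/2)` with a loss of two time derivatives. -/
theorem norm_flow_kelvinVoigt_le {ν c : ℝ} (hc : 0 < c) (hν : c ≤ ν) {t : ℝ}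
    (ht : 0 < t) (z : EnergySpace 2 ℂ ℂ) :
    ‖flow (modeOp matA matD ν (ν ^ 2)) t z‖ ≤
      √(1100 * (1 + 1 / c ^ 2) * (1 + 2 / c ^ 2)) * t ^ (-(1 / 2) : ℝ) *
        (‖z‖ + ‖modeOp matA matD ν (ν ^ 2) z‖ +
          ‖modeOp matA matD ν (ν ^ 2) (modeOp matA matD ν (ν ^ 2) z)‖) := by
  have hν0 : 0 < ν := hc.trans_le hν
  apply le_of_sq_le_sq _ (by positivity)
  have ht2 : (t ^ (-(1 / 2) : ℝ)) ^ 2 = t⁻¹ := by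
    rw [← Real.rpow_natCast, ← Real.rpow_mul ht.le, ← Real.rpow_neg_one]
    norm_num
  rw [mul_pow, mul_pow, Real.sq_sqrt (by positivity), ht2, mul_assoc _ t⁻¹,
    mul_left_comm _ t⁻¹, le_inv_mul_iff₀ ht]
  set M := modeOp matA matD ν (ν ^ 2)
  have h1 := norm_sq_le_partEnergy hν0 (flow M t z)
  have h2 := partEnergy_le hc hν z
  have h3 := partEnergy_le hc hν (M z)
  have h3' := partEnergy_le hc hν (M (M z))
  have h4 := partEnergy_kelvinVoigt_decay hc hν z Complex.reCLM ht.le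
  have h5 := partEnergy_kelvinVoigt_decay hc hν z Complex.imCLM ht.le
  change t * partEnergy Complex.re ν _ ≤ _ * (partEnergy Complex.re ν _ +
    partEnergy Complex.re ν _ + partEnergy Complex.re ν _) at h4
  change t * partEnergy Complex.im ν _ ≤ _ * (partEnergy Complex.im ν _ +
    partEnergy Complex.im ν _ + partEnergy Complex.im ν _) at h5
  have h6 : ‖z‖ ^ 2 + ‖M z‖ ^ 2 + ‖M (M z)‖ ^ 2 ≤ (‖z‖ + ‖M z‖ + ‖M (M z)‖) ^ 2 := by
    nlinarith [norm_nonneg z, norm_nonneg (M z), norm_nonneg (M (M z)),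
      mul_nonneg (norm_nonneg z) (norm_nonneg (M z)),
      mul_nonneg (norm_nonneg z) (norm_nonneg (M (M z))),
      mul_nonneg (norm_nonneg (M z)) (norm_nonneg (M (M z)))]
  have hk : 0 ≤ 1100 * (1 + 1 / c ^ 2) := by positivity
  have hk2 : 0 ≤ 1 + 2 / c ^ 2 := by positivity
  have h8 := mul_le_mul_of_nonneg_left h1 ht.le
  have h9 : t * (partEnergy Complex.re ν (flow M t z) + partEnergy Complex.im ν (flow M t z)) ≤
      1100 * (1 + 1 / c ^ 2) * (5 * (1 + 2 / c ^ 2) * (‖z‖ ^ 2 + ‖M z‖ ^ 2 + ‖M (M z)‖ ^ 2)) := by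
    have := mul_le_mul_of_nonneg_left (add_le_add (add_le_add h2 h3) h3') hk
    linarith
  have h10 : 1100 * (1 + 1 / c ^ 2) *
      (5 * (1 + 2 / c ^ 2) * (‖z‖ ^ 2 + ‖M z‖ ^ 2 + ‖M (M z)‖ ^ 2)) ≤
      1100 * (1 + 1 / c ^ 2) * (5 * (1 + 2 / c ^ 2) * (‖z‖ + ‖M z‖ + ‖M (M z)‖) ^ 2) := by
    gcongr
  linarith

/-- The mode operator with Kelvin–Voigt damping is invertible, uniformly in the frequency. -/
theorem exists_modeOp_eq {ν c : ℝ} (hc : 0 < c) (hν : c ≤ ν) (z : EnergySpace 2 ℂ ℂ) :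
    ∃ y, modeOp matA matD ν (ν ^ 2) y = z ∧ ‖y‖ ≤ (4 / c + 12) * ‖z‖ := by
  have hν0 : 0 < ν := hc.trans_le hν
  have hνC : (ν : ℂ) ≠ 0 := by exact_mod_cast hν0.ne'
  have hν1 : (ν : ℂ) ^ 2 + 1 ≠ 0 := by
    have : ν ^ 2 + 1 ≠ 0 := by positivity
    exact_mod_cast this
  have hν2 : (ν : ℂ) ^ 2 + 2 ≠ 0 := by
    have : ν ^ 2 + 2 ≠ 0 := by positivity
    exact_mod_cast this
  let g₀ : ℂ := z.snd 0 + ν * (z.fst 0 + 2 * z.fst 1)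
  let g₁ : ℂ := z.snd 1 + ν * (2 * z.fst 0 + 4 * z.fst 1)
  let y : EnergySpace 2 ℂ ℂ := state ![-(ν * g₀) / ((ν : ℂ) ^ 2 + 1), -(ν * g₁) / ((ν : ℂ) ^ 2 + 2)]
    ![z.fst 0 / ν, z.fst 1 / ν]
  have y00 : y.fst 0 = -(ν * g₀) / ((ν : ℂ) ^ 2 + 1) := rfl
  have y01 : y.fst 1 = -(ν * g₁) / ((ν : ℂ) ^ 2 + 2) := rfl
  have y10 : y.snd 0 = z.fst 0 / ν := rfl
  have y11 : y.snd 1 = z.fst 1 / ν := rfl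
  obtain ⟨h0, h1⟩ := modeOp_matA_matD_snd ν (ν ^ 2) y
  refine ⟨y, EnergySpace.ext (fun i => ?_) fun i => ?_, ?_⟩
  · rw [modeOp_fst]
    fin_cases i
    · change (ν : ℂ) * y.snd 0 = z.fst 0
      rw [y10]; field_simp
    · change (ν : ℂ) * y.snd 1 = z.fst 1
      rw [y11]; field_simp
  · fin_cases i
    · refine h0.trans ?_
      change _ = z.snd 0
      rw [y00, y10, y11]; simp only [g₀]; push_cast; field_simp; ring
    · refine h1.trans ?_
      change _ = z.snd 1
      rw [y01, y10, y11]; simp only [g₁]; push_cast; field_simp; ring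
  · have hn : ‖(ν : ℂ)‖ = ν := by simp [abs_of_pos hν0]
    have b0 := norm_fst_apply_le z 0
    have b1 := norm_fst_apply_le z 1
    have b2 := norm_snd_apply_le z 0
    have b3 := norm_snd_apply_le z 1
    have hg₀ : ‖g₀‖ ≤ (1 + 6 * ν) * ‖z‖ := by
      calc ‖g₀‖ ≤ ‖z.snd 0‖ + ν * (‖z.fst 0‖ + 2 * ‖z.fst 1‖) := by
            refine (norm_add_le _ _).trans ?_
            rw [norm_mul, hn]
            gcongr
            refine (norm_add_le _ _).trans ?_
            rw [norm_mul]; simp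
        _ ≤ ‖z‖ + ν * (‖z‖ + 2 * ‖z‖) := by gcongr
        _ ≤ (1 + 6 * ν) * ‖z‖ := by nlinarith [mul_nonneg hν0.le (norm_nonneg z)]
    have hg₁ : ‖g₁‖ ≤ (1 + 6 * ν) * ‖z‖ := by
      calc ‖g₁‖ ≤ ‖z.snd 1‖ + ν * (2 * ‖z.fst 0‖ + 4 * ‖z.fst 1‖) := by
            refine (norm_add_le _ _).trans ?_
            rw [norm_mul, hn]
            gcongr
            refine (norm_add_le _ _).trans ?_
            rw [norm_mul, norm_mul]; simp
        _ ≤ ‖z‖ + ν * (2 * ‖z‖ + 4 * ‖z‖) := by gcongr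
        _ = (1 + 6 * ν) * ‖z‖ := by ring
    have hdiv : ∀ (g : ℂ) (a : ℝ), 0 < a → ‖g‖ ≤ (1 + 6 * ν) * ‖z‖ →
        ‖-(ν * g) / ((ν : ℂ) ^ 2 + (a : ℂ))‖ ≤ (1 / c + 6) * ‖z‖ := fun g a ha hg => by
      have e : ‖(ν : ℂ) ^ 2 + (a : ℂ)‖ = ν ^ 2 + a := by
        rw [← Complex.ofReal_pow, ← Complex.ofReal_add, Complex.norm_real,
          Real.norm_of_nonneg (by positivity)]
      rw [norm_div, norm_neg, norm_mul, hn, e, div_le_iff₀ (by positivity)]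
      have e2 : ν * (1 + 6 * ν) ≤ (1 / c + 6) * (ν ^ 2 + a) := by
        have : ν ≤ 1 / c * ν ^ 2 := by
          rw [one_div, le_inv_mul_iff₀ hc]; nlinarith
        have : 0 < 1 / c * a := by positivity
        nlinarith
      calc ν * ‖g‖ ≤ ν * ((1 + 6 * ν) * ‖z‖) := by gcongr
        _ = ν * (1 + 6 * ν) * ‖z‖ := by ring
        _ ≤ (1 / c + 6) * (ν ^ 2 + a) * ‖z‖ := by gcongr
        _ = _ := by ring
    have hdiv' : ∀ w : ℂ, ‖w‖ ≤ ‖z‖ → ‖w / ν‖ ≤ 1 / c * ‖z‖ := fun w hw => by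
      rw [norm_div, hn, div_eq_mul_one_div, mul_comm]
      gcongr
    have hy := norm_le_sum_norm y
    rw [Fin.sum_univ_two, Fin.sum_univ_two, y00, y01, y10, y11] at hy
    have k0 := hdiv g₀ 1 one_pos hg₀
    have k1 := hdiv g₁ 2 two_pos hg₁
    have k2 := hdiv' _ b0
    have k3 := hdiv' _ b1
    rw [Complex.ofReal_one] at k0
    rw [Complex.ofReal_ofNat] at k1
    refine hy.trans ((add_le_add (add_le_add k0 k1) (add_le_add k2 k3)).trans (le_of_eq ?_))
    ring

/-- Interpolation: an orbit `w` with `‖w‖ = O(t ^ (-1/2))` and bounded second derivative has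
`‖w'‖ = O(t ^ (-1/4))`, by Taylor's formula with step `t ^ (-1/4)`. -/
theorem norm_flow_interpolation {E : Type*} [NormedAddCommGroup E] [NormedSpace ℂ E]
    [CompleteSpace E] {M : E →L[ℂ] E} {C : ℝ}
    (hC : ∀ t, 0 ≤ t → ∀ z, ‖flow M t z‖ ≤ C * ‖z‖) {y : E} {b : ℝ}
    (hb : ∀ t, 0 < t → ‖flow M t y‖ ≤ b * t ^ (-(1 / 2) : ℝ)) {t : ℝ} (ht : 0 < t) :
    ‖flow M t (M y)‖ ≤ (2 * b + C * ‖M (M y)‖) * t ^ (-(1 / 4) : ℝ) := by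
  have hb0 : 0 ≤ b := by simpa using (norm_nonneg _).trans (hb 1 one_pos)
  set h : ℝ := t ^ (-(1 / 4) : ℝ) with hh
  have hh0 : 0 < h := Real.rpow_pos_of_pos ht _
  have hhh : t ^ (-(1 / 2) : ℝ) = h * h := by
    rw [hh, ← Real.rpow_add ht]; norm_num
  have h1 : ‖(flow M (t + h) y - (t + h) • flow M t (M y)) - (flow M t y - t • flow M t (M y))‖ ≤
      C * ‖M (M y)‖ * h * ‖t + h - t‖ := by
    refine (convex_Icc t (t + h)).norm_image_sub_le_of_norm_hasDerivWithin_le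
      (f := fun s => flow M s y - s • flow M t (M y))
      (f' := fun s => M (flow M s y) - (1 : ℝ) • flow M t (M y))
      (fun s _ => ((hasDerivAt_flow M y s).sub
        ((hasDerivAt_id s).smul_const _)).hasDerivWithinAt) (fun s hs => ?_)
      (Set.left_mem_Icc.2 (by linarith)) (Set.right_mem_Icc.2 (by linarith))
    rw [one_smul, ← flow_apply_comm]
    refine (norm_flow_sub_le hC (M y) (ht.le.trans hs.1) ht.le).trans ?_
    have : 0 ≤ C * ‖M (M y)‖ := (norm_nonneg _).trans (hC 0 le_rfl _)
    gcongr
    rw [Real.norm_of_nonneg (by linarith [hs.1])]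
    linarith [hs.2]
  have h2 : (t + h) ^ (-(1 / 2) : ℝ) ≤ h * h := by
    rw [← hhh]
    exact Real.rpow_le_rpow_of_nonpos ht (by linarith) (by norm_num)
  have h3 := hb (t + h) (by positivity)
  have h4 := hb t ht
  rw [hhh] at h4
  have h5 : h • flow M t (M y) = (flow M (t + h) y - flow M t y) -
      ((flow M (t + h) y - (t + h) • flow M t (M y)) - (flow M t y - t • flow M t (M y))) := by
    rw [add_smul]; abel
  have h6 : h * ‖flow M t (M y)‖ ≤ h * ((2 * b + C * ‖M (M y)‖) * h) := by
    calc h * ‖flow M t (M y)‖ = ‖h • flow M t (M y)‖ := by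
          rw [norm_smul, Real.norm_of_nonneg hh0.le]
      _ ≤ (b * (h * h) + b * (h * h)) + C * ‖M (M y)‖ * h * ‖t + h - t‖ := by
          rw [h5]
          refine (norm_sub_le _ _).trans (add_le_add ((norm_sub_le _ _).trans
            (add_le_add (h3.trans ?_) h4)) h1)
          gcongr
      _ = h * ((2 * b + C * ‖M (M y)‖) * h) := by
          rw [add_sub_cancel_left, Real.norm_of_nonneg hh0.le]; ring
  exact le_of_mul_le_mul_left h6 hh0

/-- The orbit of `z = M y` is the derivative of the orbit of `y`, so the rate `t ^ (-1/4)` for `z`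
comes from interpolation between the rate `t ^ (-1/2)` for `y` and the boundedness of the orbit of
`M z`. -/
theorem exists_norm_flow_kelvinVoigt_le {c : ℝ} (hc : 0 < c) :
    ∃ C : ℝ, 0 ≤ C ∧ ∀ ν, c ≤ ν → ∀ t : ℝ, 0 < t → ∀ z : EnergySpace 2 ℂ ℂ,
      ‖flow (modeOp matA matD ν (ν ^ 2)) t z‖ ≤
        C * t ^ (-(1 / 4) : ℝ) * (‖z‖ + ‖modeOp matA matD ν (ν ^ 2) z‖) := by
  refine ⟨2 * (√(1100 * (1 + 1 / c ^ 2) * (1 + 2 / c ^ 2)) * (4 / c + 13)) + √(1 + 2 / c ^ 2),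
    by positivity, fun ν hν t ht z => ?_⟩
  obtain ⟨y, rfl, hy⟩ := exists_modeOp_eq hc hν z
  set M := modeOp matA matD ν (ν ^ 2)
  have h1 := norm_flow_interpolation (M := M) (y := y)
    (b := √(1100 * (1 + 1 / c ^ 2) * (1 + 2 / c ^ 2)) * (‖y‖ + ‖M y‖ + ‖M (M y)‖))
    (fun s hs z => norm_flow_modeOp_le hc hν (sq_nonneg ν) hs z) (fun s hs => by
      refine (norm_flow_kelvinVoigt_le hc hν hs y).trans (le_of_eq ?_)
      ring) ht
  refine h1.trans (le_trans ?_ (le_of_eq (mul_right_comm _ _ _)))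
  gcongr
  have h2 : ‖y‖ + ‖M y‖ + ‖M (M y)‖ ≤ (4 / c + 13) * (‖M y‖ + ‖M (M y)‖) := by
    have : 0 ≤ (4 / c + 12) * ‖M (M y)‖ := by positivity
    nlinarith
  have h3 := mul_le_mul_of_nonneg_left h2
    (Real.sqrt_nonneg (1100 * (1 + 1 / c ^ 2) * (1 + 2 / c ^ 2)))
  have h4 : 0 ≤ √(1 + 2 / c ^ 2) * ‖M y‖ := by positivity
  nlinarith

end ModeDecay

/-! ### Eigenvalues near the imaginary axis -/

section Root

open Polynomial

/-- A polynomial of degree `n` has a root within `n |f z / f' z|` of `z`: otherwise every term of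
`f' z / f z = ∑ 1 / (z - root)` would be too small. -/
theorem exists_root_near {f : ℂ[X]} (hf : 0 < f.natDegree) (z : ℂ) :
    ∃ β, f.eval β = 0 ∧ ‖β - z‖ * ‖f.derivative.eval z‖ ≤ f.natDegree * ‖f.eval z‖ := by
  by_contra! hcon
  have hz : f.eval z ≠ 0 := fun h => by
    have := hcon z h
    simp [h] at this
  have hz' : 0 < ‖f.eval z‖ := norm_pos_iff.2 hz
  have hne : f ≠ 0 := fun h => by simp [h] at hf
  obtain ⟨β₀, hβ₀⟩ := IsAlgClosed.exists_root f (by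
    rw [degree_eq_natDegree hne]; exact_mod_cast hf.ne')
  have hd : 0 < ‖f.derivative.eval z‖ := by
    by_contra h
    have h0 : ‖f.derivative.eval z‖ = 0 := le_antisymm (not_lt.1 h) (norm_nonneg _)
    have := hcon β₀ hβ₀
    rw [h0, mul_zero] at this
    have : 0 ≤ (f.natDegree : ℝ) * ‖f.eval z‖ := by positivity
    linarith
  have hn : (0 : ℝ) < f.natDegree := by exact_mod_cast hf
  have hsum := (IsAlgClosed.splits f).eval_derivative_div_eval_of_ne_zero hz
  have hlt : ∀ β ∈ f.roots, ‖1 / (z - β)‖ < ‖f.derivative.eval z‖ / (f.natDegree * ‖f.eval z‖) := by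
    intro β hβ
    have h1 := hcon β (isRoot_of_mem_roots hβ)
    have h2 : 0 < ‖β - z‖ := by
      rw [norm_pos_iff, sub_ne_zero]
      rintro rfl
      exact hz (isRoot_of_mem_roots hβ)
    rw [norm_div, norm_one, norm_sub_rev, div_lt_div_iff₀ h2 (by positivity), one_mul]
    linarith
  have hcard : f.roots.card = f.natDegree := by
    rw [(IsAlgClosed.splits f).natDegree_eq_card_roots]
  have h3 : ‖f.derivative.eval z / f.eval z‖ < ‖f.derivative.eval z‖ / ‖f.eval z‖ := by
    rw [hsum]
    have h4 : ‖(f.roots.map fun β => 1 / (z - β)).sum‖ ≤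
        (f.roots.map fun β => ‖1 / (z - β)‖).sum := by
      have := norm_multiset_sum_le (f.roots.map fun β => 1 / (z - β))
      rwa [Multiset.map_map] at this
    have h5 : (f.roots.map fun β => ‖1 / (z - β)‖).sum <
        (f.roots.map fun _ => ‖f.derivative.eval z‖ / (f.natDegree * ‖f.eval z‖)).sum :=
      Multiset.sum_lt_sum_of_nonempty ((mem_roots hne).2 hβ₀ |> fun h => by
        rintro h0; rw [h0] at h; simp at h) hlt
    rw [Multiset.map_const', Multiset.sum_replicate, hcard, nsmul_eq_mul] at h5
    refine h4.trans_lt (h5.trans_le (le_of_eq ?_))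
    field_simp
  rw [norm_div] at h3
  exact lt_irrefl _ h3

/-- The characteristic equation of a mode, with `P = β ^ 2 + ν ^ 2`. -/
def IsModeRoot (ν γ : ℝ) (β : ℂ) : Prop :=
  (β ^ 2 + ν ^ 2 + 1) * (β ^ 2 + ν ^ 2 + 2) + γ * β * (5 * (β ^ 2 + ν ^ 2) + 6) = 0

/-- At `z = i ν` the characteristic polynomial has size at most `8 γ ν`, and its derivative has size
at least `4 γ ν²`, so that `exists_root_near` applies with degree `4`. -/
theorem exists_isModeRoot (ν γ : ℝ) : ∃ β : ℂ, IsModeRoot ν γ β ∧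
    (1 ≤ ν → 1 ≤ γ → ν * ‖β - Complex.I * ν‖ ≤ 8) := by
  let f : ℂ[X] := (X ^ 2 + C ((ν : ℂ) ^ 2 + 1)) * (X ^ 2 + C ((ν : ℂ) ^ 2 + 2)) +
    C (γ : ℂ) * X * (C 5 * X ^ 2 + C (5 * (ν : ℂ) ^ 2 + 6))
  have hdeg : f.natDegree = 4 := by
    simp only [f]; compute_degree!
  obtain ⟨β, h1, h2⟩ := exists_root_near (f := f) (by omega) (Complex.I * ν)
  refine ⟨β, ?_, fun hν hγ => ?_⟩
  · simp only [f, eval_add, eval_mul, eval_pow, eval_X, eval_C] at h1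
    unfold IsModeRoot
    linear_combination h1
  · have e1 : f.eval (Complex.I * ν) = 2 + 6 * γ * ν * Complex.I := by
      simp only [f, eval_add, eval_mul, eval_pow, eval_X, eval_C]
      linear_combination (Complex.I ^ 2 * ν ^ 4 + ν ^ 4 + 3 * ν ^ 2 + 5 * γ * Complex.I * ν ^ 3) *
        Complex.I_sq
    have e2 : f.derivative.eval (Complex.I * ν) =
        (6 * γ - 10 * γ * ν ^ 2 : ℝ) + (6 * ν : ℝ) * Complex.I := by
      simp only [f, derivative_add, derivative_mul, derivative_C, derivative_X, derivative_X_pow,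
        eval_add, eval_mul, eval_pow, eval_X, eval_C, eval_one, eval_zero]
      push_cast
      linear_combination (4 * ν ^ 3 * Complex.I + 15 * γ * ν ^ 2) * Complex.I_sq
    have hνγ : 1 ≤ γ * ν := one_le_mul_of_one_le_of_one_le hγ hν
    have b1 : ‖f.eval (Complex.I * ν)‖ ≤ 8 * (γ * ν) := by
      rw [e1]
      refine (norm_add_le _ _).trans ?_
      simp only [norm_mul, Complex.norm_I, Complex.norm_real, Complex.norm_ofNat,
        Real.norm_of_nonneg (zero_le_one.trans hγ), Real.norm_of_nonneg (zero_le_one.trans hν)]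
      linarith
    have b2 : 4 * (γ * ν) * ν ≤ ‖f.derivative.eval (Complex.I * ν)‖ := by
      rw [e2]
      refine le_trans ?_ (Complex.abs_re_le_norm _)
      have e3 : ((6 * γ - 10 * γ * ν ^ 2 : ℝ) + (6 * ν : ℝ) * Complex.I).re =
          6 * γ - 10 * γ * ν ^ 2 := by
        rw [Complex.add_re, Complex.re_ofReal_mul, Complex.I_re, Complex.ofReal_re]; ring
      rw [e3, abs_sub_comm]
      refine le_trans ?_ (le_abs_self _)
      nlinarith [mul_le_mul_of_nonneg_left (one_le_pow₀ hν (n := 2)) (zero_le_one.trans hγ)]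
    rw [hdeg] at h2
    push_cast at h2
    have h3 : ‖β - Complex.I * ν‖ * (4 * (γ * ν) * ν) ≤ 4 * (8 * (γ * ν)) :=
      (mul_le_mul_of_nonneg_left b2 (norm_nonneg _)).trans (h2.trans
        (mul_le_mul_of_nonneg_left b1 (by norm_num)))
    have h4 : 0 < γ * ν := by linarith
    refine le_of_mul_le_mul_left ?_ (show 0 < 4 * (γ * ν) by positivity)
    linarith

end Root

/-! ### Asymptotic expansion of the eigenvalues -/

section Expansion

variable {ε : ℕ → ℝ} {e δ : ℕ → ℂ}

theorem isBigO_pow_of_le (hε : Tendsto ε atTop (𝓝 0)) {j k : ℕ} (h : j ≤ k) :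
    (fun n => ε n ^ k) =O[atTop] fun n => ε n ^ j := by
  obtain ⟨i, rfl⟩ := Nat.exists_eq_add_of_le h
  have h1 : (fun n => ε n ^ i) =O[atTop] fun _ => (1 : ℝ) := by
    simpa using ((hε.isBigO_one ℝ).pow i)
  simpa [pow_add] using (isBigO_refl (fun n => ε n ^ j) atTop).mul h1

theorem isBigO_mul_pow {f g : ℕ → ℂ} {j k : ℕ} (hf : f =O[atTop] fun n => ε n ^ j)
    (hg : g =O[atTop] fun n => ε n ^ k) : (fun n => f n * g n) =O[atTop] fun n => ε n ^ (j + k) := by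
  simpa [pow_add] using hf.mul hg

theorem isBigO_ofReal_pow (k : ℕ) :
    (fun n => (ε n : ℂ) ^ k) =O[atTop] fun n => ε n ^ k :=
  IsBigO.of_norm_right (IsBigO.of_bound 1 (by simp))

theorem isBigO_const_pow (c : ℂ) : (fun _ : ℕ => c) =O[atTop] fun n => ε n ^ 0 := by
  simpa using isBigO_const_const c (one_ne_zero (α := ℝ)) atTop

/-- One step of the fixed-point iteration for `δ`: the coefficient `5 i + 5 e ε²` of `δ` is `5 i`
up to `O(ε²)`. -/
theorem delta_eq_isBigO (hε : Tendsto ε atTop (𝓝 0)) {m : ℕ}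
    (he : e =O[atTop] fun n => ε n ^ 0)
    (h3 : ∀ᶠ n in atTop, 5 * (Complex.I + e n * (ε n : ℂ) ^ 2) * δ n =
      (ε n : ℂ) ^ m * (4 / 25 - 3 / 5 * δ n - δ n ^ 2)) {j : ℕ}
    (hδ : δ =O[atTop] fun n => ε n ^ j) :
    (fun n => δ n + 4 / 125 * Complex.I * (ε n : ℂ) ^ m) =O[atTop]
      fun n => ε n ^ (min m 2 + j) := by
  have hδ0 : δ =O[atTop] fun n => ε n ^ 0 := hδ.trans (isBigO_pow_of_le hε (Nat.zero_le j))
  have t1 : (fun n => Complex.I / 5 * ((ε n : ℂ) ^ m * (δ n * (3 / 5 + δ n)))) =O[atTop]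
      fun n => ε n ^ (min m 2 + j) := by
    have := (isBigO_const_pow (ε := ε) (Complex.I / 5)).mul ((isBigO_ofReal_pow (ε := ε) m).mul
      (hδ.mul (((isBigO_const_pow (ε := ε) (3 / 5)).add hδ0))))
    refine IsBigO.trans (g := fun n => ε n ^ (m + j)) (by simpa [pow_add] using this)
      (isBigO_pow_of_le hε (by omega))
  have t2 : (fun n => Complex.I * (e n * ((ε n : ℂ) ^ 2 * δ n))) =O[atTop]
      fun n => ε n ^ (min m 2 + j) := by
    have := (isBigO_const_pow (ε := ε) Complex.I).mul (he.mul ((isBigO_ofReal_pow (ε := ε) 2).mul hδ))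
    refine IsBigO.trans (g := fun n => ε n ^ (2 + j)) (by simpa [pow_add] using this)
      (isBigO_pow_of_le hε (by omega))
  refine (t1.add t2).congr' ?_ EventuallyEq.rfl
  filter_upwards [h3] with n hn
  linear_combination (Complex.I / 5) * hn - δ n * Complex.I_sq

theorem delta_isBigO (hε : Tendsto ε atTop (𝓝 0)) {m : ℕ}
    (he : e =O[atTop] fun n => ε n ^ 0)
    (h3 : ∀ᶠ n in atTop, 5 * (Complex.I + e n * (ε n : ℂ) ^ 2) * δ n =
      (ε n : ℂ) ^ m * (4 / 25 - 3 / 5 * δ n - δ n ^ 2))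
    (hδ : δ =O[atTop] fun n => ε n ^ 0) : δ =O[atTop] fun n => ε n ^ m := by
  -- each iteration gains `min m 2` powers of `ε`, up to the order `m` of the main term
  have hm : (fun n => 4 / 125 * Complex.I * (ε n : ℂ) ^ m) =O[atTop] fun n => ε n ^ m := by
    simpa using (isBigO_const_pow (ε := ε) (4 / 125 * Complex.I)).mul (isBigO_ofReal_pow (ε := ε) m)
  have step : ∀ j, δ =O[atTop] (fun n => ε n ^ j) → δ =O[atTop] fun n => ε n ^ min m (j + 1) := by
    intro j hj
    rcases Nat.eq_zero_or_pos m with rfl | hpos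
    · simpa using hδ
    have h1 := ((delta_eq_isBigO hε he h3 hj).trans
      (isBigO_pow_of_le hε (j := min m (j + 1)) (by omega))).sub
      (hm.trans (isBigO_pow_of_le hε (min_le_left m (j + 1))))
    simpa using h1
  have : ∀ j, δ =O[atTop] fun n => ε n ^ min m j := by
    intro j
    induction j with
    | zero => simpa using hδ
    | succ j ih =>
      refine (step _ ih).trans (isBigO_pow_of_le hε ?_)
      omega
  simpa using this m

/-- The leading term `-4/125 i ε ^ m` of `δ`, where `ε = 1 / ν`, and `m = 1` for viscous and `m = 3`
for Kelvin–Voigt damping. -/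
theorem delta_expansion (hε : Tendsto ε atTop (𝓝 0)) {m : ℕ}
    (he : e =O[atTop] fun n => ε n ^ 0)
    (h2 : ∀ n, δ n = 6 / 5 + 2 * Complex.I * e n + e n ^ 2 * (ε n : ℂ) ^ 2)
    (h3 : ∀ᶠ n in atTop, 5 * (Complex.I + e n * (ε n : ℂ) ^ 2) * δ n =
      (ε n : ℂ) ^ m * (4 / 25 - 3 / 5 * δ n - δ n ^ 2)) :
    (fun n => δ n + 4 / 125 * Complex.I * (ε n : ℂ) ^ m) =O[atTop]
      fun n => ε n ^ (min m 2 + m) := by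
  refine delta_eq_isBigO hε he h3 (delta_isBigO hε he h3 ?_)
  have h4 : (fun n => e n ^ 2 * (ε n : ℂ) ^ 2) =O[atTop] fun n => ε n ^ 0 := by
    have := (he.pow 2).mul (isBigO_ofReal_pow (ε := ε) 2)
    exact (by simpa using this : _ =O[atTop] fun n => ε n ^ 2).trans
      (isBigO_pow_of_le hε (Nat.zero_le 2))
  have h5 : (fun n => 2 * Complex.I * e n) =O[atTop] fun n => ε n ^ 0 := by
    simpa using (isBigO_const_pow (ε := ε) (2 * Complex.I)).mul he
  exact (((isBigO_const_pow (6 / 5)).add h5).add h4).congr_left fun n => (h2 n).symm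

/-- Expansion of `e = ν (β - i ν)` in powers of `ε = 1 / ν`, where `δ = β² + ν² + 6/5`. -/
theorem viscous_expansion (hε : Tendsto ε atTop (𝓝 0))
    (he : e =O[atTop] fun n => ε n ^ 0)
    (h2 : ∀ n, δ n = 6 / 5 + 2 * Complex.I * e n + e n ^ 2 * (ε n : ℂ) ^ 2)
    (h3 : ∀ᶠ n in atTop, 5 * (Complex.I + e n * (ε n : ℂ) ^ 2) * δ n =
      (ε n : ℂ) ^ 1 * (4 / 25 - 3 / 5 * δ n - δ n ^ 2)) :
    (fun n => e n - 3 / 5 * Complex.I + 2 / 125 * (ε n : ℂ)) =O[atTop] fun n => ε n ^ 2 := by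
  have h4 : (fun n => -(Complex.I / 2) * (δ n + 4 / 125 * Complex.I * (ε n : ℂ) ^ 1))
      =O[atTop] fun n => ε n ^ 2 := by
    simpa using (isBigO_const_pow (ε := ε) (-(Complex.I / 2))).mul (delta_expansion hε he h2 h3)
  have h5 : (fun n => Complex.I / 2 * (e n ^ 2 * (ε n : ℂ) ^ 2)) =O[atTop] fun n => ε n ^ 2 := by
    simpa using (isBigO_const_pow (ε := ε) (Complex.I / 2)).mul
      ((he.pow 2).mul (isBigO_ofReal_pow (ε := ε) 2))
  refine (h4.add h5).congr_left fun n => ?_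
  linear_combination (-(Complex.I / 2)) * h2 n + (-(e n) - 2 / 125 * (ε n : ℂ)) * Complex.I_sq

/-- The Kelvin–Voigt analogue of `viscous_expansion`. The real part is known to one more order than
`e` itself. -/
theorem kelvinVoigt_expansion (hε : Tendsto ε atTop (𝓝 0))
    (he : e =O[atTop] fun n => ε n ^ 0)
    (h2 : ∀ n, δ n = 6 / 5 + 2 * Complex.I * e n + e n ^ 2 * (ε n : ℂ) ^ 2)
    (h3 : ∀ᶠ n in atTop, 5 * (Complex.I + e n * (ε n : ℂ) ^ 2) * δ n =
      (ε n : ℂ) ^ 3 * (4 / 25 - 3 / 5 * δ n - δ n ^ 2)) :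
    (fun n => e n - 3 / 5 * Complex.I + 9 / 50 * Complex.I * (ε n : ℂ) ^ 2
        + 2 / 125 * (ε n : ℂ) ^ 3) =O[atTop] (fun n => ε n ^ 4) ∧
      (fun n => (e n).re + 2 / 125 * ε n ^ 3) =O[atTop] fun n => ε n ^ 5 := by
  have h4 : (fun n => -(Complex.I / 2) * (δ n + 4 / 125 * Complex.I * (ε n : ℂ) ^ 3))
      =O[atTop] fun n => ε n ^ 5 := by
    simpa using (isBigO_const_pow (ε := ε) (-(Complex.I / 2))).mul (delta_expansion hε he h2 h3)
  have hid : ∀ n, e n - 3 / 5 * Complex.I + 2 / 125 * (ε n : ℂ) ^ 3 =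
      -(Complex.I / 2) * (δ n + 4 / 125 * Complex.I * (ε n : ℂ) ^ 3) +
      Complex.I / 2 * (e n ^ 2 * (ε n : ℂ) ^ 2) := fun n => by
    linear_combination (Complex.I / 2) * h2 n + (e n + 2 / 125 * (ε n : ℂ) ^ 3) * Complex.I_sq
  -- the first-order expansion of `e` gives the second-order term of `e ^ 2`
  have h5 : (fun n => e n - 3 / 5 * Complex.I) =O[atTop] fun n => ε n ^ 2 := by
    have a1 : (fun n => Complex.I / 2 * (e n ^ 2 * (ε n : ℂ) ^ 2)) =O[atTop]
        fun n => ε n ^ 2 := by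
      simpa using (isBigO_const_pow (ε := ε) (Complex.I / 2)).mul
        ((he.pow 2).mul (isBigO_ofReal_pow (ε := ε) 2))
    have a2 : (fun n => 2 / 125 * (ε n : ℂ) ^ 3) =O[atTop] fun n => ε n ^ 3 := by
      simpa using (isBigO_const_pow (ε := ε) (2 / 125)).mul (isBigO_ofReal_pow (ε := ε) 3)
    refine (((h4.trans (isBigO_pow_of_le hε (by norm_num))).add a1).sub
      (a2.trans (isBigO_pow_of_le hε (by norm_num)))).congr_left fun n => ?_
    linear_combination -hid n
  constructor
  · have h6 : (fun n => Complex.I / 2 * ((e n - 3 / 5 * Complex.I) *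
        (e n + 3 / 5 * Complex.I) * (ε n : ℂ) ^ 2)) =O[atTop] fun n => ε n ^ 4 := by
      have := (isBigO_const_pow (ε := ε) (Complex.I / 2)).mul
        ((h5.mul (he.add (isBigO_const_pow (ε := ε) (3 / 5 * Complex.I)))).mul
          (isBigO_ofReal_pow (ε := ε) 2))
      simpa [← pow_add] using this
    refine ((h4.trans (isBigO_pow_of_le hε (by norm_num))).add h6).congr_left fun n => ?_
    linear_combination -hid n - 9 / 50 * Complex.I * (ε n : ℂ) ^ 2 * Complex.I_sq
  · -- `Re (i e² / 2) = - Re e Im e`, so that the real part satisfies a linear equation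
    have hre : ∀ n, (e n).re + 2 / 125 * ε n ^ 3 =
        (-(Complex.I / 2) * (δ n + 4 / 125 * Complex.I * (ε n : ℂ) ^ 3)).re -
        (e n).re * (e n).im * ε n ^ 2 := fun n => by
      have := congrArg Complex.re (hid n)
      have r1 : (e n - 3 / 5 * Complex.I + 2 / 125 * (ε n : ℂ) ^ 3).re =
          (e n).re + 2 / 125 * ε n ^ 3 := by
        rw [← Complex.ofReal_pow]; simp [-Complex.ofReal_pow]
      have r2 : (Complex.I / 2 * (e n ^ 2 * (ε n : ℂ) ^ 2)).re =
          - ((e n).re * (e n).im * ε n ^ 2) := by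
        rw [← Complex.ofReal_pow, pow_two (e n)]; simp [-Complex.ofReal_pow]; ring
      rw [r1, Complex.add_re, r2] at this
      linarith
    have b1 : (fun n => (-(Complex.I / 2) * (δ n + 4 / 125 * Complex.I * (ε n : ℂ) ^ 3)).re)
        =O[atTop] fun n => ε n ^ 5 :=
      (IsBigO.of_bound 1 (Eventually.of_forall fun n => by
        rw [one_mul]; exact Complex.abs_re_le_norm _)).trans h4
    have him : (fun n => (e n).im) =O[atTop] fun n => ε n ^ 0 :=
      (IsBigO.of_bound 1 (Eventually.of_forall fun n => by
        rw [one_mul]; exact Complex.abs_im_le_norm _)).trans he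
    have b2 : (fun n => 2 / 125 * ε n ^ 3) =O[atTop] fun n => ε n ^ 3 :=
      (isBigO_refl _ _).const_mul_left _
    have step : ∀ j, (fun n => (e n).re) =O[atTop] (fun n => ε n ^ j) →
        (fun n => (e n).re + 2 / 125 * ε n ^ 3) =O[atTop] fun n => ε n ^ min 5 (j + 2) := by
      intro j hj
      have : (fun n => (e n).re * (e n).im * ε n ^ 2) =O[atTop] fun n => ε n ^ (j + 2) := by
        simpa [pow_add] using (hj.mul him).mul (isBigO_refl (fun n => ε n ^ 2) atTop)
      exact ((b1.trans (isBigO_pow_of_le hε (min_le_left _ _))).sub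
        (this.trans (isBigO_pow_of_le hε (min_le_right _ _)))).congr_left fun n => (hre n).symm
    have c0 : (fun n => (e n).re) =O[atTop] fun n => ε n ^ 0 :=
      (IsBigO.of_bound 1 (Eventually.of_forall fun n => by
        rw [one_mul]; exact Complex.abs_re_le_norm _)).trans he
    have c1 : (fun n => (e n).re) =O[atTop] fun n => ε n ^ 2 := by
      simpa using (step 0 c0).sub (b2.trans (isBigO_pow_of_le hε (by norm_num : 2 ≤ 3)))
    have c2 : (fun n => (e n).re) =O[atTop] fun n => ε n ^ 3 := by
      have := (step 2 c1).trans (isBigO_pow_of_le hε (by norm_num : 3 ≤ 4))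
      simpa using this.sub b2
    exact step 3 c2

theorem isLittleO_of_isBigO_pow (hε : Tendsto ε atTop (𝓝 0)) {E : Type*} [NormedAddCommGroup E]
    {f : ℕ → E} {j k : ℕ} (h : j < k) (hf : f =O[atTop] fun n => ε n ^ k) :
    f =o[atTop] fun n => ε n ^ j := by
  refine (hf.trans (isBigO_pow_of_le hε h)).trans_isLittleO ?_
  have h1 : ε =o[atTop] fun _ => (1 : ℝ) := (isLittleO_one_iff ℝ).2 hε
  simpa [pow_succ] using (isBigO_refl (fun n => ε n ^ j) atTop).mul_isLittleO h1

/-- The scaled distance `e = ν (β - i ν)` of a root to `i ν` is bounded, and `δ = P + 6 / 5`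
satisfies a fixed-point equation. -/
theorem exists_modeRoots {ν : ℕ → ℝ} (hν : ∀ n, 0 < ν n) (hνt : Tendsto ν atTop atTop) (s : ℕ) :
    ∃ (β e δ : ℕ → ℂ), (∀ n, IsModeRoot (ν n) (ν n ^ s) (β n)) ∧
      (∀ n, β n = Complex.I * ν n + e n * ((ν n)⁻¹ : ℝ)) ∧
      (e =O[atTop] fun n => (ν n)⁻¹ ^ 0) ∧ (∀ᶠ n in atTop, 1 + ‖β n‖ ≤ 10 * ν n) ∧
      (∀ n, δ n = 6 / 5 + 2 * Complex.I * e n + e n ^ 2 * (((ν n)⁻¹ : ℝ) : ℂ) ^ 2) ∧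
      ∀ᶠ n in atTop, 5 * (Complex.I + e n * (((ν n)⁻¹ : ℝ) : ℂ) ^ 2) * δ n =
        (((ν n)⁻¹ : ℝ) : ℂ) ^ (s + 1) * (4 / 25 - 3 / 5 * δ n - δ n ^ 2) := by
  choose β hroot hβ using fun n => exists_isModeRoot (ν n) (ν n ^ s)
  have hνC : ∀ n, (ν n : ℂ) ≠ 0 := fun n => by exact_mod_cast (hν n).ne'
  have hb : ∀ᶠ n in atTop, ν n * ‖β n - Complex.I * ν n‖ ≤ 8 := by
    filter_upwards [hνt.eventually_ge_atTop 1] with n hn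
    exact hβ n hn (one_le_pow₀ hn)
  refine ⟨β, fun n => ν n * (β n - Complex.I * ν n), fun n => β n ^ 2 + ν n ^ 2 + 6 / 5, hroot,
    fun n => ?_, ?_, ?_, fun n => ?_, Eventually.of_forall fun n => ?_⟩
  · have := hνC n
    push_cast
    field_simp
    ring
  · refine IsBigO.of_bound 8 ?_
    filter_upwards [hb] with n hn
    simpa [abs_of_pos (hν n)] using hn
  · filter_upwards [hb, hνt.eventually_ge_atTop 1] with n hn h1
    have h2 : ‖β n - Complex.I * ν n‖ ≤ 8 * ν n := by
      have : ‖β n - Complex.I * ν n‖ ≤ ν n * ‖β n - Complex.I * ν n‖ :=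
        le_mul_of_one_le_left (norm_nonneg _) h1
      linarith
    have h3 : ‖β n‖ ≤ ‖β n - Complex.I * ν n‖ + ‖Complex.I * (ν n : ℂ)‖ := by
      simpa using norm_add_le (β n - Complex.I * ν n) (Complex.I * ν n)
    have h4 : ‖Complex.I * (ν n : ℂ)‖ = ν n := by simp [abs_of_pos (hν n)]
    have h5 : ‖β n - Complex.I * ν n‖ ≤ 8 := by
      have : ‖β n - Complex.I * ν n‖ ≤ ν n * ‖β n - Complex.I * ν n‖ :=
        le_mul_of_one_le_left (norm_nonneg _) h1
      linarith
    linarith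
  · have := hνC n
    push_cast
    field_simp
    linear_combination (5 * (ν n : ℂ) ^ 2) * Complex.I_sq
  · have h := hroot n
    unfold IsModeRoot at h
    have h1 : ((ν n : ℂ)⁻¹) ^ (s + 1) * ((ν n : ℂ) ^ s * ν n) = 1 := by
      rw [← pow_succ, ← mul_pow, inv_mul_cancel₀ (hνC n), one_pow]
    have h2 : Complex.I + ν n * (β n - Complex.I * ν n) * ((ν n : ℂ)⁻¹) ^ 2 =
        (ν n : ℂ)⁻¹ * β n := by
      have := hνC n
      field_simp
      ring
    push_cast at h ⊢
    rw [h2]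
    have h3 : (ν n : ℂ)⁻¹ * β n = ((ν n : ℂ)⁻¹) ^ (s + 1) * ((ν n : ℂ) ^ s * β n) := by
      rw [pow_succ]
      have : ((ν n : ℂ)⁻¹) ^ s * (ν n : ℂ) ^ s = 1 := by
        rw [← mul_pow, inv_mul_cancel₀ (hνC n), one_pow]
      linear_combination (-(ν n : ℂ)⁻¹ * β n) * this
    rw [h3]
    linear_combination (((ν n : ℂ)⁻¹) ^ (s + 1)) * h

theorem exists_viscous_roots {ν : ℕ → ℝ} (hν : ∀ n, 0 < ν n) (hνt : Tendsto ν atTop atTop) :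
    ∃ β : ℕ → ℂ, (∀ n, IsModeRoot (ν n) 1 (β n)) ∧
      ((fun n => β n - (Complex.I * (ν n + 3 / (5 * ν n)) - 2 / (125 * (ν n : ℂ) ^ 2)))
          =o[atTop] (fun n => 1 / ν n ^ 2)) ∧
      (∀ᶠ n in atTop, -1 ≤ (β n).re * ν n ^ 2) ∧ ∀ᶠ n in atTop, 1 + ‖β n‖ ≤ 10 * ν n := by
  obtain ⟨β, e, δ, hroot, hβ, he, hb, h2, h3⟩ := exists_modeRoots hν hνt 0
  have hε : Tendsto (fun n => (ν n)⁻¹) atTop (𝓝 0) := hνt.inv_tendsto_atTop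
  have hνC : ∀ n, (ν n : ℂ) ≠ 0 := fun n => by exact_mod_cast (hν n).ne'
  have h := viscous_expansion hε he h2 (by simpa using h3)
  have h4 : (fun n => β n - (Complex.I * (ν n + 3 / (5 * ν n)) - 2 / (125 * (ν n : ℂ) ^ 2)))
      =o[atTop] (fun n => 1 / ν n ^ 2) := by
    have hone : (fun n => (((ν n)⁻¹ : ℝ) : ℂ)) =O[atTop] fun n => (ν n)⁻¹ ^ 1 := by
      simpa using isBigO_ofReal_pow (ε := fun n => (ν n)⁻¹) 1
    have h5 := isLittleO_of_isBigO_pow hε (j := 2) (k := 3) (by norm_num)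
      (isBigO_mul_pow (ε := fun n => (ν n)⁻¹) (j := 2) (k := 1) h hone)
    refine h5.congr (fun n => ?_) fun n => by simp
    rw [hβ]
    have := hνC n
    push_cast
    field_simp
    ring
  refine ⟨β, by simpa using hroot, h4, ?_, hb⟩
  filter_upwards [h4.def (c := 1 / 2) (by norm_num)] with n hn
  have h5 := (Complex.abs_re_le_norm _).trans hn
  have h6 : (β n - (Complex.I * (ν n + 3 / (5 * ν n)) - 2 / (125 * (ν n : ℂ) ^ 2))).re =
      (β n).re + 2 / (125 * ν n ^ 2) := by
    have e1 : (3 / (5 * ν n) : ℂ) = ((3 / (5 * ν n) : ℝ) : ℂ) := by push_cast; rfl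
    have e2 : (2 / (125 * (ν n : ℂ) ^ 2) : ℂ) = ((2 / (125 * ν n ^ 2) : ℝ) : ℂ) := by
      push_cast; rfl
    rw [e1, e2, ← Complex.ofReal_add]
    simp only [Complex.sub_re, Complex.mul_re, Complex.I_re, Complex.I_im, Complex.ofReal_re,
      Complex.ofReal_im]
    ring
  rw [h6, Real.norm_of_nonneg (by positivity)] at h5
  have h7 := (abs_le.1 h5).1
  have hp : 0 < ν n ^ 2 := pow_pos (hν n) 2
  have h8 := mul_le_mul_of_nonneg_right h7 hp.le
  have hν0 := (hν n).ne'
  have e3 : -(1 / 2 * (1 / ν n ^ 2)) * ν n ^ 2 = -(1 / 2) := by field_simp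
  have e4 : ((β n).re + 2 / (125 * ν n ^ 2)) * ν n ^ 2 = (β n).re * ν n ^ 2 + 2 / 125 := by
    field_simp
  rw [e3, e4] at h8
  linarith

theorem exists_kelvinVoigt_roots {ν : ℕ → ℝ} (hν : ∀ n, 0 < ν n) (hνt : Tendsto ν atTop atTop) :
    ∃ β : ℕ → ℂ, (∀ n, IsModeRoot (ν n) (ν n ^ 2) (β n)) ∧
      ((fun n => β n - (Complex.I * (ν n + 3 / (5 * ν n) - 9 / (50 * (ν n : ℂ) ^ 3))
            - 2 / (125 * (ν n : ℂ) ^ 4)))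
          =o[atTop] (fun n => 1 / ν n ^ 4)) ∧
      ((fun n => (β n).re + 2 / (125 * ν n ^ 4)) =o[atTop] (fun n => 1 / ν n ^ 5)) ∧
      (∀ᶠ n in atTop, -1 ≤ (β n).re * ν n ^ 4) ∧ ∀ᶠ n in atTop, 1 + ‖β n‖ ≤ 10 * ν n := by
  obtain ⟨β, e, δ, hroot, hβ, he, hb, h2, h3⟩ := exists_modeRoots hν hνt 2
  have hε : Tendsto (fun n => (ν n)⁻¹) atTop (𝓝 0) := hνt.inv_tendsto_atTop
  have hνC : ∀ n, (ν n : ℂ) ≠ 0 := fun n => by exact_mod_cast (hν n).ne'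
  obtain ⟨h, hre⟩ := kelvinVoigt_expansion hε he h2 h3
  have h4 : (fun n => (β n).re + 2 / (125 * ν n ^ 4)) =o[atTop] (fun n => 1 / ν n ^ 5) := by
    have h5 := isLittleO_of_isBigO_pow hε (j := 5) (k := 6) (by norm_num)
      ((hre.mul (isBigO_refl (fun n => (ν n)⁻¹) atTop)).congr_right fun n => by ring)
    refine h5.congr (fun n => ?_) fun n => by simp
    have e1 : (β n).re = (e n).re * (ν n)⁻¹ := by
      rw [hβ, Complex.add_re, Complex.re_mul_ofReal]
      simp
    rw [e1]
    have := (hν n).ne'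
    field_simp
  refine ⟨β, hroot, ?_, h4, ?_, hb⟩
  · have hone : (fun n => (((ν n)⁻¹ : ℝ) : ℂ)) =O[atTop] fun n => (ν n)⁻¹ ^ 1 := by
      simpa using isBigO_ofReal_pow (ε := fun n => (ν n)⁻¹) 1
    have h5 := isLittleO_of_isBigO_pow hε (j := 4) (k := 5) (by norm_num)
      (isBigO_mul_pow (ε := fun n => (ν n)⁻¹) (j := 4) (k := 1) h hone)
    refine h5.congr (fun n => ?_) fun n => by simp
    rw [hβ]
    have := hνC n
    push_cast
    field_simp
    ring
  · filter_upwards [h4.def (c := 1 / 2) (by norm_num), hνt.eventually_ge_atTop 1] with n h5 h1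
    rw [Real.norm_eq_abs, Real.norm_of_nonneg (by have := hν n; positivity)] at h5
    have h7 := (abs_le.1 h5).1
    have hp : 0 < ν n ^ 4 := pow_pos (hν n) 4
    have h8 := mul_le_mul_of_nonneg_right h7 hp.le
    have hν0 := hν n
    have e3 : -(1 / 2 * (1 / ν n ^ 5)) * ν n ^ 4 = -(1 / (2 * ν n)) := by field_simp
    have e4 : ((β n).re + 2 / (125 * ν n ^ 4)) * ν n ^ 4 = (β n).re * ν n ^ 4 + 2 / 125 := by
      field_simp
    have e5 : 1 / (2 * ν n) ≤ 1 / 2 := by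
      rw [div_le_div_iff₀ (by positivity) (by norm_num)]; linarith
    rw [e3, e4] at h8
    linarith

end Expansion

/-! ### The three conclusions for an elliptic model -/

section Elliptic

universe u

variable {H₁ H₀ Z : Type*} {K : Type u}
  [NormedAddCommGroup H₁] [InnerProductSpace ℂ H₁]
  [NormedAddCommGroup H₀] [InnerProductSpace ℂ H₀]
  [NormedAddCommGroup K] [InnerProductSpace ℂ K]
  [NormedAddCommGroup Z] [InnerProductSpace ℂ Z]
  {m : Model H₁ H₀ K Z}

/-- The characteristic equation is the vanishing of the determinant of
`(β ^ 2 + ν ^ 2) + A + γ β D`. -/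
theorem IsModeRoot.exists_kernel {ν γ : ℝ} {β : ℂ} (h : IsModeRoot ν γ β) :
    ∃ c : Fin 2 → ℂ, c ≠ 0 ∧ ∀ i, (β ^ 2 + ν ^ 2) * c i + ∑ j, (matA i j : ℂ) * c j
      + γ * β * ∑ j, (matD i j : ℂ) * c j = 0 := by
  let M : Matrix (Fin 2) (Fin 2) ℂ := !![β ^ 2 + ν ^ 2 + 1 + γ * β, γ * β * 2;
    γ * β * 2, β ^ 2 + ν ^ 2 + 2 + γ * β * 4]
  have hdet : M.det = 0 := by
    rw [Matrix.det_fin_two_of]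
    unfold IsModeRoot at h
    linear_combination h
  obtain ⟨c, hc, hM⟩ := Matrix.exists_mulVec_eq_zero_iff.2 hdet
  have h0 := congrFun hM 0
  have h1 := congrFun hM 1
  simp only [M, Matrix.mulVec, dotProduct, Fin.sum_univ_two, Matrix.of_apply, Matrix.cons_val',
    Matrix.cons_val_zero, Matrix.cons_val_one, Matrix.cons_val_fin_one, Pi.zero_apply] at h0 h1
  refine ⟨c, hc, fun i => ?_⟩
  fin_cases i
  · simp [matA, matD, Fin.sum_univ_two]
    linear_combination h0
  · simp [matA, matD, Fin.sum_univ_two]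
    linear_combination h1

theorem isEigenvector_modeState {ν γ : ℝ} {β : ℂ} {φ : H₁}
    (hφ : m.IsEigenfunction (ν ^ 2) φ)
    (hdamp : ∀ ψ, inner ℂ (m.damp ψ) (m.damp φ) = (γ : ℂ) * inner ℂ (m.emb ψ) (m.emb φ))
    {c : Fin 2 → ℂ} (hc : c ≠ 0) (h : ∀ i, (β ^ 2 + ν ^ 2) * c i + ∑ j, (matA i j : ℂ) * c j
      + γ * β * ∑ j, (matD i j : ℂ) * c j = 0) :
    m.IsEigenvector matA matD β (m.modeState c β φ) := by
  have hfst : ∀ i, (m.modeState c β φ).fst i = c i • φ := fun _ => rfl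
  have hsnd : ∀ i, (m.modeState c β φ).snd i = (β * c i) • m.emb φ := fun _ => rfl
  refine ⟨fun h0 => ?_, fun i => ?_, fun i ψ => ?_⟩
  · obtain ⟨i, hi⟩ := Function.ne_iff.1 hc
    have h1 := hfst i
    rw [h0] at h1
    exact smul_ne_zero hi hφ.1 h1.symm
  · simp only [WithLp.smul_fst, PiLp.smul_apply, hfst, hsnd, map_smul, smul_smul]
  · have h2 := hφ.2 ψ
    simp only [WithLp.smul_fst, WithLp.smul_snd, PiLp.smul_apply, hfst, hsnd, map_smul, smul_smul,
      inner_smul_right, hdamp, h2]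
    have h3 : ∀ w : ℂ, ∑ j, (matA i j : ℂ) * (c j * w) = (∑ j, (matA i j : ℂ) * c j) * w :=
      fun w => by rw [Finset.sum_mul]; exact Finset.sum_congr rfl fun j _ => by ring
    have h4 : ∀ w : ℂ, ∑ j, (matD i j : ℂ) * (β * c j * (γ * w)) =
        γ * β * (∑ j, (matD i j : ℂ) * c j) * w := fun w => by
      rw [Finset.mul_sum, Finset.sum_mul]
      exact Finset.sum_congr rfl fun j _ => by ring
    rw [h3, h4]
    push_cast
    linear_combination (inner ℂ (m.emb ψ) (m.emb φ)) * h i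

/-- The damping coefficient of the modes is `γ = 1` when the damping is `u'`. -/
theorem Model.IsElliptic.viscous [CompleteSpace H₁] [CompleteSpace H₀] [CompleteSpace K]
    (hm : m.IsElliptic)
    (hdamp : ∀ u v, inner ℂ (m.damp u) (m.damp v) = inner ℂ (m.emb u) (m.emb v)) :
    m.WellPosed matA matD ∧
      (∃ (ν : ℕ → ℝ) (β : ℕ → ℂ), m.IsFrequencySequence ν ∧
        m.IsEigenvalueBranch matA matD ν β ∧
        (fun n => β n - (Complex.I * (ν n + 3 / (5 * ν n)) - 2 / (125 * (ν n : ℂ) ^ 2)))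
          =o[atTop] (fun n => 1 / ν n ^ 2)) ∧
      m.OptimalRate matA matD (1 / 2) := by
  obtain ⟨ι, ⟨B⟩⟩ := hm.exists_modalBasis
  obtain ⟨c, hc, hcν⟩ := B.exists_le_ν
  have hγ : ∀ k u, inner ℂ (m.damp (B.φ k)) (m.damp u) =
      (((fun _ : ι => (1 : ℝ)) k : ℝ) : ℂ) * inner ℂ (B.e k) (m.emb u) := fun k u => by
    rw [hdamp, B.emb_φ]
    simp
  obtain ⟨ν, hν⟩ := B.exists_isFrequencySequence
  obtain ⟨β, hroot, hexp, hre, hn⟩ := exists_viscous_roots hν.2.1 hν.2.2.1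
  have hbranch : m.IsEigenvalueBranch matA matD ν β := fun n => by
    obtain ⟨a, ha, h⟩ := (hroot n).exists_kernel
    exact ⟨a, fun φ hφ => isEigenvector_modeState hφ
      (fun ψ => by rw [hdamp]; simp) ha h⟩
  refine ⟨B.wellPosed hγ fun k t ht z => norm_flow_modeOp_le hc (hcν k) zero_le_one ht z,
    ⟨ν, β, hν, hbranch, hexp⟩, ?_, fun ρ hρ => ?_⟩
  · exact B.decayBound hγ (Real.sqrt_nonneg _) fun k t ht z =>
      norm_flow_viscous_le hc (hcν k) (by linarith) z
  · choose a ha using hbranch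
    choose φ hφ using fun n => (hν.2.2.2 (ν n ^ 2)).2 ⟨n, rfl⟩
    exact m.not_decayBoundAt_of_eigenvalues (q := 2) (fun n => ha n (φ n) (hφ n)) hν.2.2.1
      two_ne_zero hre hn (by exact_mod_cast hρ)

/-- The damping coefficient of the mode of frequency `ν` is `γ = ν ^ 2` when the damping is
`L u'`. -/
theorem Model.IsElliptic.kelvinVoigt [CompleteSpace H₁] [CompleteSpace H₀] [CompleteSpace K]
    (hm : m.IsElliptic)
    (hdamp : ∀ u v, inner ℂ (m.damp u) (m.damp v) = inner ℂ (m.stiff u) (m.stiff v)) :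
    m.WellPosed matA matD ∧
      (∃ (ν : ℕ → ℝ) (β : ℕ → ℂ), m.IsFrequencySequence ν ∧
        m.IsEigenvalueBranch matA matD ν β ∧
        (fun n => β n - (Complex.I * (ν n + 3 / (5 * ν n) - 9 / (50 * (ν n : ℂ) ^ 3))
            - 2 / (125 * (ν n : ℂ) ^ 4)))
          =o[atTop] (fun n => 1 / ν n ^ 4) ∧
        (fun n => (β n).re + 2 / (125 * ν n ^ 4)) =o[atTop] (fun n => 1 / ν n ^ 5)) ∧
      m.OptimalRate matA matD (1 / 4) := by
  obtain ⟨ι, ⟨B⟩⟩ := hm.exists_modalBasis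
  obtain ⟨c, hc, hcν⟩ := B.exists_le_ν
  have hγ : ∀ k u, inner ℂ (m.damp (B.φ k)) (m.damp u) =
      (((fun k : ι => B.ν k ^ 2) k : ℝ) : ℂ) * inner ℂ (B.e k) (m.emb u) := fun k u => by
    rw [hdamp, B.stiff_φ]
    push_cast
    rfl
  obtain ⟨ν, hν⟩ := B.exists_isFrequencySequence
  obtain ⟨β, hroot, hexp, hexp', hre, hn⟩ := exists_kelvinVoigt_roots hν.2.1 hν.2.2.1
  have hbranch : m.IsEigenvalueBranch matA matD ν β := fun n => by
    obtain ⟨a, ha, h⟩ := (hroot n).exists_kernel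
    exact ⟨a, fun φ hφ => isEigenvector_modeState hφ
      (fun ψ => by rw [hdamp, hφ.2]) ha h⟩
  obtain ⟨C, hC0, hC⟩ := exists_norm_flow_kelvinVoigt_le hc
  refine ⟨B.wellPosed hγ fun k t ht z => norm_flow_modeOp_le hc (hcν k) (sq_nonneg _) ht z,
    ⟨ν, β, hν, hbranch, hexp, hexp'⟩, ?_, fun ρ hρ => ?_⟩
  · exact B.decayBound hγ hC0 fun k t ht z => hC _ (hcν k) t (by linarith) z
  · choose a ha using hbranch
    choose φ hφ using fun n => (hν.2.2.2 (ν n ^ 2)).2 ⟨n, rfl⟩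
    exact m.not_decayBoundAt_of_eigenvalues (q := 4) (fun n => ha n (φ n) (hφ n)) hν.2.2.1
      four_ne_zero hre hn (by exact_mod_cast hρ)

end Elliptic

/-! ### Translates of test functions: the Poincaré inequality and the oscillation over cubes -/

section Translation

open scoped ENNReal

theorem sq_lintegral_le {α : Type*} [MeasurableSpace α] (μ : Measure α) {f : α → ℝ≥0∞}
    (hf : AEMeasurable f μ) : (∫⁻ x, f x ∂μ) ^ 2 ≤ (∫⁻ x, f x ^ 2 ∂μ) * μ Set.univ := by
  have h := ENNReal.lintegral_mul_le_Lp_mul_Lq μ Real.HolderConjugate.two_two hf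
    (aemeasurable_const (b := (1 : ℝ≥0∞)))
  simp only [Pi.mul_apply, mul_one, ENNReal.rpow_two, one_pow, lintegral_const, one_mul] at h
  calc (∫⁻ x, f x ∂μ) ^ 2
      ≤ ((∫⁻ x, f x ^ 2 ∂μ) ^ (1 / 2 : ℝ) * μ Set.univ ^ (1 / 2 : ℝ)) ^ 2 := by gcongr
    _ = (∫⁻ x, f x ^ 2 ∂μ) * μ Set.univ := by
      rw [mul_pow, ← ENNReal.rpow_two, ← ENNReal.rpow_two, ← ENNReal.rpow_mul,
        ← ENNReal.rpow_mul]
      norm_num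

variable {d : ℕ} {Ω : Set (EuclideanSpace ℝ (Fin d))} {f : EuclideanSpace ℝ (Fin d) → ℂ}

theorem fderiv_apply_eq_sum (f : EuclideanSpace ℝ (Fin d) → ℂ) (x z : EuclideanSpace ℝ (Fin d)) :
    fderiv ℝ f x z = ∑ i, (z i : ℂ) * pd i f x := by
  conv_lhs => rw [← (EuclideanSpace.basisFun (Fin d) ℝ).sum_repr z]
  simp [pd]

theorem enorm_fderiv_apply_sq_le (f : EuclideanSpace ℝ (Fin d) → ℂ)
    (x z : EuclideanSpace ℝ (Fin d)) :
    ‖fderiv ℝ f x z‖ₑ ^ 2 ≤ ‖z‖ₑ ^ 2 * ∑ i, ‖pd i f x‖ₑ ^ 2 := by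
  have h : ‖fderiv ℝ f x z‖ ^ 2 ≤ ‖z‖ ^ 2 * ∑ i, ‖pd i f x‖ ^ 2 := by
    rw [fderiv_apply_eq_sum, EuclideanSpace.norm_sq_eq]
    calc ‖∑ i, (z i : ℂ) * pd i f x‖ ^ 2 ≤ (∑ i, ‖z i‖ * ‖pd i f x‖) ^ 2 := by
          gcongr
          refine (norm_sum_le _ _).trans_eq ?_
          simp
      _ ≤ _ := Finset.sum_mul_sq_le_sq_mul_sq _ _ _
  simp only [← ofReal_norm, ← ENNReal.ofReal_pow (norm_nonneg _)]
  rw [← ENNReal.ofReal_sum_of_nonneg (fun i _ => by positivity),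
    ← ENNReal.ofReal_mul (by positivity)]
  exact ENNReal.ofReal_le_ofReal h

theorem enorm_sub_sq_le (hf : ContDiff ℝ ∞ f) (x z : EuclideanSpace ℝ (Fin d)) :
    ‖f (x + z) - f x‖ₑ ^ 2 ≤
      ∫⁻ s in Set.Ioc (0 : ℝ) 1, ‖z‖ₑ ^ 2 * ∑ i, ‖pd i f (x + s • z)‖ₑ ^ 2 := by
  have hd : Differentiable ℝ f := hf.differentiable (by simp)
  have hc : Continuous fun s : ℝ => fderiv ℝ f (x + s • z) z :=
    ((hf.continuous_fderiv (by simp)).comp (by fun_prop)).clm_apply continuous_const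
  have h1 : f (x + z) - f x = ∫ s in (0 : ℝ)..1, fderiv ℝ f (x + s • z) z := by
    have h2 : ∀ s ∈ Set.uIcc (0 : ℝ) 1, HasDerivAt (fun s : ℝ => f (x + s • z))
        (fderiv ℝ f (x + s • z) z) s := fun s _ => by
      have h3 : HasDerivAt (fun s : ℝ => x + s • z) z s := by
        simpa using ((hasDerivAt_id s).smul_const z).const_add x
      exact (hd _).hasFDerivAt.comp_hasDerivAt s h3
    rw [intervalIntegral.integral_eq_sub_of_hasDerivAt h2 (hc.intervalIntegrable _ _)]
    simp
  rw [h1, intervalIntegral.integral_of_le zero_le_one]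
  calc _ ≤ (∫⁻ s in Set.Ioc (0 : ℝ) 1, ‖fderiv ℝ f (x + s • z) z‖ₑ) ^ 2 := by
        gcongr
        exact enorm_integral_le_lintegral_enorm _
    _ ≤ (∫⁻ s in Set.Ioc (0 : ℝ) 1, ‖fderiv ℝ f (x + s • z) z‖ₑ ^ 2) * 1 := by
        refine (sq_lintegral_le _ hc.enorm.measurable.aemeasurable).trans_eq ?_
        simp
    _ ≤ _ := by
        rw [mul_one]
        exact lintegral_mono fun s => enorm_fderiv_apply_sq_le _ _ _

theorem IsTest.continuous (hf : IsTest Ω f) : Continuous f := hf.1.continuous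

/-- The difference `f (· + z) - f` is of size `|z| ‖∇f‖` in `L²`. -/
theorem lintegral_translate_le (hf : IsTest Ω f) (z : EuclideanSpace ℝ (Fin d)) :
    ∫⁻ x, ‖f (x + z) - f x‖ₑ ^ 2 ≤ ‖z‖ₑ ^ 2 * ∑ i, ∫⁻ x, ‖pd i f x‖ₑ ^ 2 := by
  have hm : ∀ i, Measurable fun x => ‖pd i f x‖ₑ ^ 2 := fun i =>
    ((hf.pd i).continuous.enorm.measurable.pow_const 2)
  calc ∫⁻ x, ‖f (x + z) - f x‖ₑ ^ 2
      ≤ ∫⁻ x, ∫⁻ s in Set.Ioc (0 : ℝ) 1, ‖z‖ₑ ^ 2 * ∑ i, ‖pd i f (x + s • z)‖ₑ ^ 2 :=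
        lintegral_mono fun x => enorm_sub_sq_le hf.1 x z
    _ = ∫⁻ s in Set.Ioc (0 : ℝ) 1, ∫⁻ x, ‖z‖ₑ ^ 2 * ∑ i, ‖pd i f (x + s • z)‖ₑ ^ 2 := by
        refine lintegral_lintegral_swap (Measurable.aemeasurable ?_)
        refine Measurable.const_mul (Finset.measurable_sum _ fun i _ => (hm i).comp ?_) _
        fun_prop
    _ = ∫⁻ s in Set.Ioc (0 : ℝ) 1, ‖z‖ₑ ^ 2 * ∑ i, ∫⁻ x, ‖pd i f x‖ₑ ^ 2 := by
        refine lintegral_congr fun s => ?_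
        rw [lintegral_add_right_eq_self (μ := (volume : Measure (EuclideanSpace ℝ (Fin d))))
          (fun x => ‖z‖ₑ ^ 2 * ∑ i, ‖pd i f x‖ₑ ^ 2) (s • z),
          lintegral_const_mul _ (Finset.measurable_sum _ fun i _ => hm i),
          lintegral_finsetSum _ fun i _ => hm i]
    _ = _ := by simp

theorem IsTest.apply_eq_zero (hf : IsTest Ω f) {x : EuclideanSpace ℝ (Fin d)} (hx : x ∉ Ω) :
    f x = 0 :=
  image_eq_zero_of_notMem_tsupport fun h => hx (hf.2.2 h)

/-- The Poincaré inequality, from a translation that moves `Ω` off itself. -/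
theorem exists_poincare (hd : 0 < d) (hΩ : Bornology.IsBounded Ω) :
    ∃ C : ℝ, 0 ≤ C ∧ ∀ f, IsTest Ω f →
      ∫⁻ x, ‖f x‖ₑ ^ 2 ≤ ENNReal.ofReal C ^ 2 * ∑ i, ∫⁻ x, ‖pd i f x‖ₑ ^ 2 := by
  obtain ⟨R, hR0, hR⟩ := hΩ.subset_ball_lt 0 0
  let z : EuclideanSpace ℝ (Fin d) := EuclideanSpace.single ⟨0, hd⟩ (2 * R)
  have hz : ‖z‖ = 2 * R := by simp [z, abs_of_pos hR0]
  refine ⟨2 * R, by positivity, fun f hf => ?_⟩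
  have h := lintegral_translate_le hf z
  rw [← hz, ofReal_norm]
  refine (lintegral_mono fun x => ?_).trans h
  by_cases hx : x ∈ Ω
  · have h1 : x + z ∉ Ω := fun h2 => by
      have h3 := hR hx
      have h4 := hR h2
      rw [mem_ball_zero_iff] at h3 h4
      have h5 := norm_sub_le (x + z) x
      rw [add_sub_cancel_left, hz] at h5
      linarith
    rw [hf.apply_eq_zero h1, zero_sub, enorm_neg]
  · simp [hf.apply_eq_zero hx]

end Translation

/-! ### Averages over cubes -/

section Cubes

open scoped ENNReal

variable {d : ℕ} {Ω : Set (EuclideanSpace ℝ (Fin d))} {f : EuclideanSpace ℝ (Fin d) → ℂ} {h : ℝ}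

/-- The index of the cube of side `h` that contains `x`. -/
def cell (h : ℝ) (x : EuclideanSpace ℝ (Fin d)) : Fin d → ℤ := fun i => ⌊x i / h⌋

/-- The half-open cube of side `h` with index `k`; these cubes form a partition of the space. -/
def cube (h : ℝ) (k : Fin d → ℤ) : Set (EuclideanSpace ℝ (Fin d)) := cell h ⁻¹' {k}

theorem mem_cube {k : Fin d → ℤ} {x : EuclideanSpace ℝ (Fin d)} : x ∈ cube h k ↔ cell h x = k :=
  Iff.rfl

theorem cube_eq_preimage (hh : 0 < h) (k : Fin d → ℤ) : cube h k =
    (WithLp.ofLp : EuclideanSpace ℝ (Fin d) → Fin d → ℝ) ⁻¹'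
      Set.pi Set.univ fun i => Set.Ico (k i * h) ((k i + 1) * h) := by
  ext x
  simp [cube, cell, funext_iff, Int.floor_eq_iff, le_div_iff₀ hh, div_lt_iff₀ hh]

theorem measurableSet_cube (hh : 0 < h) (k : Fin d → ℤ) : MeasurableSet (cube h k) := by
  rw [cube_eq_preimage hh]
  exact (PiLp.volume_preserving_ofLp (Fin d)).measurable
    (MeasurableSet.univ_pi fun i => measurableSet_Ico)

theorem volume_cube (hh : 0 < h) (k : Fin d → ℤ) :
    volume (cube h k) = ENNReal.ofReal h ^ d := by
  rw [cube_eq_preimage hh, (PiLp.volume_preserving_ofLp (Fin d)).measure_preimage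
    (MeasurableSet.univ_pi fun i => measurableSet_Ico).nullMeasurableSet, Real.volume_pi_Ico]
  simp [add_mul]

theorem volume_cube_ne_top (hh : 0 < h) (k : Fin d → ℤ) : volume (cube h k) ≠ ⊤ := by
  rw [volume_cube hh]
  exact ENNReal.pow_ne_top ENNReal.ofReal_ne_top

theorem finite_cell_image (hΩ : Bornology.IsBounded Ω) (hh : 0 < h) : (cell h '' Ω).Finite := by
  obtain ⟨R, hR⟩ := hΩ.subset_closedBall 0
  refine (Set.finite_Icc (fun _ : Fin d => ⌊-R / h⌋) fun _ => ⌊R / h⌋).subset ?_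
  rintro _ ⟨x, hx, rfl⟩
  have h1 : ∀ i, |x i| ≤ R := fun i => by
    have h2 := hR hx
    rw [mem_closedBall_zero_iff] at h2
    exact (PiLp.norm_apply_le x i).trans h2
  constructor <;> intro i <;> simp only [cell] <;> gcongr
  · exact (abs_le.1 (h1 i)).1
  · exact (abs_le.1 (h1 i)).2

/-- The points `z` with `|z i| < h`: all differences of two points in a cube of side `h`. -/
def box (d : ℕ) (h : ℝ) : Set (EuclideanSpace ℝ (Fin d)) :=
  WithLp.ofLp ⁻¹' Set.pi Set.univ fun _ => Set.Ioo (-h) h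

theorem volume_box (h : ℝ) : volume (box d h) = ENNReal.ofReal (2 * h) ^ d := by
  rw [box, (PiLp.volume_preserving_ofLp (Fin d)).measure_preimage
    (MeasurableSet.univ_pi fun i => measurableSet_Ioo).nullMeasurableSet, Real.volume_pi_Ioo]
  simp [two_mul]

theorem measurableSet_box (h : ℝ) : MeasurableSet (box d h) :=
  (PiLp.volume_preserving_ofLp (Fin d)).measurable (MeasurableSet.univ_pi fun _ => measurableSet_Ioo)

theorem sub_mem_box (hh : 0 < h) {x y : EuclideanSpace ℝ (Fin d)} (hxy : cell h y = cell h x) :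
    y - x ∈ box d h := by
  have h1 : y ∈ cube h (cell h x) := hxy
  have h2 : x ∈ cube h (cell h x) := rfl
  rw [cube_eq_preimage hh] at h1 h2
  intro i _
  have h3 := h1 i trivial
  have h4 := h2 i trivial
  simp only [Set.mem_Ico, Set.mem_Ioo, PiLp.sub_apply] at h3 h4 ⊢
  constructor <;> linarith

theorem norm_sq_le_of_mem_box (hh : 0 < h) {z : EuclideanSpace ℝ (Fin d)} (hz : z ∈ box d h) :
    ‖z‖ₑ ^ 2 ≤ ENNReal.ofReal (d * h ^ 2) := by
  rw [← ofReal_norm, ← ENNReal.ofReal_pow (norm_nonneg _), EuclideanSpace.norm_sq_eq]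
  refine ENNReal.ofReal_le_ofReal ((Finset.sum_le_card_nsmul _ _ (h ^ 2) fun i _ => ?_).trans_eq
    (by simp))
  have h1 := hz i trivial
  exact sq_le_sq' (by linarith [norm_nonneg (z i)]) (abs_lt.2 ⟨h1.1, h1.2⟩).le

/-- The mean oscillation of `f` over cubes of side `h` is controlled by `h ‖∇f‖`. -/
theorem lintegral_oscillation_le (hf : IsTest Ω f) (hh : 0 < h) :
    ∫⁻ x, ∫⁻ y in cube h (cell h x), ‖f x - f y‖ₑ ^ 2 ≤
      ENNReal.ofReal (2 * h) ^ d *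
        (ENNReal.ofReal (d * h ^ 2) * ∑ i, ∫⁻ x, ‖pd i f x‖ₑ ^ 2) := by
  have hfc := hf.continuous
  calc ∫⁻ x, ∫⁻ y in cube h (cell h x), ‖f x - f y‖ₑ ^ 2
      ≤ ∫⁻ x, ∫⁻ z in box d h, ‖f (x + z) - f x‖ₑ ^ 2 := by
        refine lintegral_mono fun x => ?_
        rw [← lintegral_indicator (measurableSet_cube hh _),
          ← lintegral_indicator (measurableSet_box h), ← lintegral_add_left_eq_self _ x]
        refine lintegral_mono fun z => ?_
        by_cases hz : x + z ∈ cube h (cell h x)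
        · have h1 : z ∈ box d h := by simpa using sub_mem_box hh hz
          simp only [Set.indicator_of_mem hz, Set.indicator_of_mem h1]
          rw [← enorm_neg, neg_sub]
        · simp [Set.indicator_of_notMem hz]
    _ = ∫⁻ z in box d h, ∫⁻ x, ‖f (x + z) - f x‖ₑ ^ 2 := by
        refine lintegral_lintegral_swap (Continuous.measurable ?_).aemeasurable
        exact (ENNReal.continuous_pow 2).comp (by fun_prop)
    _ ≤ ∫⁻ z in box d h, ENNReal.ofReal (d * h ^ 2) * ∑ i, ∫⁻ x, ‖pd i f x‖ₑ ^ 2 :=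
        setLIntegral_mono measurable_const fun z hz =>
          (lintegral_translate_le hf z).trans (by gcongr; exact norm_sq_le_of_mem_box hh hz)
    _ = _ := by rw [setLIntegral_const, volume_box, mul_comm]

theorem IsTest.integrable (hf : IsTest Ω f) : Integrable f :=
  hf.continuous.integrable_of_hasCompactSupport hf.2.1

/-- Jensen's inequality on one cube; `h ^ d` is the volume of the cube. -/
theorem enorm_sub_mean_sq_le (hf : IsTest Ω f) (hh : 0 < h) (x : EuclideanSpace ℝ (Fin d)) :
    ENNReal.ofReal h ^ d * ‖f x - ((h ^ d)⁻¹ : ℝ) * ∫ y in cube h (cell h x), f y‖ₑ ^ 2 ≤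
      ∫⁻ y in cube h (cell h x), ‖f x - f y‖ₑ ^ 2 := by
  set Q := cube h (cell h x)
  have hQ : volume Q = ENNReal.ofReal h ^ d := volume_cube hh _
  have hQt : volume Q ≠ ⊤ := volume_cube_ne_top hh _
  have hQr : volume.real Q = h ^ d := by
    rw [Measure.real, hQ, ENNReal.toReal_pow, ENNReal.toReal_ofReal hh.le]
  have hp : 0 < h ^ d := pow_pos hh d
  have h1 : f x - ((h ^ d)⁻¹ : ℝ) * ∫ y in Q, f y = ((h ^ d)⁻¹ : ℝ) * ∫ y in Q, (f x - f y) := by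
    rw [integral_sub (integrable_const_iff.2 (Or.inr (isFiniteMeasure_restrict.2 hQt)))
      hf.integrable.integrableOn, setIntegral_const, hQr,
      Complex.real_smul, mul_sub, ← mul_assoc, ← Complex.ofReal_mul, inv_mul_cancel₀ hp.ne',
      Complex.ofReal_one, one_mul]
  have h2 : ‖(((h ^ d)⁻¹ : ℝ) : ℂ)‖ₑ = (ENNReal.ofReal h ^ d)⁻¹ := by
    rw [← ofReal_norm, Complex.norm_real, Real.norm_of_nonneg (by positivity),
      ENNReal.ofReal_inv_of_pos hp, ENNReal.ofReal_pow hh.le]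
  have h3 : (‖∫ y in Q, (f x - f y)‖ₑ) ^ 2 ≤
      (∫⁻ y in Q, ‖f x - f y‖ₑ ^ 2) * ENNReal.ofReal h ^ d := by
    have h4 : ‖∫ y in Q, (f x - f y)‖ₑ ^ 2 ≤ (∫⁻ y in Q, ‖f x - f y‖ₑ) ^ 2 := by
      gcongr
      exact enorm_integral_le_lintegral_enorm _
    refine h4.trans ((sq_lintegral_le _ ?_).trans_eq (by simp [hQ]))
    exact (continuous_const.sub hf.continuous).enorm.measurable.aemeasurable
  have hV0 : ENNReal.ofReal h ^ d ≠ 0 := by simp [hh]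
  have hVt : ENNReal.ofReal h ^ d ≠ ⊤ := ENNReal.pow_ne_top ENNReal.ofReal_ne_top
  rw [h1, enorm_mul, h2, mul_pow]
  calc ENNReal.ofReal h ^ d * ((ENNReal.ofReal h ^ d)⁻¹ ^ 2 * ‖∫ y in Q, (f x - f y)‖ₑ ^ 2)
      ≤ ENNReal.ofReal h ^ d * ((ENNReal.ofReal h ^ d)⁻¹ ^ 2 *
        ((∫⁻ y in Q, ‖f x - f y‖ₑ ^ 2) * ENNReal.ofReal h ^ d)) := by gcongr
    _ = (ENNReal.ofReal h ^ d * (ENNReal.ofReal h ^ d)⁻¹) ^ 2 *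
        ∫⁻ y in Q, ‖f x - f y‖ₑ ^ 2 := by ring
    _ = _ := by rw [ENNReal.mul_inv_cancel hV0 hVt]; simp

/-- The distance in `L²` from `f` to its averages over cubes of side `h`. -/
theorem lintegral_sub_mean_sq_le (hf : IsTest Ω f) (hh : 0 < h) :
    ∫⁻ x, ‖f x - ((h ^ d)⁻¹ : ℝ) * ∫ y in cube h (cell h x), f y‖ₑ ^ 2 ≤
      ENNReal.ofReal (2 ^ d * d * h ^ 2) * ∑ i, ∫⁻ x, ‖pd i f x‖ₑ ^ 2 := by
  have hV0 : ENNReal.ofReal h ^ d ≠ 0 := by simp [hh]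
  have hVt : ENNReal.ofReal h ^ d ≠ ⊤ := ENNReal.pow_ne_top ENNReal.ofReal_ne_top
  refine (ENNReal.mul_le_mul_iff_right hV0 hVt).1 ?_
  rw [← lintegral_const_mul' _ _ hVt]
  refine (lintegral_mono fun x => enorm_sub_mean_sq_le hf hh x).trans
    ((lintegral_oscillation_le hf hh).trans_eq ?_)
  rw [← mul_assoc, ← mul_assoc, ← ENNReal.ofReal_pow (by positivity),
    ← ENNReal.ofReal_mul (by positivity), ← ENNReal.ofReal_pow hh.le,
    ← ENNReal.ofReal_mul (by positivity)]
  congr 2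
  rw [mul_pow]
  ring

/-- Averaging over the cubes of side `h` that meet `Ω` is an operator of finite rank. -/
theorem exists_mean_operator (hΩ : Bornology.IsBounded Ω) (hΩm : MeasurableSet Ω) (hh : 0 < h) :
    ∃ T : L2 Ω →L[ℂ] L2 Ω, IsCompactOperator T ∧ ∀ f, IsTest Ω f → ∀ w : L2 Ω,
      w =ᵐ[volume.restrict Ω] f → T w =ᵐ[volume.restrict Ω]
        fun x => ((h ^ d)⁻¹ : ℝ) * ∫ y in cube h (cell h x), f y := by
  let F : Finset (Fin d → ℤ) := (finite_cell_image hΩ hh).toFinset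
  have hfin : ∀ k, volume.restrict Ω (cube h k) ≠ ⊤ := fun k =>
    ((Measure.restrict_apply_le _ _).trans_lt (volume_cube_ne_top hh k).lt_top).ne
  let v : (Fin d → ℤ) → L2 Ω := fun k =>
    indicatorConstLp 2 (measurableSet_cube hh k) (hfin k) (1 : ℂ)
  let T : L2 Ω →L[ℂ] L2 Ω :=
    ∑ k ∈ F, (ContinuousLinearMap.toSpanSingleton ℂ ((((h ^ d)⁻¹ : ℝ) : ℂ) • v k)).comp
      (innerSL ℂ (v k))
  have hT : ∀ w, T w = ∑ k ∈ F, (inner ℂ (v k) w * (((h ^ d)⁻¹ : ℝ) : ℂ)) • v k := fun w => by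
    simp [T, smul_smul]
  refine ⟨T, ?_, fun f hf w hw => ?_⟩
  · have : T ∈ compactOperator (RingHom.id ℂ) (L2 Ω) (L2 Ω) :=
      Submodule.sum_mem _ fun k _ =>
        (isCompactOperator_of_locallyCompactSpace_rng
          (ContinuousLinearMap.toSpanSingleton ℂ ((((h ^ d)⁻¹ : ℝ) : ℂ) • v k))).comp_clm
          (innerSL ℂ (v k))
    exact this
  · have hin : ∀ k, inner ℂ (v k) w = ∫ y in cube h k, f y := fun k => by
      rw [L2.inner_indicatorConstLp_one, setIntegral_congr_ae (measurableSet_cube hh k)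
        (hw.mono fun x hx _ => hx), Measure.restrict_restrict (measurableSet_cube hh k)]
      exact (setIntegral_eq_of_subset_of_forall_sdiff_eq_zero (measurableSet_cube hh k)
        Set.inter_subset_left fun x hx => hf.apply_eq_zero fun hxΩ => hx.2 ⟨hx.1, hxΩ⟩).symm
    have hv : ∀ k, ⇑((inner ℂ (v k) w * (((h ^ d)⁻¹ : ℝ) : ℂ)) • v k) =ᵐ[volume.restrict Ω]
        fun x => (inner ℂ (v k) w * (((h ^ d)⁻¹ : ℝ) : ℂ)) *
          (cube h k).indicator (fun _ => (1 : ℂ)) x := fun k => by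
      filter_upwards [Lp.coeFn_smul (inner ℂ (v k) w * (((h ^ d)⁻¹ : ℝ) : ℂ)) (v k),
        (indicatorConstLp_coeFn (p := 2) (hs := measurableSet_cube hh k) (hμs := hfin k)
          (c := (1 : ℂ)))] with x h1 h2
      rw [h1, Pi.smul_apply, h2, smul_eq_mul]
    rw [hT]
    filter_upwards [Lp.coeFn_finsetSum F fun k =>
      (inner ℂ (v k) w * (((h ^ d)⁻¹ : ℝ) : ℂ)) • v k, ae_all_iff.2 hv,
      ae_restrict_mem hΩm] with x h1 h2 hx
    rw [h1, Finset.sum_apply, Finset.sum_congr rfl fun k _ => h2 k,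
      Finset.sum_eq_single (cell h x)]
    · rw [Set.indicator_of_mem (mem_cube.2 rfl), mul_one, hin, mul_comm]
    · intro k _ hk
      rw [Set.indicator_of_notMem fun h3 => hk (mem_cube.1 h3).symm, mul_zero]
    · intro h3
      exact absurd ((finite_cell_image hΩ hh).mem_toFinset.2 ⟨x, hx, rfl⟩) h3

end Cubes

/-! ### Test functions in `L²` -/

section TestL2

open scoped ENNReal ComplexConjugate

variable {d : ℕ} {Ω : Set (EuclideanSpace ℝ (Fin d))} {f g : EuclideanSpace ℝ (Fin d) → ℂ}

theorem IsTest.memLp (hf : IsTest Ω f) : MemLp f 2 (volume.restrict Ω) :=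
  (hf.continuous.memLp_of_hasCompactSupport hf.2.1).restrict Ω

/-- The class of a test function in `L²(Ω)`. -/
def IsTest.toL2 (hf : IsTest Ω f) : L2 Ω := hf.memLp.toLp f

theorem IsTest.coeFn_toL2 (hf : IsTest Ω f) : hf.toL2 =ᵐ[volume.restrict Ω] f :=
  hf.memLp.coeFn_toLp

theorem IsTest.eq_toL2 (hf : IsTest Ω f) {w : L2 Ω} (hw : w =ᵐ[volume.restrict Ω] f) :
    w = hf.toL2 :=
  Lp.ext (hw.trans hf.coeFn_toL2.symm)

theorem enorm_sq_eq_lintegral {w : L2 Ω} {f : EuclideanSpace ℝ (Fin d) → ℂ}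
    (hw : w =ᵐ[volume.restrict Ω] f) : ‖w‖ₑ ^ 2 = ∫⁻ x in Ω, ‖f x‖ₑ ^ 2 := by
  have h := eLpNorm_nnreal_pow_eq_lintegral (f := f) (μ := volume.restrict Ω) (p := 2) two_ne_zero
  simp only [NNReal.coe_ofNat, ENNReal.rpow_two] at h
  rw [Lp.enorm_def, eLpNorm_congr_ae hw]
  exact h

theorem IsTest.enorm_toL2_sq (hΩ : MeasurableSet Ω) (hf : IsTest Ω f) :
    ‖hf.toL2‖ₑ ^ 2 = ∫⁻ x, ‖f x‖ₑ ^ 2 := by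
  rw [enorm_sq_eq_lintegral hf.coeFn_toL2, ← lintegral_indicator hΩ]
  refine lintegral_congr fun x => ?_
  by_cases hx : x ∈ Ω
  · rw [Set.indicator_of_mem hx]
  · rw [Set.indicator_of_notMem hx, hf.apply_eq_zero hx]
    simp

theorem norm_sq_le_of_enorm_sq_le {E ι : Type*} [NormedAddCommGroup E] [Fintype ι] {w : E}
    {v : ι → E} {c : ℝ} (hc : 0 ≤ c) (h : ‖w‖ₑ ^ 2 ≤ ENNReal.ofReal c * ∑ i, ‖v i‖ₑ ^ 2) :
    ‖w‖ ^ 2 ≤ c * ∑ i, ‖v i‖ ^ 2 := by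
  simp only [← ofReal_norm, ← ENNReal.ofReal_pow (norm_nonneg _)] at h
  rw [← ENNReal.ofReal_sum_of_nonneg (fun i _ => by positivity), ← ENNReal.ofReal_mul hc] at h
  exact (ENNReal.ofReal_le_ofReal_iff (by positivity)).1 h

theorem exists_norm_toL2_le (hd : 0 < d) (hΩ : Bornology.IsBounded Ω) (hΩm : MeasurableSet Ω) :
    ∃ C : ℝ, 0 ≤ C ∧ ∀ f, ∀ hf : IsTest Ω f,
      ‖hf.toL2‖ ^ 2 ≤ C * ∑ i, ‖(hf.pd i).toL2‖ ^ 2 := by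
  obtain ⟨C, hC, h⟩ := exists_poincare hd hΩ
  refine ⟨C ^ 2, sq_nonneg C, fun f hf => norm_sq_le_of_enorm_sq_le (sq_nonneg C) ?_⟩
  simp only [IsTest.enorm_toL2_sq hΩm, ENNReal.ofReal_pow hC]
  exact h f hf

/-- The operators of finite rank approximate the identity on test functions, uniformly with
respect to the norm of the gradient. -/
theorem exists_compact_approx (hΩ : Bornology.IsBounded Ω) (hΩm : MeasurableSet Ω) {ε : ℝ}
    (hε : 0 < ε) :
    ∃ T : L2 Ω →L[ℂ] L2 Ω, IsCompactOperator T ∧ ∀ f, ∀ hf : IsTest Ω f,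
      ‖hf.toL2 - T hf.toL2‖ ^ 2 ≤ ε ^ 2 * ∑ i, ‖(hf.pd i).toL2‖ ^ 2 := by
  -- the side of the cubes is chosen so that `2 ^ d * d * h ^ 2 ≤ ε ^ 2`
  let h : ℝ := ε / √(2 ^ d * d + 1)
  have hh : 0 < h := by positivity
  have hhε : 2 ^ d * d * h ^ 2 ≤ ε ^ 2 := by
    rw [div_pow, Real.sq_sqrt (by positivity), ← mul_div_assoc, div_le_iff₀ (by positivity)]
    nlinarith [sq_nonneg ε]
  obtain ⟨T, hT, h1⟩ := exists_mean_operator hΩ hΩm hh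
  refine ⟨T, hT, fun f hf => norm_sq_le_of_enorm_sq_le (sq_nonneg ε) ?_⟩
  have h2 : ⇑(hf.toL2 - T hf.toL2) =ᵐ[volume.restrict Ω]
      fun x => f x - ((h ^ d)⁻¹ : ℝ) * ∫ y in cube h (cell h x), f y := by
    filter_upwards [Lp.coeFn_sub hf.toL2 (T hf.toL2), hf.coeFn_toL2,
      h1 f hf _ hf.coeFn_toL2] with x h3 h4 h5
    rw [h3, Pi.sub_apply, h4, h5]
  rw [enorm_sq_eq_lintegral h2]
  simp only [IsTest.enorm_toL2_sq hΩm]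
  calc _ ≤ _ := setLIntegral_le_lintegral _ _
    _ ≤ _ := lintegral_sub_mean_sq_le hf hh
    _ ≤ _ := by gcongr

theorem inner_toL2 (hf : IsTest Ω f) (hg : IsTest Ω g) :
    inner ℂ hf.toL2 hg.toL2 = ∫ x, conj (f x) * g x := by
  rw [L2.inner_def, integral_congr_ae (g := fun x => conj (f x) * g x)]
  · refine setIntegral_eq_integral_of_forall_compl_eq_zero fun x hx => ?_
    rw [hg.apply_eq_zero hx, mul_zero]
  · filter_upwards [hf.coeFn_toL2, hg.coeFn_toL2] with x h1 h2
    rw [h1, h2, RCLike.inner_apply, mul_comm]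

/-- Integration by parts. -/
theorem inner_toL2_pd (hf : IsTest Ω f) (hg : IsTest Ω g) (i : Fin d) :
    inner ℂ hf.toL2 (hg.pd i).toL2 = -inner ℂ (hf.pd i).toL2 hg.toL2 := by
  rw [inner_toL2, inner_toL2]
  have hconj : ∀ x v, fderiv ℝ (fun y => conj (f y)) x v = conj (fderiv ℝ f x v) := fun x v => by
    have h1 := (Complex.conjCLE : ℂ →L[ℝ] ℂ).hasFDerivAt.comp x (hf.differentiable x).hasFDerivAt
    have h2 : (fun y => conj (f y)) = (Complex.conjCLE : ℂ →L[ℝ] ℂ) ∘ f := rfl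
    rw [h2, h1.fderiv]
    rfl
  have hint : ∀ {f g : EuclideanSpace ℝ (Fin d) → ℂ}, IsTest Ω f → IsTest Ω g →
      Integrable fun x => conj (f x) * g x := fun hf hg =>
    ((Complex.continuous_conj.comp hf.continuous).mul hg.continuous
      ).integrable_of_hasCompactSupport hg.2.1.mul_left
  have h := integral_mul_fderiv_eq_neg_fderiv_mul_of_integrable
    (μ := (volume : Measure (EuclideanSpace ℝ (Fin d)))) (f := fun y => conj (f y)) (g := g)
    (v := EuclideanSpace.single i 1) (by simp only [hconj]; exact hint (hf.pd i) hg)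
    (hint hf (hg.pd i)) (hint hf hg)
    (fun x _ => (Complex.conjCLE : ℂ →L[ℝ] ℂ).differentiableAt.comp x (hf.differentiable x))
    (fun x _ => hg.differentiable x)
  simp only [hconj] at h
  exact h

theorem pd_comm (hf : ContDiff ℝ ∞ f) (i j : Fin d) : pd i (pd j f) = pd j (pd i f) := by
  have h : ∀ a b : Fin d, ∀ x, pd a (pd b f) x = fderiv ℝ (fderiv ℝ f) x
      (EuclideanSpace.single a 1) (EuclideanSpace.single b 1) := fun a b x => by
    have h1 : DifferentiableAt ℝ (fderiv ℝ f) x :=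
      (hf.fderiv_right (m := ∞) (by simp)).differentiable (by simp) x
    have h2 := h1.hasFDerivAt.clm_apply
      (hasFDerivAt_const (EuclideanSpace.single b (1 : ℝ) : EuclideanSpace ℝ (Fin d)) x)
    have h3 : pd b f = fun y => fderiv ℝ f y (EuclideanSpace.single b 1) := rfl
    rw [pd, h3, h2.fderiv]
    simp
  funext x
  rw [h, h]
  exact (hf.contDiffAt.isSymmSndFDerivAt (by
    rw [minSmoothness_of_isRCLikeNormedField]; exact WithTop.coe_le_coe.2 le_top)).eq _ _

/-- All second derivatives are controlled by the Laplacian: `∑ ‖∂ᵢ∂ⱼf‖² = ‖Δf‖²`. -/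
theorem sum_norm_hessian_sq (hf : IsTest Ω f) :
    ∑ ij : Fin d × Fin d, ‖((hf.pd ij.2).pd ij.1).toL2‖ ^ 2 =
      ‖∑ i, ((hf.pd i).pd i).toL2‖ ^ 2 := by
  have h : ∀ i j, inner ℂ ((hf.pd j).pd i).toL2 ((hf.pd j).pd i).toL2 =
      inner ℂ ((hf.pd i).pd i).toL2 ((hf.pd j).pd j).toL2 := fun i j => by
    rw [inner_toL2_pd _ (hf.pd j) i, inner_toL2_pd _ (hf.pd j) j]
    have h1 : pd i (pd i (pd j f)) = pd j (pd i (pd i f)) := by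
      rw [pd_comm hf.1, pd_comm (hf.pd i).1]
    have h2 : (((hf.pd j).pd i).pd i).toL2 = (((hf.pd i).pd i).pd j).toL2 :=
      IsTest.eq_toL2 _ (by rw [← h1]; exact IsTest.coeFn_toL2 _)
    rw [h2]
  have h3 : ((∑ ij : Fin d × Fin d, ‖((hf.pd ij.2).pd ij.1).toL2‖ ^ 2 : ℝ) : ℂ) =
      ((‖∑ i, ((hf.pd i).pd i).toL2‖ ^ 2 : ℝ) : ℂ) := by
    have h5 : ∀ w : L2 Ω, ((‖w‖ : ℂ)) ^ 2 = inner ℂ w w := fun w =>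
      (inner_self_eq_norm_sq_to_K (𝕜 := ℂ) w).symm
    push_cast
    simp only [h5, sum_inner, inner_sum, Fintype.sum_prod_type]
    rw [Finset.sum_comm]
    exact Finset.sum_congr rfl fun i _ => Finset.sum_congr rfl fun j _ => by
      rw [h]
  exact_mod_cast h3

/-- Test functions are dense in `L²(Ω)`; boundedness of `Ω` makes `v` integrable. -/
theorem eq_zero_of_forall_inner_toL2 (hΩo : IsOpen Ω) (hΩ : Bornology.IsBounded Ω) {v : L2 Ω}
    (h : ∀ f, ∀ hf : IsTest Ω f, inner ℂ hf.toL2 v = 0) : v = 0 := by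
  have hfin : IsFiniteMeasure (volume.restrict Ω) :=
    isFiniteMeasure_restrict.2 hΩ.measure_lt_top.ne
  have hint : IntegrableOn v Ω := (Lp.memLp v).integrable (by norm_num)
  have h1 := hΩo.ae_eq_zero_of_integral_contDiff_smul_eq_zero
    (μ := (volume : Measure (EuclideanSpace ℝ (Fin d)))) (f := v)
    (hint.locallyIntegrableOn) fun g hg hgc hgΩ => by
      have htest : IsTest Ω fun x => (g x : ℂ) := by
        refine ⟨Complex.ofRealCLM.contDiff.comp hg, hgc.comp_left (g := fun r : ℝ => (r : ℂ))
          Complex.ofReal_zero, (closure_mono ?_).trans hgΩ⟩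
        intro x hx
        simpa using hx
      have h2 := h _ htest
      rw [L2.inner_def, integral_congr_ae (g := fun x => g x • v x)] at h2
      · rw [← h2]
        refine (setIntegral_eq_integral_of_forall_compl_eq_zero fun x hx => ?_).symm
        have h3 : g x = 0 := by exact_mod_cast htest.apply_eq_zero hx
        rw [h3, zero_smul]
      · filter_upwards [htest.coeFn_toL2] with x h3
        rw [h3, RCLike.inner_apply, Complex.real_smul, mul_comm]
        simp
  refine Lp.ext ?_
  have h2 := (ae_restrict_iff' hΩo.measurableSet).2 h1
  filter_upwards [h2, Lp.coeFn_zero ℂ 2 (volume.restrict Ω)] with x h3 h4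
  rw [h3, h4, Pi.zero_apply]

/-- The indicators of infinitely many disjoint open subsets of `Ω` are linearly independent. -/
theorem not_finiteDimensional_L2 (hd : 0 < d) (hΩo : IsOpen Ω) (hΩne : Ω.Nonempty)
    (hΩ : Bornology.IsBounded Ω) : ¬ FiniteDimensional ℂ (L2 Ω) := by
  have : Nonempty (Fin d) := ⟨⟨0, hd⟩⟩
  obtain ⟨x₀, hx₀⟩ := hΩne
  have hinf : Infinite Ω := (infinite_of_mem_nhds x₀ (hΩo.mem_nhds hx₀)).to_subtype
  obtain ⟨U, hUi, hUo, hUd⟩ := exists_seq_infinite_isOpen_pairwise_disjoint Ω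
  let V : ℕ → Set (EuclideanSpace ℝ (Fin d)) := fun n => Subtype.val '' U n
  have hVo : ∀ n, IsOpen (V n) := fun n => hΩo.isOpenMap_subtype_val _ (hUo n)
  have hVΩ : ∀ n, V n ⊆ Ω := fun n => by rintro _ ⟨x, _, rfl⟩; exact x.2
  have hVd : ∀ m n, m ≠ n → V m ∩ V n = ∅ := fun m n hmn => by
    rw [← Set.disjoint_iff_inter_eq_empty]
    exact (Set.disjoint_image_iff Subtype.val_injective).2 (hUd hmn)
  have hV : ∀ n, volume.restrict Ω (V n) = volume (V n) := fun n => by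
    rw [Measure.restrict_apply (hVo n).measurableSet, Set.inter_eq_left.2 (hVΩ n)]
  have hVfin : ∀ n, volume.restrict Ω (V n) ≠ ⊤ := fun n => by
    rw [hV]
    exact (hΩ.subset (hVΩ n)).measure_lt_top.ne
  have hVpos : ∀ n, volume (V n) ≠ 0 := fun n =>
    ((hVo n).measure_pos _ ((hUi n).nonempty.image _)).ne'
  let v : ℕ → L2 Ω := fun n => indicatorConstLp 2 (hVo n).measurableSet (hVfin n) (1 : ℂ)
  have hv0 : ∀ n, v n ≠ 0 := fun n h0 => by
    have h1 : ‖v n‖ = 0 := by rw [h0, norm_zero]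
    rw [norm_indicatorConstLp two_ne_zero ENNReal.ofNat_ne_top, norm_one, one_mul,
      Real.rpow_eq_zero measureReal_nonneg (by norm_num), measureReal_eq_zero_iff (hVfin n),
      hV] at h1
    exact hVpos n h1
  have horth : Pairwise fun m n => inner ℂ (v m) (v n) = 0 := fun m n hmn => by
    change inner ℂ (indicatorConstLp 2 (hVo m).measurableSet (hVfin m) (1 : ℂ)) (v n) = 0
    rw [L2.inner_indicatorConstLp_one, setIntegral_congr_ae (g := fun _ => 0) (hVo m).measurableSet]
    · simp
    · filter_upwards [indicatorConstLp_coeFn (p := 2) (hs := (hVo n).measurableSet)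
        (hμs := hVfin n) (c := (1 : ℂ))] with x h1 h2
      rw [h1, Set.indicator_of_notMem]
      intro h3
      have h4 : x ∈ V m ∩ V n := ⟨h2, h3⟩
      rw [hVd m n hmn] at h4
      exact h4
  intro hfd
  have hli := linearIndependent_of_ne_zero_of_inner_eq_zero (𝕜 := ℂ) hv0 horth
  have := hli.finite
  exact not_finite ℕ

end TestL2

/-! ### Ellipticity of the wave and plate models -/

section Sobolev

variable {d : ℕ} {Ω : Set (EuclideanSpace ℝ (Fin d))}

/-- A closed condition holds on `H¹₀(Ω)` if it holds for the jets of test functions. -/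
theorem H10_forall {p : Jet1 Ω → Prop} (hcl : IsClosed {w | p w})
    (h : ∀ w : Jet1 Ω, ∀ f, ∀ hf : IsTest Ω f, w.fst = hf.toL2 → (∀ i, w.snd i = (hf.pd i).toL2) →
      p w) (u : H10 Ω) : p u :=
  closure_minimal (s := (testJet1 Ω : Set (Jet1 Ω))) (t := {w | p w})
    (by rintro w ⟨f, hf, h0, h1⟩; exact h w f hf (hf.eq_toL2 h0) fun i => IsTest.eq_toL2 _ (h1 i))
    hcl u.2

/-- A closed condition holds on `H²₀(Ω)` if it holds for the jets of test functions. -/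
theorem H20_forall {p : Jet2 Ω → Prop} (hcl : IsClosed {w | p w})
    (h : ∀ w : Jet2 Ω, ∀ f, ∀ hf : IsTest Ω f, w.fst = hf.toL2 →
      (∀ i, w.snd.fst i = (hf.pd i).toL2) →
      (∀ ij, w.snd.snd ij = ((hf.pd ij.2).pd ij.1).toL2) → p w) (u : H20 Ω) : p u :=
  closure_minimal (s := (testJet2 Ω : Set (Jet2 Ω))) (t := {w | p w})
    (by
      rintro w ⟨f, hf, h0, h1, h2⟩
      exact h w f hf (hf.eq_toL2 h0) (fun i => IsTest.eq_toL2 _ (h1 i))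
        fun ij => IsTest.eq_toL2 _ (h2 ij))
    hcl u.2

theorem toL2_mem_range_emb1 {f : EuclideanSpace ℝ (Fin d) → ℂ} (hf : IsTest Ω f) :
    hf.toL2 ∈ Set.range (emb1 Ω) :=
  ⟨⟨WithLp.toLp 2 (hf.toL2, WithLp.toLp 2 fun i => (hf.pd i).toL2),
    (testJet1 Ω).le_topologicalClosure
      ⟨f, hf, hf.coeFn_toL2, fun i => (hf.pd i).coeFn_toL2⟩⟩, rfl⟩

theorem toL2_mem_range_emb2 {f : EuclideanSpace ℝ (Fin d) → ℂ} (hf : IsTest Ω f) :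
    hf.toL2 ∈ Set.range (emb2 Ω) :=
  ⟨⟨WithLp.toLp 2 (hf.toL2, WithLp.toLp 2 (WithLp.toLp 2 fun i => (hf.pd i).toL2,
      WithLp.toLp 2 fun ij => ((hf.pd ij.2).pd ij.1).toL2)),
    (testJet2 Ω).le_topologicalClosure
      ⟨f, hf, hf.coeFn_toL2, fun i => (hf.pd i).coeFn_toL2,
        fun ij => ((hf.pd ij.2).pd ij.1).coeFn_toL2⟩⟩, rfl⟩

theorem denseRange_of_toL2_mem (hΩo : IsOpen Ω) (hΩ : Bornology.IsBounded Ω) {W : Type*}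
    [NormedAddCommGroup W] [InnerProductSpace ℂ W] {J : W →L[ℂ] L2 Ω}
    (h : ∀ f, ∀ hf : IsTest Ω f, hf.toL2 ∈ Set.range J) : DenseRange J := by
  have h1 : Dense (J.range : Set (L2 Ω)) := by
    rw [Submodule.dense_iff_topologicalClosure_eq_top, Submodule.topologicalClosure_eq_top_iff,
      Submodule.eq_bot_iff]
    intro v hv
    refine eq_zero_of_forall_inner_toL2 hΩo hΩ fun f hf => ?_
    obtain ⟨u, hu⟩ := h f hf
    rw [← hu]
    exact (Submodule.mem_orthogonal _ _).1 hv _ ⟨u, rfl⟩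
  exact h1

/-- An operator is compact if it can be approximated through `L²` operators of finite rank. -/
theorem isCompactOperator_of_approx {W : Type*} [NormedAddCommGroup W] [InnerProductSpace ℂ W]
    {J : W →L[ℂ] L2 Ω}
    (h : ∀ ε : ℝ, 0 < ε → ∃ T : L2 Ω →L[ℂ] L2 Ω, IsCompactOperator T ∧
      ∀ u, ‖J u - T (J u)‖ ≤ ε * ‖u‖) : IsCompactOperator J := by
  choose T hT hTJ using fun n : ℕ => h (1 / ((n : ℝ) + 1)) (by positivity)
  refine isCompactOperator_of_tendsto (l := atTop) (F := fun n => (T n).comp J) ?_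
    (Eventually.of_forall fun n => (hT n).comp_clm J)
  rw [tendsto_iff_norm_sub_tendsto_zero]
  refine squeeze_zero (fun n => norm_nonneg _) (fun n => ?_) tendsto_one_div_add_atTop_nhds_zero_nat
  refine ContinuousLinearMap.opNorm_le_bound _ (by positivity) fun u => ?_
  have h1 := hTJ n u
  rw [norm_sub_rev] at h1
  exact h1

theorem jet1_norm_sq (w : Jet1 Ω) : ‖w‖ ^ 2 = ‖w.fst‖ ^ 2 + ∑ i, ‖w.snd i‖ ^ 2 := by
  rw [WithLp.prod_norm_sq_eq_of_L2, PiLp.norm_sq_eq_of_L2]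

theorem jet2_norm_sq (w : Jet2 Ω) :
    ‖w‖ ^ 2 = ‖w.fst‖ ^ 2 + (∑ i, ‖w.snd.fst i‖ ^ 2 + ∑ ij, ‖w.snd.snd ij‖ ^ 2) := by
  rw [WithLp.prod_norm_sq_eq_of_L2, WithLp.prod_norm_sq_eq_of_L2, PiLp.norm_sq_eq_of_L2,
    PiLp.norm_sq_eq_of_L2]

theorem continuous_jet1_fst : Continuous fun w : Jet1 Ω => w.fst :=
  (WithLp.fstL 2 ℂ (L2 Ω) (PiLp 2 fun _ : Fin d => L2 Ω)).continuous

theorem continuous_jet1_snd (i : Fin d) : Continuous fun w : Jet1 Ω => w.snd i :=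
  ((PiLp.proj 2 (𝕜 := ℂ) (fun _ : Fin d => L2 Ω) i).comp
    (WithLp.sndL 2 ℂ (L2 Ω) (PiLp 2 fun _ : Fin d => L2 Ω))).continuous

theorem continuous_jet2_fst : Continuous fun w : Jet2 Ω => w.fst :=
  (WithLp.fstL 2 ℂ (L2 Ω) (WithLp 2 (PiLp 2 (fun _ : Fin d => L2 Ω) ×
    PiLp 2 (fun _ : Fin d × Fin d => L2 Ω)))).continuous

theorem continuous_jet2_snd_fst (i : Fin d) : Continuous fun w : Jet2 Ω => w.snd.fst i :=
  ((PiLp.proj 2 (𝕜 := ℂ) (fun _ : Fin d => L2 Ω) i).comp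
    ((WithLp.fstL 2 ℂ (PiLp 2 fun _ : Fin d => L2 Ω) (PiLp 2 fun _ : Fin d × Fin d => L2 Ω)).comp
    (WithLp.sndL 2 ℂ (L2 Ω) (WithLp 2 (PiLp 2 (fun _ : Fin d => L2 Ω) ×
    PiLp 2 (fun _ : Fin d × Fin d => L2 Ω)))))).continuous

theorem continuous_jet2_snd_snd (ij : Fin d × Fin d) :
    Continuous fun w : Jet2 Ω => w.snd.snd ij :=
  ((PiLp.proj 2 (𝕜 := ℂ) (fun _ : Fin d × Fin d => L2 Ω) ij).comp
    ((WithLp.sndL 2 ℂ (PiLp 2 fun _ : Fin d => L2 Ω) (PiLp 2 fun _ : Fin d × Fin d => L2 Ω)).comp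
    (WithLp.sndL 2 ℂ (L2 Ω) (WithLp 2 (PiLp 2 (fun _ : Fin d => L2 Ω) ×
    PiLp 2 (fun _ : Fin d × Fin d => L2 Ω)))))).continuous

/-- The function determines its weak gradient, since the two are related by integration by parts
against test functions. -/
theorem emb1_injective (hΩo : IsOpen Ω) (hΩ : Bornology.IsBounded Ω) :
    Function.Injective (emb1 Ω) := by
  rw [injective_iff_map_eq_zero]
  intro u hu
  have hu0 : (u : Jet1 Ω).fst = 0 := hu
  have hu1 : ∀ i, (u : Jet1 Ω).snd i = 0 := fun i =>
    eq_zero_of_forall_inner_toL2 hΩo hΩ fun φ hφ => by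
      have h := H10_forall (p := fun w => inner ℂ hφ.toL2 (w.snd i) =
          -inner ℂ (hφ.pd i).toL2 w.fst)
        (isClosed_eq (continuous_const.inner (continuous_jet1_snd i))
          (continuous_const.inner continuous_jet1_fst).neg)
        (fun w f hf h0 h1 => by rw [h0, h1]; exact inner_toL2_pd hφ hf i) u
      rwa [hu0, inner_zero_right, neg_zero] at h
  refine Subtype.ext (norm_eq_zero.1 (pow_eq_zero_iff two_ne_zero |>.1 ?_))
  simp [jet1_norm_sq, hu0, hu1]

theorem emb2_injective (hΩo : IsOpen Ω) (hΩ : Bornology.IsBounded Ω) :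
    Function.Injective (emb2 Ω) := by
  rw [injective_iff_map_eq_zero]
  intro u hu
  have hu0 : (u : Jet2 Ω).fst = 0 := hu
  have hu1 : ∀ i, (u : Jet2 Ω).snd.fst i = 0 := fun i =>
    eq_zero_of_forall_inner_toL2 hΩo hΩ fun φ hφ => by
      have h := H20_forall (p := fun w => inner ℂ hφ.toL2 (w.snd.fst i) =
          -inner ℂ (hφ.pd i).toL2 w.fst)
        (isClosed_eq (continuous_const.inner (continuous_jet2_snd_fst i))
          (continuous_const.inner continuous_jet2_fst).neg)
        (fun w f hf h0 h1 _ => by rw [h0, h1]; exact inner_toL2_pd hφ hf i) u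
      rwa [hu0, inner_zero_right, neg_zero] at h
  have hu2 : ∀ ij, (u : Jet2 Ω).snd.snd ij = 0 := fun ij =>
    eq_zero_of_forall_inner_toL2 hΩo hΩ fun φ hφ => by
      have h := H20_forall (p := fun w => inner ℂ hφ.toL2 (w.snd.snd ij) =
          -inner ℂ (hφ.pd ij.1).toL2 (w.snd.fst ij.2))
        (isClosed_eq (continuous_const.inner (continuous_jet2_snd_snd ij))
          (continuous_const.inner (continuous_jet2_snd_fst ij.2)).neg)
        (fun w f hf _ h1 h2 => by rw [h1, h2]; exact inner_toL2_pd hφ (hf.pd ij.2) ij.1) u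
      rwa [hu1, inner_zero_right, neg_zero] at h
  refine Subtype.ext (norm_eq_zero.1 (pow_eq_zero_iff two_ne_zero |>.1 ?_))
  simp [jet2_norm_sq, hu0, hu1, hu2]

/-- Rellich's theorem for `H¹₀(Ω)`. -/
theorem waveViscous_emb_isCompactOperator (hΩo : IsOpen Ω) (hΩ : Bornology.IsBounded Ω) :
    IsCompactOperator (waveViscous Ω).emb := by
  have key : ∀ ε : ℝ, 0 < ε → ∃ T : L2 Ω →L[ℂ] L2 Ω, IsCompactOperator T ∧
      ∀ u : H10 Ω, ‖(u : Jet1 Ω).fst - T (u : Jet1 Ω).fst‖ ≤ ε * ‖(u : Jet1 Ω)‖ := by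
    intro ε hε
    obtain ⟨T, hT, h⟩ := exists_compact_approx hΩ hΩo.measurableSet hε
    refine ⟨T, hT, fun u => ?_⟩
    have hcl : IsClosed {w : Jet1 Ω | ‖w.fst - T w.fst‖ ≤ ε * ‖w‖} :=
      isClosed_le (continuous_jet1_fst.sub (T.continuous.comp continuous_jet1_fst)).norm
        (continuous_const.mul continuous_norm)
    refine H10_forall hcl (fun w f hf h0 h1 => ?_) u
    refine le_of_sq_le_sq ?_ (by positivity)
    rw [mul_pow, jet1_norm_sq, h0]
    refine (h f hf).trans ?_
    simp only [h1]
    gcongr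
    exact le_add_of_nonneg_left (sq_nonneg _)
  apply isCompactOperator_of_approx
  exact key

/-- Rellich's theorem for `H²₀(Ω)`. -/
theorem plateViscous_emb_isCompactOperator (hΩo : IsOpen Ω) (hΩ : Bornology.IsBounded Ω) :
    IsCompactOperator (plateViscous Ω).emb := by
  have key : ∀ ε : ℝ, 0 < ε → ∃ T : L2 Ω →L[ℂ] L2 Ω, IsCompactOperator T ∧
      ∀ u : H20 Ω, ‖(u : Jet2 Ω).fst - T (u : Jet2 Ω).fst‖ ≤ ε * ‖(u : Jet2 Ω)‖ := by
    intro ε hε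
    obtain ⟨T, hT, h⟩ := exists_compact_approx hΩ hΩo.measurableSet hε
    refine ⟨T, hT, fun u => ?_⟩
    have hcl : IsClosed {w : Jet2 Ω | ‖w.fst - T w.fst‖ ≤ ε * ‖w‖} :=
      isClosed_le (continuous_jet2_fst.sub (T.continuous.comp continuous_jet2_fst)).norm
        (continuous_const.mul continuous_norm)
    refine H20_forall hcl (fun w f hf h0 h1 _ => ?_) u
    refine le_of_sq_le_sq ?_ (by positivity)
    rw [mul_pow, jet2_norm_sq, h0]
    refine (h f hf).trans ?_
    simp only [h1]
    gcongr
    exact le_add_of_nonneg_of_le (sq_nonneg _) (le_add_of_nonneg_right (by positivity))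
  apply isCompactOperator_of_approx
  exact key

theorem exists_norm_le_grad (hd : 0 < d) (hΩo : IsOpen Ω) (hΩ : Bornology.IsBounded Ω) :
    ∃ C : ℝ, ∀ u : H10 Ω, ‖u‖ ≤ C * ‖grad Ω u‖ := by
  obtain ⟨C, hC, h⟩ := exists_norm_toL2_le hd hΩ hΩo.measurableSet
  refine ⟨√(C + 1), fun u => le_of_sq_le_sq ?_ (by positivity)⟩
  rw [mul_pow, Real.sq_sqrt (by positivity)]
  refine H10_forall (p := fun w => ‖w‖ ^ 2 ≤ (C + 1) * ‖w.snd‖ ^ 2)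
    (isClosed_le (continuous_norm.pow 2) (continuous_const.mul
      ((WithLp.sndL 2 ℂ (L2 Ω) (PiLp 2 fun _ : Fin d => L2 Ω)).continuous.norm.pow 2)))
    (fun w f hf h0 h1 => ?_) u
  rw [jet1_norm_sq, PiLp.norm_sq_eq_of_L2, h0]
  simp only [h1]
  linarith [h f hf]

/-- The Poincaré inequality, applied to `f` and to its first derivatives, reduces the estimate to
`sum_norm_hessian_sq`. -/
theorem exists_norm_le_lap (hd : 0 < d) (hΩo : IsOpen Ω) (hΩ : Bornology.IsBounded Ω) :
    ∃ C : ℝ, ∀ u : H20 Ω, ‖u‖ ≤ C * ‖lap Ω u‖ := by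
  obtain ⟨C, hC, h⟩ := exists_norm_toL2_le hd hΩ hΩo.measurableSet
  refine ⟨√(C * C + C + 1), fun u => le_of_sq_le_sq ?_ (by positivity)⟩
  rw [mul_pow, Real.sq_sqrt (by positivity)]
  have hlap : lap Ω u = ∑ i, (u : Jet2 Ω).snd.snd (i, i) := by
    simp only [lap, _root_.sum_apply]
    rfl
  rw [hlap]
  refine H20_forall (p := fun w => ‖w‖ ^ 2 ≤ (C * C + C + 1) * ‖∑ i, w.snd.snd (i, i)‖ ^ 2)
    (isClosed_le (continuous_norm.pow 2) (continuous_const.mul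
      ((continuous_finsetSum _ fun i _ => continuous_jet2_snd_snd (i, i)).norm.pow 2)))
    (fun w f hf h0 h1 h2 => ?_) u
  rw [jet2_norm_sq, h0]
  simp only [h1, h2]
  rw [← sum_norm_hessian_sq hf]
  have h3 : ∑ i, ‖(hf.pd i).toL2‖ ^ 2 ≤
      C * ∑ ij : Fin d × Fin d, ‖((hf.pd ij.2).pd ij.1).toL2‖ ^ 2 := by
    rw [Fintype.sum_prod_type_right, Finset.mul_sum]
    exact Finset.sum_le_sum fun i _ => h _ (hf.pd i)
  have h4 := mul_le_mul_of_nonneg_left h3 hC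
  linarith [h f hf]

instance : CompleteSpace (H10 Ω) :=
  (testJet1 Ω).isClosed_topologicalClosure.completeSpace_coe

instance : CompleteSpace (H20 Ω) :=
  (testJet2 Ω).isClosed_topologicalClosure.completeSpace_coe

theorem waveViscous_isElliptic (hd : 0 < d) (hΩo : IsOpen Ω) (hΩne : Ω.Nonempty)
    (hΩ : Bornology.IsBounded Ω) : (waveViscous Ω).IsElliptic where
  compact := waveViscous_emb_isCompactOperator hΩo hΩ
  injective := emb1_injective hΩo hΩ
  dense := denseRange_of_toL2_mem hΩo hΩ fun _ => toL2_mem_range_emb1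
  coercive := exists_norm_le_grad hd hΩo hΩ
  infinite := not_finiteDimensional_L2 hd hΩo hΩne hΩ

theorem waveKelvinVoigt_isElliptic (hd : 0 < d) (hΩo : IsOpen Ω) (hΩne : Ω.Nonempty)
    (hΩ : Bornology.IsBounded Ω) : (waveKelvinVoigt Ω).IsElliptic where
  compact := waveViscous_emb_isCompactOperator hΩo hΩ
  injective := emb1_injective hΩo hΩ
  dense := denseRange_of_toL2_mem hΩo hΩ fun _ => toL2_mem_range_emb1
  coercive := exists_norm_le_grad hd hΩo hΩ
  infinite := not_finiteDimensional_L2 hd hΩo hΩne hΩ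

theorem plateViscous_isElliptic (hd : 0 < d) (hΩo : IsOpen Ω) (hΩne : Ω.Nonempty)
    (hΩ : Bornology.IsBounded Ω) : (plateViscous Ω).IsElliptic where
  compact := plateViscous_emb_isCompactOperator hΩo hΩ
  injective := emb2_injective hΩo hΩ
  dense := denseRange_of_toL2_mem hΩo hΩ fun _ => toL2_mem_range_emb2
  coercive := exists_norm_le_lap hd hΩo hΩ
  infinite := not_finiteDimensional_L2 hd hΩo hΩne hΩ

end Sobolev

/-! ### The matrices -/

section Matrices

theorem matA_posSemidef : matA.PosSemidef := by
  refine Matrix.PosSemidef.of_dotProduct_mulVec_nonneg ?_ fun x => ?_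
  · ext i j
    fin_cases i <;> fin_cases j <;> simp [matA]
  · simp [matA, dotProduct, Matrix.mulVec, Fin.sum_univ_two]
    nlinarith [sq_nonneg (x 0), sq_nonneg (x 1)]

theorem matD_posSemidef : matD.PosSemidef := by
  refine Matrix.PosSemidef.of_dotProduct_mulVec_nonneg ?_ fun x => ?_
  · ext i j
    fin_cases i <;> fin_cases j <;> simp [matD]
  · simp [matD, dotProduct, Matrix.mulVec, Fin.sum_univ_two]
    nlinarith [sq_nonneg (x 0 + 2 * x 1)]

theorem matD_det : matD.det = 0 := by
  simp [matD, Matrix.det_fin_two]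
  norm_num

/-- The first columns of `D` and of `A * D` are linearly independent. -/
theorem rank_fromCols_matD : (Matrix.fromCols matD (matA * matD)).rank = 2 := by
  refine le_antisymm ((Matrix.rank_le_card_height _).trans_eq (by simp)) ?_
  -- `R` combines these columns to a diagonal matrix
  let R : Matrix (Fin 2 ⊕ Fin 2) (Fin 2) ℝ := Matrix.fromRows !![2, -1; 0, 0] !![-1, 1; 0, 0]
  have h : Matrix.fromCols matD (matA * matD) * R = !![1, 0; 0, 2] := by
    rw [Matrix.fromCols_mul_fromRows]
    ext i j
    fin_cases i <;> fin_cases j <;>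
      simp [matA, matD] <;> norm_num
  have h2 : (!![1, 0; 0, 2] : Matrix (Fin 2) (Fin 2) ℝ).rank = 2 := by
    rw [Matrix.rank_of_isUnit]
    · simp
    · rw [Matrix.isUnit_iff_isUnit_det]
      simp [Matrix.det_fin_two]
  rw [← h] at h2
  exact h2.symm.trans_le (Matrix.rank_mul_le_left _ _)

/-- The commutator is twice a rotation. -/
theorem norm_commutator : ‖Matrix.toEuclideanCLM (n := Fin 2) (𝕜 := ℝ)
    (matA * matD - matD * matA)‖ = 2 := by
  have h : ∀ x : EuclideanSpace ℝ (Fin 2), ‖Matrix.toEuclideanCLM (n := Fin 2) (𝕜 := ℝ)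
      (matA * matD - matD * matA) x‖ = 2 * ‖x‖ := fun x => by
    rw [← sq_eq_sq₀ (norm_nonneg _) (by positivity), mul_pow, EuclideanSpace.norm_sq_eq,
      EuclideanSpace.norm_sq_eq]
    simp [Matrix.ofLp_toEuclideanCLM, matA, matD, Matrix.mulVec, dotProduct, Fin.sum_univ_two]
    ring
  refine le_antisymm (ContinuousLinearMap.opNorm_le_bound _ (by norm_num) fun x => (h x).le) ?_
  have h1 := ContinuousLinearMap.le_opNorm (Matrix.toEuclideanCLM (n := Fin 2) (𝕜 := ℝ)
    (matA * matD - matD * matA)) (EuclideanSpace.single 0 1)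
  rw [h] at h1
  simpa using h1

end Matrices

end CoupledDamping

end

theorem mainTheorem8 (d : ℕ) (hd : 0 < d) (Ω : Set (EuclideanSpace ℝ (Fin d)))
    (hΩopen : IsOpen Ω) (hΩne : Ω.Nonempty) (hΩbdd : Bornology.IsBounded Ω) :
    -- the matrices
    (CoupledDamping.matA.PosSemidef ∧ CoupledDamping.matD.PosSemidef ∧
      CoupledDamping.matD.det = 0 ∧
      (Matrix.fromCols CoupledDamping.matD
        (CoupledDamping.matA * CoupledDamping.matD)).rank = 2 ∧
      ‖Matrix.toEuclideanCLM (n := Fin 2) (𝕜 := ℝ)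
        (CoupledDamping.matA * CoupledDamping.matD
          - CoupledDamping.matD * CoupledDamping.matA)‖ = 2) ∧
    -- coupled wave equations with viscous damping
    ((CoupledDamping.waveViscous Ω).WellPosed CoupledDamping.matA CoupledDamping.matD ∧
      (∃ (ν : ℕ → ℝ) (β : ℕ → ℂ),
        (CoupledDamping.waveViscous Ω).IsFrequencySequence ν ∧
        (CoupledDamping.waveViscous Ω).IsEigenvalueBranch
          CoupledDamping.matA CoupledDamping.matD ν β ∧
        (fun n => β n - (Complex.I * (ν n + 3 / (5 * ν n)) - 2 / (125 * (ν n : ℂ) ^ 2)))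
          =o[atTop] (fun n => 1 / ν n ^ 2)) ∧
      (CoupledDamping.waveViscous Ω).OptimalRate
        CoupledDamping.matA CoupledDamping.matD (1 / 2)) ∧
    -- coupled plate equations with viscous damping
    ((CoupledDamping.plateViscous Ω).WellPosed CoupledDamping.matA CoupledDamping.matD ∧
      (∃ (ν : ℕ → ℝ) (β : ℕ → ℂ),
        (CoupledDamping.plateViscous Ω).IsFrequencySequence ν ∧
        (CoupledDamping.plateViscous Ω).IsEigenvalueBranch
          CoupledDamping.matA CoupledDamping.matD ν β ∧
        (fun n => β n - (Complex.I * (ν n + 3 / (5 * ν n)) - 2 / (125 * (ν n : ℂ) ^ 2)))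
          =o[atTop] (fun n => 1 / ν n ^ 2)) ∧
      (CoupledDamping.plateViscous Ω).OptimalRate
        CoupledDamping.matA CoupledDamping.matD (1 / 2)) ∧
    -- coupled wave equations with Kelvin-Voigt damping
    ((CoupledDamping.waveKelvinVoigt Ω).WellPosed CoupledDamping.matA CoupledDamping.matD ∧
      (∃ (ν : ℕ → ℝ) (β : ℕ → ℂ),
        (CoupledDamping.waveKelvinVoigt Ω).IsFrequencySequence ν ∧
        (CoupledDamping.waveKelvinVoigt Ω).IsEigenvalueBranch
          CoupledDamping.matA CoupledDamping.matD ν β ∧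
        (fun n => β n - (Complex.I * (ν n + 3 / (5 * ν n) - 9 / (50 * (ν n : ℂ) ^ 3))
            - 2 / (125 * (ν n : ℂ) ^ 4)))
          =o[atTop] (fun n => 1 / ν n ^ 4) ∧
        (fun n => (β n).re + 2 / (125 * ν n ^ 4)) =o[atTop] (fun n => 1 / ν n ^ 5)) ∧
      (CoupledDamping.waveKelvinVoigt Ω).OptimalRate
        CoupledDamping.matA CoupledDamping.matD (1 / 4)) := by
  refine ⟨⟨CoupledDamping.matA_posSemidef, CoupledDamping.matD_posSemidef,
    CoupledDamping.matD_det, CoupledDamping.rank_fromCols_matD,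
    CoupledDamping.norm_commutator⟩, ?_, ?_, ?_⟩
  · exact (CoupledDamping.waveViscous_isElliptic hd hΩopen hΩne hΩbdd).viscous fun _ _ => rfl
  · exact (CoupledDamping.plateViscous_isElliptic hd hΩopen hΩne hΩbdd).viscous fun _ _ => rfl
  · exact (CoupledDamping.waveKelvinVoigt_isElliptic hd hΩopen hΩne hΩbdd).kelvinVoigt
      fun _ _ => rfl
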